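/- **Spinors and momenta.** For spinors $a,b\in\mathbb C^2$ put $(ab)=a_0b_1-a_1b_0$ (unprimed), and use the same formula $[ab]$ for primed spinors. A momentum is a $2\times2$ complex matrix $P_{AA'}$, and $P^2=\det P$. The contractions $(a|P|c]$ and $(a|P|Q|b)$ are linear in each momentum; on null momenta $P=kk'$, $Q=ll'$ they are $(ak)[k'c]$ and $(ak)[k'l'](lb)$. Let a finite set of positive-helicity gravitons $i$ be given, with null momenta $i=\lambda_i\tilde\lambda_i$, and one negative-helicity graviton $1$ with momentum $q\tilde\lambda_1$, where $q$ is also the reference spinor of all positive-helicity gravitons; let $p$ be the reference spinor of graviton $1$. In round brackets $i$ stands for $\lambda_i$, in square brackets for $\tilde\lambda_i$. A set $\mathcal S$ of gravitons also denotes the sum of its momenta. Assume that the denominators do not vanish: $[1p]\ne0$, $\mathcal S^2\neq 0$ for every $\mathcal S$ with $|\mathcal S|\ge2$, and $(1+\mathcal S)^2\ne0$ for every nonempty $\mathcal S$ (all $\mathcal S$ consisting of positive-helicity gravitons). **Currents.** The scalar all-plus current is defined by $J(\{i\})=(qi)^{-4}$ and, for $|\mathcal K|\ge2$, $$J(\mathcal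 K)=\frac1{\mathcal K^2}\sum_{\{\mathcal I,\mathcal J\}}(q|\mathcal I|\mathcal J|q)^2J(\mathcal I)J(\mathcal J),$$ the sum being over unordered partitions of $\mathcal K$ into two nonempty sets. The scalar all-but-one-plus current is defined for nonempty $\mathcal K$ by $$J(1|\mathcal K)=\frac1{(1+\mathcal K)^2}\Big(\frac{(q|\mathcal K|p]^2}{[1p]^2}J(\mathcal K)+\sum_{(\mathcal I,\mathcal J)}(q|\mathcal I|\mathcal J|q)^2J(1|\mathcal I)J(\mathcal J)\Big),$$ the sum being over ordered partitions of $\mathcal K$ into two nonempty sets. **Trees.** For a tree $\Gamma$ with vertex set $\mathcal K$ and valencies $\alpha_i$ put $$J(\Gamma)=\prod_{i\in\mathcal K}(qi)^{2\alpha_i-4}\prod_{\langle jk\rangle\in\Gamma}\frac{[jk]}{(jk)},\qquad \Phi(\Gamma)=\sum_{\Gamma_{\mathcal I}\subseteq\Gamma}\phi(\Gamma_{\mathcal I}),$$ the last sum being over all subtrees of $\Gamma$ (single vertices and $\Gamma$ included). Here $\phi(\Gamma_{\mathcal I})$ is as follows. For one vertex, $$\phi_1(i)=\frac{(qi)[ip]^2}{[1i][1p]^2};$$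 for two vertices joined by an edge, $$\phi_2(ij)=\frac{(q|i|j|q)(q|j|i|q)}{(1+i)^2(1+j)^2(1+i+j)^2};$$ for $|\mathcal I|\ge3$, let $E$ be the number of leaves (vertices of valency one), $\Psi$ the stem (the set of the other vertices), $\Delta$ the multiset that contains each vertex of valency $\alpha>2$ exactly $\alpha-2$ times, and $\delta_1,\dots,\delta_{E-2}$ any enumeration of $\Delta$; then $$\phi(\Gamma_{\mathcal I})=\sum_{\eta}\frac1{(1+\mathcal I)^2}\frac{(q|\eta_1|\Psi|q)}{(1+\Psi)^2}\prod_{j=1}^{E-2}\frac{(q|\eta_{j+1}|1+\Psi+\eta_1+\dots+\eta_j|\delta_j)}{(1+\Psi+\eta_1+\dots+\eta_j)^2(q\delta_j)}\cdot\frac{(q|\eta_E|\Psi+\eta_1+\dots+\eta_{E-1}|q)}{(1+\Psi+\eta_1+\dots+\eta_{E-1})^2},$$ the sum being over all $E!$ orderings $\eta_1,\dots,\eta_E$ of the leaves. **Theorem.** For a tree with at least three vertices, $\Delta$ has exactly $E-2$ elements, and $\phi(\Gamma_{\mathcal I})$ does not depend on the order in which they are enumerated. For every choice of the enumerations, one for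 each tree: 1. For every tree $\Gamma$ on a set $\mathcal K$ of positive-helicity gravitons, $$\Phi(\Gamma)=\frac1{(1+\mathcal K)^2}\Big(\frac{(q|\mathcal K|p]^2}{[1p]^2}+\sum_{\langle ij\rangle\in\Gamma}(q|\mathcal I|\mathcal J|q)\frac{(ij)}{(qi)(jq)}\big(\Phi(\Gamma_{\mathcal I})+\Phi(\Gamma_{\mathcal J})\big)\Big),$$ where $\Gamma_{\mathcal I}\ni i$ and $\Gamma_{\mathcal J}\ni j$ are the two trees into which $\Gamma$ splits when the edge $\langle ij\rangle$ is removed. 2. For every nonempty set $\mathcal K$ of positive-helicity gravitons, $$J(1|\mathcal K)=\sum_{\Gamma_{\mathcal K}}\Phi(\Gamma_{\mathcal K})\,J(\Gamma_{\mathcal K}),$$ the sum being over all spanning trees of the complete graph on $\mathcal K$. -/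

import Mathlib

open Finset

noncomputable section

namespace GravityBG

/-- A two-component spinor (of either chirality). -/
abbrev Spinor := Fin 2 → ℂ

/-- A complexified 4-vector `P_{AA'}`, as a `2 × 2` matrix. -/
abbrev Momentum := Matrix (Fin 2) (Fin 2) ℂ

/-- The spinor metric. -/
def eps : Matrix (Fin 2) (Fin 2) ℂ := !![0, 1; -1, 0]

/-- The spinor contraction, written `(a b)` for unprimed and `[a b]` for primed spinors. -/
def br (a b : Spinor) : ℂ := a ⬝ᵥ (eps.mulVec b)

/-- The contraction `(a|P|c]`; on a null momentum `P = k k'` it is `(a k)[k' c]`. -/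
def sand1 (a : Spinor) (P : Momentum) (c : Spinor) : ℂ :=
  a ⬝ᵥ ((eps * P * eps).mulVec c)

/-- The contraction `(a|P|Q|b)`; on null momenta `P = k k'`, `Q = l l'` it is
`(a k)[k' l'](l b)`. -/
def sand (a : Spinor) (P Q : Momentum) (b : Spinor) : ℂ :=
  a ⬝ᵥ ((eps * P * eps * Q.transpose * eps).mulVec b)

/-- The momentum squared, normalised by `(a|P|P|b) = - P² (a b)`, so that
`(k k' + l l')² = (k l)[k' l']`. -/
def msq (P : Momentum) : ℂ := P.det

/-- The external data: the momentum spinors `lam i`, `lamBar i` of the positive helicity gravitons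
`i`, the primed momentum spinor `oneBar` of the negative helicity graviton `1`, its reference
spinor `p`, and the common reference spinor `q` of the positive helicity gravitons, which is also
the unprimed momentum spinor of graviton `1`. -/
structure SpinorData (ι : Type*) where
  q : Spinor
  oneBar : Spinor
  p : Spinor
  lam : ι → Spinor
  lamBar : ι → Spinor

/-- The complete graph on the positive helicity gravitons, whose subgraphs we sum over. -/
abbrev Graph (ι : Type*) := (⊤ : SimpleGraph ι).Subgraph

section Currents

variable {ι : Type*} (D : SpinorData ι)

/-- The null momentum of the positive helicity graviton `i`. -/
def SpinorData.mom (i : ι) : Momentum := Matrix.vecMulVec (D.lam i) (D.lamBar i)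

/-- The null momentum of the negative helicity graviton `1`. -/
def SpinorData.mom1 : Momentum := Matrix.vecMulVec D.q D.oneBar

/-- The sum of the momenta in `S`. -/
def SpinorData.tot (S : Finset ι) : Momentum := ∑ i ∈ S, D.mom i

/-- The momentum `1 + S`. -/
def SpinorData.tot1 (S : Finset ι) : Momentum := D.mom1 + D.tot S

variable [DecidableEq ι]

/-- The scalar part `J(K)` of the all-plus current, defined by the Berends–Giele recursion
`J({i}) = 1 / (q i)⁴`, `J(K) = (1 / K²) ∑ (q|I|K ∖ I|q)² J(I) J(K ∖ I)`, where the sum runs over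
the unordered splittings of `K` into two nonempty parts: we sum over the ordered ones and halve. -/
def allPlus (K : Finset ι) : ℂ :=
  if K.card = 1 then ∏ i ∈ K, 1 / (br D.q (D.lam i)) ^ 4
  else 1 / msq (D.tot K) * (1 / 2 * ∑ I ∈ (K.ssubsets.erase ∅).attach,
    (sand D.q (D.tot I.1) (D.tot (K \ I.1)) D.q) ^ 2 * allPlus I.1 * allPlus (K \ I.1))
termination_by K.card
decreasing_by
  · have h := I.2
    rw [Finset.mem_erase, Finset.mem_ssubsets] at h
    exact Finset.card_lt_card h.2
  · have h := I.2
    rw [Finset.mem_erase, Finset.mem_ssubsets] at h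
    exact Finset.card_lt_card
      (Finset.sdiff_ssubset h.2.subset (Finset.nonempty_iff_ne_empty.2 h.1))

/-- The scalar part `J(1|K)` of the all-but-one-plus current, defined by the Berends–Giele
recursion
`J(1|K) = (1 / (1 + K)²) ((q|K|p]² / [1p]² J(K) + ∑ (q|I|K ∖ I|q)² J(1|I) J(K ∖ I))`,
the sum being over all nonempty proper subsets `I` of `K`. -/
def allButOnePlus (K : Finset ι) : ℂ :=
  1 / msq (D.tot1 K) *
    ((sand1 D.q (D.tot K) D.p) ^ 2 / (br D.oneBar D.p) ^ 2 * allPlus D K +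
      ∑ I ∈ (K.ssubsets.erase ∅).attach,
        (sand D.q (D.tot I.1) (D.tot (K \ I.1)) D.q) ^ 2 * allButOnePlus I.1 *
          allPlus D (K \ I.1))
termination_by K.card
decreasing_by
  have h := I.2
  rw [Finset.mem_erase, Finset.mem_ssubsets] at h
  exact Finset.card_lt_card h.2

end Currents

section Trees

variable {ι : Type*} [Fintype ι]

/-- `Γ` is a tree on its own vertex set. -/
def IsSubtree (Γ : Graph ι) : Prop := Γ.coe.IsTree

open Classical in
/-- The vertices of `Γ`. -/
def verts (Γ : Graph ι) : Finset ι := Γ.verts.toFinset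

open Classical in
/-- The valency (multiplicity) `α_v` of the vertex `v` of `Γ`. -/
def valency (Γ : Graph ι) (v : ι) : ℕ := Γ.degree v

open Classical in
/-- The set of the spanning trees of the complete graph on `K`. -/
def spanningTrees (K : Finset ι) : Finset (Graph ι) :=
  Finset.univ.filter fun Γ => IsSubtree Γ ∧ verts Γ = K

open Classical in
/-- The set of the trees contained in `Γ`, one-vertex trees and `Γ` itself included. -/
def subtrees (Γ : Graph ι) : Finset (Graph ι) :=
  Finset.univ.filter fun Γ' => IsSubtree Γ' ∧ Γ' ≤ Γ

/-- The leaves (ends) of `Γ`. -/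
def leaves (Γ : Graph ι) : Finset ι := (verts Γ).filter fun v => valency Γ v = 1

/-- The number `E` of ends of `Γ`. -/
def numEnds (Γ : Graph ι) : ℕ := (leaves Γ).card

/-- The stem `Ψ`: the vertices of `Γ` that are not leaves. -/
def stem (Γ : Graph ι) : Finset ι := (verts Γ).filter fun v => valency Γ v ≠ 1

/-- The multiset `Δ`: each vertex `v` of valency `α_v > 2`, taken `α_v - 2` times. -/
def delta (Γ : Graph ι) : Multiset ι :=
  ∑ v ∈ verts Γ, Multiset.replicate (valency Γ v - 2) v

/-- `δ` lists the elements of `Δ`, with their multiplicities, as `δ_1, …, δ_{E-2}`. -/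
def IsDeltaEnumeration (Γ : Graph ι) (δ : Fin (numEnds Γ - 2) → ι) : Prop :=
  Finset.univ.val.map δ = delta Γ

open Classical in
/-- The vertices `Ψ ∪ {η_1, …, η_j}` present after `j` ends have been added to the stem. -/
def grown (Γ : Graph ι) (η : Fin (numEnds Γ) ≃ leaves Γ) (j : ℕ) : Finset ι :=
  stem Γ ∪ (Finset.univ.filter fun k : Fin (numEnds Γ) => (k : ℕ) < j).image fun k => (η k : ι)

/-- The part of the tree `Γ` on the side of `v` after the edge `v w` has been removed. -/
def branch (Γ : Graph ι) (v w : ι) : Graph ι :=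
  Γ.induce {x | (Γ.deleteEdges {s(v, w)}).spanningCoe.Reachable v x}

end Trees

section Weights

variable {ι : Type*} (D : SpinorData ι)

/-- The factor `[j k] / (j k)` of an edge. -/
def edgeWeight (e : Sym2 ι) : ℂ :=
  Sym2.lift ⟨fun j k => br (D.lamBar j) (D.lamBar k) / br (D.lam j) (D.lam k), by
    intro j k
    have h : ∀ a b : Spinor, br a b = -br b a := by
      intro a b
      simp only [br, eps, Matrix.mulVec, dotProduct, Fin.sum_univ_two, Matrix.of_apply,
        Matrix.cons_val_zero, Matrix.cons_val_one, Matrix.cons_val', Matrix.cons_val_fin_one]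
      ring
    beta_reduce
    rw [h (D.lamBar j), h (D.lam j), neg_div_neg_eq]⟩ e

/-- `φ_1(i) = (q i)[i p]² / ([1 i][1 p]²)`. -/
def phi1 (i : ι) : ℂ :=
  br D.q (D.lam i) * (br (D.lamBar i) D.p) ^ 2 /
    (br D.oneBar (D.lamBar i) * (br D.oneBar D.p) ^ 2)

/-- `φ_2(ij) = (q|i|j|q)(q|j|i|q) / ((1+i)² (1+j)² (1+i+j)²)`, for an edge `ij`. -/
def phi2 (e : Sym2 ι) : ℂ :=
  Sym2.lift ⟨fun i j => sand D.q (D.mom i) (D.mom j) D.q * sand D.q (D.mom j) (D.mom i) D.q /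
      (msq (D.mom1 + D.mom i) * msq (D.mom1 + D.mom j) * msq (D.mom1 + (D.mom i + D.mom j))), by
    intro i j
    beta_reduce
    rw [add_comm (D.mom i) (D.mom j)]
    ring⟩ e

variable [Fintype ι]

open Classical in
/-- The weight `J(Γ) = ∏_i (q i)^(2 α_i - 4) ∏_{⟨jk⟩} [j k] / (j k)` of a tree. -/
def treeWeight (Γ : Graph ι) : ℂ :=
  (∏ i ∈ verts Γ, (br D.q (D.lam i)) ^ (2 * (valency Γ i : ℤ) - 4)) *
    ∏ e ∈ Γ.edgeSet.toFinset, edgeWeight D e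

open Classical in
/-- `φ(Γ)` for a tree with at least three vertices and an enumeration `δ` of `Δ`: the sum over all
`E!` orderings `η_1, …, η_E` of the ends. The indices start from `0` here, so `η_{j+1}` of the usual
notation is `η j`. Such a tree always has two ends, so the value `0` is never used. -/
def phiBig (Γ : Graph ι) (δ : Fin (numEnds Γ - 2) → ι) : ℂ :=
  if h : 2 ≤ numEnds Γ then
    ∑ η : Fin (numEnds Γ) ≃ leaves Γ,
      1 / msq (D.tot1 (verts Γ)) *
      (sand D.q (D.mom (η ⟨0, by omega⟩)) (D.tot (stem Γ)) D.q / msq (D.tot1 (stem Γ))) *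
      (∏ j : Fin (numEnds Γ - 2),
        sand D.q (D.mom (η ⟨j + 1, by omega⟩)) (D.tot1 (grown Γ η (j + 1))) (D.lam (δ j)) /
          (msq (D.tot1 (grown Γ η (j + 1))) * br D.q (D.lam (δ j)))) *
      (sand D.q (D.mom (η ⟨numEnds Γ - 1, by omega⟩)) (D.tot (grown Γ η (numEnds Γ - 1))) D.q /
        msq (D.tot1 (grown Γ η (numEnds Γ - 1))))
  else 0

open Classical in
/-- The contribution `φ(Γ)` of a tree `Γ`. -/
def phi (Γ : Graph ι) (δ : Fin (numEnds Γ - 2) → ι) : ℂ :=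
  if (verts Γ).card = 1 then ∑ i ∈ verts Γ, phi1 D i
  else if (verts Γ).card = 2 then ∑ e ∈ Γ.edgeSet.toFinset, phi2 D e
  else phiBig D Γ δ

/-- `Φ(Γ)`, the sum of `φ(Γ')` over the subtrees `Γ'` of `Γ`, where `δ Γ'` is the chosen
enumeration of the multiset `Δ` of `Γ'`. -/
def bigPhi (δ : (Γ : Graph ι) → Fin (numEnds Γ - 2) → ι) (Γ : Graph ι) : ℂ :=
  ∑ Γ' ∈ subtrees Γ, phi D Γ' (δ Γ')

end Weights

end GravityBG

end

/-!
The proof rests on the factors `attach D S x a = (q|x|1 + S|a) / (1 + S)²` for the attachment of a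
vertex `x` to a set `S` of vertices, with a spinor `a`. The sum of products of such factors over all
the orders in which the elements of a set `R` are attached to `S`, divided by `(1 + S + R)²`, is
`flow D S R as`, where `as` lists the spinors. The weight `φ(Γ)` of a tree with at least three
vertices is of this form (`phiBig_eq`): its leaves are attached to its stem, with the spinor `q`
twice and the spinors of the multiset `Δ`, normalised by `(q i) = 1`. Exchanging the spinors of two
consecutive attachments changes the product by a term that is antisymmetric in the two vertices
(`attach_mul_attach_swap`), so `flow` is symmetric in the spinors (`flow_perm`), and `φ(Γ)` does not
depend on the enumeration of `Δ`. The number of elements of `Δ` comes from counting valencies.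

**The recursion for a single tree.** Contracting `1 + S` with `p` expresses an attachment with the
spinor `q` through attachments with the spinors of the vertices of `S` (`attach_q`). This makes
`φ(Γ)` a sum over the vertices `r` of `Γ`, each of them taken as the root
(`phi_eq_sum_rootWeight`). By `flow_insert` the term of `r` becomes a sum over sets `R` of vertices
of terms in which all of `R` is attached to `r` alone; these are the sets `R` for which `Γ` is the
smallest tree containing `R` and `r`. Summed over all the subtrees of a tree `K` that contain `r`,
this is a sum over all the sets of vertices of `K` (`IsRooted.sum_rootedFlow`).

When all the terms of the recursion with `Φ` are on one side, the coefficient of a subtree `Γ'` is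
`(1 + K)²` minus the sum of the edge coefficients over the edges outside of `Γ'`. That sum
telescopes along paths, and the coefficient is the square of the momentum that arises from `1 + K`
when the spinor of each vertex is turned into the direction of the spinor of the vertex of `Γ'`
that is closest to it, its gate (`GraphRooted.den_sub_sum_cutTerm`). It is a polynomial of degree
two in the vertices outside of `R`. Collecting the terms according to the union of `R` and of the at
most two further vertices, all the unions with at least two elements cancel
(`IsRooted.chain_cancel`); this is an identity between sums over orders, `chain_exchange`, which
follows from the Plücker relation for spinors. The other terms give the factor `zed D r` times the
sum of `zed D x` over all `x`, and the sum over `r` is the square `(q|K|p]² / [1p]²`.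

**The currents.** A tree on `K` with an oriented edge is the same as two trees on complementary
subsets `I`, `J` of `K` with a vertex of each (`sum_spanningTrees_branch`). The weight `J(Γ)` is the
product of the weights of the two trees and of a factor of the edge (`treeWeight_join`), and the sum
of these factors, times the coefficients from the recursion, is `(q|I|J|q)²`. Hence the
Berends–Giele recursions follow from recursions for single trees. For the all-plus current the
latter is the decomposition of `K²` into the terms of the edges of any tree on `K`
(`msq_tot_eq_sum_cutTerm`), which is again a telescoping sum; for the all-but-one-plus current it is
`bigPhi_recursion`.
-/

namespace GravityBG

/-! ### Spinor algebra -/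

lemma br_eq (a b : Spinor) : br a b = a 0 * b 1 - a 1 * b 0 := by
  simp only [br, eps, Matrix.mulVec, dotProduct, Fin.sum_univ_two, Matrix.of_apply,
    Matrix.cons_val_zero, Matrix.cons_val_one, Matrix.cons_val', Matrix.cons_val_fin_one]
  ring

lemma br_swap (a b : Spinor) : br a b = -br b a := by
  simp only [br_eq]; ring

lemma br_self (a : Spinor) : br a a = 0 := by
  simp only [br_eq]; ring

lemma sand_eq (a : Spinor) (P Q : Momentum) (b : Spinor) :
    sand a P Q b =
      (a 0 * P 1 0 - a 1 * P 0 0) * (Q 0 1 * b 1 - Q 1 1 * b 0) -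
        (a 0 * P 1 1 - a 1 * P 0 1) * (Q 0 0 * b 1 - Q 1 0 * b 0) := by
  simp [sand, eps, Matrix.mulVec, Matrix.vecMul, dotProduct, Matrix.mul_apply, Fin.sum_univ_two,
    Matrix.transpose_apply]
  ring

lemma sand1_eq (a : Spinor) (P : Momentum) (c : Spinor) :
    sand1 a P c = (a 0 * P 1 0 - a 1 * P 0 0) * c 1 - (a 0 * P 1 1 - a 1 * P 0 1) * c 0 := by
  simp [sand1, eps, Matrix.mulVec, Matrix.vecMul, dotProduct, Matrix.mul_apply, Fin.sum_univ_two]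
  ring

lemma msq_eq (P : Momentum) : msq P = P 0 0 * P 1 1 - P 0 1 * P 1 0 := by
  rw [msq, Matrix.det_fin_two]

variable {ι : Type*} (D : SpinorData ι)

lemma mom_apply (i : ι) (a b : Fin 2) : D.mom i a b = D.lam i a * D.lamBar i b := rfl

lemma mom1_apply (a b : Fin 2) : D.mom1 a b = D.q a * D.oneBar b := rfl

lemma sand_mom_mom (i j : ι) (a b : Spinor) :
    sand a (D.mom i) (D.mom j) b =
      br a (D.lam i) * br (D.lamBar i) (D.lamBar j) * br (D.lam j) b := by
  simp only [sand_eq, br_eq, mom_apply]; ring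

lemma sand1_mom (i : ι) (a c : Spinor) :
    sand1 a (D.mom i) c = br a (D.lam i) * br (D.lamBar i) c := by
  simp only [sand1_eq, br_eq, mom_apply]; ring

lemma sand_add_left (a : Spinor) (P P' Q : Momentum) (b : Spinor) :
    sand a (P + P') Q b = sand a P Q b + sand a P' Q b := by
  simp only [sand_eq, Matrix.add_apply]; ring

lemma sand_add_right (a : Spinor) (P Q Q' : Momentum) (b : Spinor) :
    sand a P (Q + Q') b = sand a P Q b + sand a P Q' b := by
  simp only [sand_eq, Matrix.add_apply]; ring

lemma sand_swap (a : Spinor) (P Q : Momentum) : sand a P Q a = -sand a Q P a := by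
  simp only [sand_eq]; ring

lemma sand_self (a : Spinor) (P : Momentum) : sand a P P a = 0 := by
  simp only [sand_eq]; ring

lemma sand_zero_left (a : Spinor) (Q : Momentum) (b : Spinor) : sand a 0 Q b = 0 := by
  simp [sand_eq]

lemma sand_zero_right (a : Spinor) (P : Momentum) (b : Spinor) : sand a P 0 b = 0 := by
  simp [sand_eq]

lemma sand_sum_left {κ : Type*} (s : Finset κ) (f : κ → Momentum) (a : Spinor) (Q : Momentum)
    (b : Spinor) : sand a (∑ i ∈ s, f i) Q b = ∑ i ∈ s, sand a (f i) Q b := by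
  classical
  induction s using Finset.induction_on with
  | empty => simp [sand_zero_left]
  | insert x s hx ih => rw [sum_insert hx, sum_insert hx, sand_add_left, ih]

lemma sand_sum_right {κ : Type*} (s : Finset κ) (f : κ → Momentum) (a : Spinor) (P : Momentum)
    (b : Spinor) : sand a P (∑ i ∈ s, f i) b = ∑ i ∈ s, sand a P (f i) b := by
  classical
  induction s using Finset.induction_on with
  | empty => simp [sand_zero_right]
  | insert x s hx ih => rw [sum_insert hx, sum_insert hx, sand_add_right, ih]

lemma sand1_sum {κ : Type*} (s : Finset κ) (f : κ → Momentum) (a c : Spinor) :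
    sand1 a (∑ i ∈ s, f i) c = ∑ i ∈ s, sand1 a (f i) c := by
  classical
  induction s using Finset.induction_on with
  | empty => simp [sand1_eq]
  | insert x s hx ih =>
    rw [sum_insert hx, sum_insert hx, ← ih]
    simp only [sand1_eq, Matrix.add_apply]; ring

/-- The unprimed spinor of `i`, rescaled so that its contraction with `q` is `1`. -/
noncomputable def nlam (i : ι) : Spinor := (br D.q (D.lam i))⁻¹ • D.lam i

/-- The denominator `(1 + S)²`. -/
noncomputable def den (S : Finset ι) : ℂ := msq (D.tot1 S)

/-- The factor `(q|x|1 + S|a) / (1 + S)²` for the attachment of `x` to `S`. For `a = q` the summand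
`1` of `1 + S` drops out, see `sand_tot1_q`. -/
noncomputable def attach (S : Finset ι) (x : ι) (a : Spinor) : ℂ :=
  sand D.q (D.mom x) (D.tot1 S) a / den D S

lemma br_q_nlam {i : ι} (h : br D.q (D.lam i) ≠ 0) : br D.q (nlam D i) = 1 := by
  have : br D.q (nlam D i) = (br D.q (D.lam i))⁻¹ * br D.q (D.lam i) := by
    simp only [br_eq, nlam, Pi.smul_apply, smul_eq_mul]; ring
  rw [this, inv_mul_cancel₀ h]

lemma attach_smul (S : Finset ι) (x : ι) (c : ℂ) (a : Spinor) :
    attach D S x (c • a) = c * attach D S x a := by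
  simp only [attach, sand_eq, Pi.smul_apply, smul_eq_mul]; ring

lemma attach_sub (S : Finset ι) (x : ι) (a b : Spinor) :
    attach D S x (a - b) = attach D S x a - attach D S x b := by
  simp only [attach, sand_eq, Pi.sub_apply]; ring

/-- Three spinors are linearly dependent. -/
lemma schouten (a b c : Spinor) : br a b • c - br a c • b = -(br b c • a) := by
  ext i
  fin_cases i <;> simp [br_eq] <;> ring

/-- The Plücker relation. -/
lemma attach_schouten (S : Finset ι) (x : ι) (a b c : Spinor) :
    br a b * attach D S x c - br a c * attach D S x b = -(br b c * attach D S x a) := by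
  simp only [attach, sand_eq, br_eq]; ring

lemma sand_tot1_q (x : ι) (S : Finset ι) :
    sand D.q (D.mom x) (D.tot1 S) D.q = sand D.q (D.mom x) (D.tot S) D.q := by
  rw [SpinorData.tot1, sand_add_right]
  simp only [sand_eq, mom1_apply]; ring

variable [DecidableEq ι]

lemma tot1_insert {S : Finset ι} {x : ι} (hx : x ∉ S) :
    D.tot1 (insert x S) = D.tot1 S + D.mom x := by
  rw [SpinorData.tot1, SpinorData.tot1, SpinorData.tot, SpinorData.tot, sum_insert hx]
  abel

/-- The attachment factor of `x` with its own spinor gives the ratio of two denominators. -/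
lemma den_insert {S : Finset ι} {x : ι} (hx : x ∉ S) (hq : br D.q (D.lam x) ≠ 0)
    (hS : den D S ≠ 0) : den D (insert x S) = den D S * (1 - attach D S x (nlam D x)) := by
  have h : den D S * attach D S x (nlam D x) =
      (br D.q (D.lam x))⁻¹ * sand D.q (D.mom x) (D.tot1 S) (D.lam x) := by
    rw [attach, mul_div_cancel₀ _ hS]
    simp only [sand_eq, nlam, Pi.smul_apply, smul_eq_mul]; ring
  have h2 : sand D.q (D.mom x) (D.tot1 S) (D.lam x) = br D.q (D.lam x) *
      (den D S - den D (insert x S)) := by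
    rw [den, den, tot1_insert D hx]
    simp only [sand_eq, msq_eq, Matrix.add_apply, mom_apply, br_eq]; ring
  rw [mul_sub, h, h2, inv_mul_cancel_left₀ hq]
  ring

/-- The symmetry of two consecutive attachments under the exchange of their spinors. -/
lemma attach_mul_attach_swap {S : Finset ι} {x y : ι} (hx : x ∉ S)
    (hS : den D S ≠ 0) (hSx : den D (insert x S) ≠ 0) (a b : Spinor) :
    attach D S x a * attach D (insert x S) y b - attach D S x b * attach D (insert x S) y a =
      br a b * (br D.q (D.lam x) * br D.q (D.lam y) * br (D.lamBar x) (D.lamBar y)) / den D S := by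
  have hx1 : msq (D.tot1 S) ≠ 0 := hS
  have hx2 : msq (D.tot1 S + D.mom x) ≠ 0 := by rw [← tot1_insert D hx]; exact hSx
  simp only [attach, den, tot1_insert D hx]
  field_simp
  simp only [sand_eq, msq_eq, Matrix.add_apply, mom_apply, br_eq]; ring

/-- The change of an attachment factor when the set grows by `m`. -/
lemma attach_insert {S : Finset ι} {m : ι} (x : ι) (hm : m ∉ S) (hq : br D.q (D.lam m) ≠ 0)
    (hS : den D S ≠ 0) (hSm : den D (insert m S) ≠ 0) (a : Spinor) :
    attach D (insert m S) x a =
      attach D S x a + attach D S m a * attach D (insert m S) x (nlam D m) := by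
  have hx1 : msq (D.tot1 S) ≠ 0 := hS
  have hx2 : msq (D.tot1 S + D.mom m) ≠ 0 := by rw [← tot1_insert D hm]; exact hSm
  have : attach D (insert m S) x (nlam D m) =
      (br D.q (D.lam m))⁻¹ * attach D (insert m S) x (D.lam m) := by
    rw [nlam, attach_smul]
  rw [this]
  simp only [attach, den, tot1_insert D hm]
  field_simp
  simp only [sand_eq, msq_eq, Matrix.add_apply, mom_apply, br_eq]; ring

/-- The ratio `[i p] (q i) / [1 p]`. -/
noncomputable def zed (i : ι) : ℂ := br D.q (D.lam i) * br (D.lamBar i) D.p / br D.oneBar D.p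

omit [DecidableEq ι] in
/-- An attachment with the spinor `q` is a combination of attachments with the spinors of the
vertices that are already present, up to the term `zed D x`. -/
lemma attach_q (S : Finset ι) (x : ι) (hp : br D.oneBar D.p ≠ 0)
    (hq : ∀ v, br D.q (D.lam v) ≠ 0) (hS : den D S ≠ 0) :
    attach D S x D.q = -zed D x - ∑ v ∈ S, zed D v * attach D S x (nlam D v) := by
  -- contracting `1 + S` with `p` expresses `q` through the spinors of the elements of `S`
  have h1 : ∀ c : Fin 2, D.q c * br D.oneBar D.p + ∑ v ∈ S, D.lam v c * br (D.lamBar v) D.p =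
      D.tot1 S c 0 * D.p 1 - D.tot1 S c 1 * D.p 0 := by
    intro c
    simp only [SpinorData.tot1, SpinorData.tot, Matrix.add_apply, Matrix.sum_apply, mom_apply,
      mom1_apply, br_eq, add_mul, sum_mul, mul_sub, sum_sub_distrib, mul_assoc]
    ring
  have h2 : ∀ v, zed D v * attach D S x (nlam D v) =
      attach D S x (fun c => D.lam v c * br (D.lamBar v) D.p) / br D.oneBar D.p := by
    intro v
    rw [nlam, attach_smul, zed]
    have : (fun c => D.lam v c * br (D.lamBar v) D.p) = br (D.lamBar v) D.p • D.lam v := by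
      ext c; simp [mul_comm]
    rw [this, attach_smul]
    have := hq v
    field_simp
  have h3 : ∑ v ∈ S, attach D S x (fun c => D.lam v c * br (D.lamBar v) D.p) =
      attach D S x (fun c => ∑ v ∈ S, D.lam v c * br (D.lamBar v) D.p) := by
    simp only [attach, sand_eq, ← sum_div, sum_sub_distrib, ← mul_sum]
  have h4 : (fun c => ∑ v ∈ S, D.lam v c * br (D.lamBar v) D.p) =
      (fun c => D.tot1 S c 0 * D.p 1 - D.tot1 S c 1 * D.p 0) - br D.oneBar D.p • D.q := by
    ext c
    simp only [Pi.sub_apply, Pi.smul_apply, smul_eq_mul, ← h1 c]; ring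
  have h5 : attach D S x (fun c => D.tot1 S c 0 * D.p 1 - D.tot1 S c 1 * D.p 0) =
      -(br D.q (D.lam x) * br (D.lamBar x) D.p) := by
    have hS' : msq (D.tot1 S) ≠ 0 := hS
    rw [attach, den, div_eq_iff hS']
    simp only [sand_eq, msq_eq, mom_apply, br_eq]; ring
  simp only [h2]
  rw [← sum_div, h3, h4, attach_sub, attach_smul, h5, zed]
  field_simp
  ring

/-! ### Sums over the orders of attachment -/

section Chain

lemma sum_sum_erase_comm {ι : Type*} [DecidableEq ι] (R : Finset ι) (f : ι → ι → ℂ) :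
    ∑ x ∈ R, ∑ y ∈ R.erase x, f x y = ∑ x ∈ R, ∑ y ∈ R.erase x, f y x := by
  refine Finset.sum_comm' ?_
  intro x y
  simp only [mem_erase]
  tauto

lemma sum_sum_erase_eq_zero {ι : Type*} [DecidableEq ι] (R : Finset ι) (f : ι → ι → ℂ)
    (hf : ∀ x ∈ R, ∀ y ∈ R, x ≠ y → f x y = -f y x) :
    ∑ x ∈ R, ∑ y ∈ R.erase x, f x y = 0 := by
  have h := sum_sum_erase_comm R f
  have h2 : ∑ x ∈ R, ∑ y ∈ R.erase x, f y x = -∑ x ∈ R, ∑ y ∈ R.erase x, f x y := by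
    rw [← sum_neg_distrib]
    refine sum_congr rfl fun x hx => ?_
    rw [← sum_neg_distrib]
    refine sum_congr rfl fun y hy => ?_
    rw [mem_erase] at hy
    exact hf y hy.2 x hx hy.1
  rw [h2] at h
  exact self_eq_neg.1 h

variable {ι : Type*} [DecidableEq ι] (D : SpinorData ι)

/-- The sum over all the orders in which elements of `R` are attached one after the other to `S`,
where `as` lists the spinors used in the successive attachments. In the applications `as` is as long
as `R` is large, so that all of `R` is used up. -/
noncomputable def chain (S R : Finset ι) : List Spinor → ℂ
  | [] => 1
  | a :: as => ∑ x ∈ R, attach D S x a * chain (insert x S) (R.erase x) as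

/-- The normalisation of `chain` in which the final denominator is included. -/
noncomputable def flow (S R : Finset ι) (as : List Spinor) : ℂ := chain D S R as / den D (S ∪ R)

lemma insert_union_erase {S R : Finset ι} {x : ι} (hx : x ∈ R) :
    insert x S ∪ R.erase x = S ∪ R := by
  ext y
  simp only [mem_union, mem_insert, mem_erase]
  by_cases h : y = x
  · subst h; simp [hx]
  · simp [h]

lemma disjoint_insert_erase {S R : Finset ι} (h : Disjoint S R) (x : ι) :
    Disjoint (insert x S) (R.erase x) := by
  rw [disjoint_insert_left]
  exact ⟨notMem_erase x R, h.mono_right (erase_subset x R)⟩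

lemma flow_cons (S R : Finset ι) (a : Spinor) (as : List Spinor) :
    flow D S R (a :: as) =
      ∑ x ∈ R, attach D S x a * flow D (insert x S) (R.erase x) as := by
  simp only [flow, chain, sum_div]
  refine sum_congr rfl fun x hx => ?_
  rw [insert_union_erase hx, mul_div_assoc]

variable (hq : ∀ v, br D.q (D.lam v) ≠ 0) (hD : ∀ S : Finset ι, S.Nonempty → den D S ≠ 0)

include hD in
lemma chain_swap {S R : Finset ι} (hS : S.Nonempty) (hSR : Disjoint S R) (a b : Spinor)
    (as : List Spinor) : chain D S R (a :: b :: as) = chain D S R (b :: a :: as) := by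
  rw [← sub_eq_zero]
  simp only [chain, mul_sum, ← sum_sub_distrib]
  refine sum_sum_erase_eq_zero R _ fun x hx y hy _ => ?_
  have hx' : x ∉ S := fun h => disjoint_left.1 hSR h hx
  have hy' : y ∉ S := fun h => disjoint_left.1 hSR h hy
  have h1 := attach_mul_attach_swap D (y := y) hx' (hD S hS) (hD _ (insert_nonempty x S)) a b
  have h2 := attach_mul_attach_swap D (y := x) hy' (hD S hS) (hD _ (insert_nonempty y S)) a b
  rw [br_swap (D.lamBar y)] at h2
  rw [Finset.insert_comm y x S, erase_right_comm (s := R) (a := y)]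
  linear_combination chain D (insert x (insert y S)) ((R.erase x).erase y) as * (h1 + h2)

include hD in
/-- The sum over all orders is symmetric in the spinors, by the antisymmetry of the defect in
`attach_mul_attach_swap`. -/
lemma chain_perm {as bs : List Spinor} (h : as.Perm bs) : ∀ {S R : Finset ι}, S.Nonempty →
    Disjoint S R → chain D S R as = chain D S R bs := by
  induction h with
  | nil => intros; rfl
  | cons a _ ih =>
    intro S R _ hSR
    simp only [chain]
    exact sum_congr rfl fun x _ => by
      rw [ih (insert_nonempty x S) (disjoint_insert_erase hSR x)]
  | swap a b l =>
    intro S R hS hSR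
    exact chain_swap D hD hS hSR b a l
  | trans _ _ ih1 ih2 =>
    intro S R hS hSR
    rw [ih1 hS hSR, ih2 hS hSR]

include hD in
lemma flow_perm {as bs : List Spinor} (h : as.Perm bs) {S R : Finset ι} (hS : S.Nonempty)
    (hSR : Disjoint S R) : flow D S R as = flow D S R bs := by
  rw [flow, flow, chain_perm D hD h hS hSR]

include hq hD in
/-- An element of the initial set can be made to attach like all the others. -/
lemma flow_insert {m : ι} (as : List Spinor) : ∀ {S R : Finset ι}, S.Nonempty → Disjoint S R →
    m ∉ S → m ∉ R → as.length = R.card →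
    flow D (insert m S) R as = flow D S R as + flow D S (insert m R) (nlam D m :: as) := by
  induction as with
  | nil =>
    intro S R hS _ hm _ hR
    have hR0 : R = ∅ := by rw [← card_eq_zero]; simpa using hR.symm
    subst hR0
    have h1 := hD S hS
    have h2 := hD _ (insert_nonempty m S)
    have h3 := den_insert D hm (hq m) h1
    have h4 : S ∪ {m} = insert m S := by rw [union_comm]; rfl
    simp only [flow, chain, union_empty, insert_empty_eq, sum_singleton, h4, mul_one]
    field_simp
    rw [h3]
    ring
  | cons a as ih =>
    intro S R hS hSR hm hmR hR
    have hmR' : Disjoint S (insert m R) := by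
      rw [disjoint_insert_right]; exact ⟨hm, hSR⟩
    rw [flow_perm D hD (List.Perm.swap a (nlam D m) as) hS hmR', flow_cons, flow_cons, flow_cons,
      sum_insert hmR, erase_insert hmR, flow_cons, mul_sum, add_comm (∑ _ ∈ _, _), add_assoc,
      ← sum_add_distrib, ← sum_add_distrib]
    refine sum_congr rfl fun x hx => ?_
    have hxS : x ∉ S := fun h => disjoint_left.1 hSR h hx
    have hxm : x ≠ m := fun h => hmR (h ▸ hx)
    have hm' : m ∉ insert x S := by simp [hm, hxm.symm]
    have hcard : as.length = (R.erase x).card := by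
      rw [card_erase_of_mem hx, ← hR]; simp
    have h1 := ih (insert_nonempty x S) (disjoint_insert_erase hSR x) hm'
      (fun h => hmR (mem_of_mem_erase h)) hcard
    rw [erase_insert_of_ne hxm.symm, Finset.insert_comm x m S, h1,
      attach_insert D x hm (hq m) (hD S hS) (hD _ (insert_nonempty m S)) a]
    ring

/-- The recursion that singles out the last attachment. -/
lemma chain_append_singleton (a : Spinor) (as : List Spinor) : ∀ {S R : Finset ι},
    as.length + 1 = R.card →
    chain D S R (as ++ [a]) =
      ∑ x ∈ R, chain D S (R.erase x) as * attach D (S ∪ R.erase x) x a := by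
  induction as with
  | nil =>
    intro S R hR
    obtain ⟨x, rfl⟩ := card_eq_one.1 hR.symm
    simp [chain]
  | cons b as ih =>
    intro S R hR
    have h1 : ∀ y ∈ R, as.length + 1 = (R.erase y).card := by
      intro y hy
      rw [card_erase_of_mem hy, ← hR]; simp
    rw [List.cons_append]
    simp only [chain]
    rw [sum_congr rfl fun y hy => by rw [ih (h1 y hy)]]
    simp only [mul_sum, sum_mul]
    rw [sum_sum_erase_comm]
    refine sum_congr rfl fun x _ => sum_congr rfl fun y hy => ?_
    rw [mem_erase] at hy
    have h2 : insert y S ∪ (R.erase x).erase y = S ∪ R.erase x :=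
      insert_union_erase (mem_erase.2 hy)
    rw [erase_right_comm (s := R) (a := y), h2, mul_assoc]

include hD in
/-- The exchange identity. The sum over all orders ends with the spinor `a` in its definition; here
each `x` brings its own spinor `b x` when it comes last. The difference is a sum over pairs. -/
lemma chain_exchange {S R : Finset ι} (hS : S.Nonempty) (hSR : Disjoint S R) (a : Spinor)
    (b : ι → Spinor) (N : List Spinor) (N₁ : ι → List Spinor) (N₂ : ι → ι → List Spinor)
    (hN : N.length + 1 = R.card) (h₁ : ∀ x ∈ R, N.Perm (b x :: N₁ x))
    (h₂ : ∀ x ∈ R, ∀ y ∈ R, x ≠ y → (N₁ x).Perm (b y :: N₂ x y) ∨ b x = b y) :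
    chain D S R (a :: N) =
      ∑ x ∈ R, chain D S (R.erase x) (a :: N₁ x) * attach D (S ∪ R.erase x) x (b x) -
        1 / 2 * ∑ x ∈ R, ∑ y ∈ R.erase x, chain D S ((R.erase x).erase y) (a :: N₂ x y) *
          (br (b x) (b y) *
            (br D.q (D.lam x) * br D.q (D.lam y) * br (D.lamBar x) (D.lamBar y)) /
              den D (S ∪ (R.erase x).erase y)) := by
  have hlen : ∀ x ∈ R, (N₁ x).length + 1 = (R.erase x).card := by
    intro x hx
    have := (h₁ x hx).length_eq
    rw [List.length_cons] at this
    rw [card_erase_of_mem hx]; omega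
  have hd : ∀ x, Disjoint S (R.erase x) := fun x => hSR.mono_right (erase_subset x R)
  -- both sides as sums over ordered pairs: the element attached last and the one before it
  have e1 : chain D S R (a :: N) = ∑ x ∈ R, ∑ y ∈ R.erase x,
      chain D S ((R.erase x).erase y) (N₁ x) *
        (attach D (S ∪ (R.erase x).erase y) y (b x) *
          attach D (insert y (S ∪ (R.erase x).erase y)) x a) := by
    rw [chain_perm D hD (List.perm_append_singleton a N).symm hS hSR,
      chain_append_singleton D a N hN]
    refine sum_congr rfl fun x hx => ?_
    rw [chain_perm D hD ((h₁ x hx).trans (List.perm_append_singleton _ _).symm) hS (hd x),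
      chain_append_singleton D _ _ (hlen x hx), sum_mul]
    refine sum_congr rfl fun y hy => ?_
    rw [← insert_union, insert_union_erase hy, mul_assoc]
  have e2 : ∑ x ∈ R, chain D S (R.erase x) (a :: N₁ x) * attach D (S ∪ R.erase x) x (b x) =
      ∑ x ∈ R, ∑ y ∈ R.erase x,
      chain D S ((R.erase x).erase y) (N₁ x) *
        (attach D (S ∪ (R.erase x).erase y) y a *
          attach D (insert y (S ∪ (R.erase x).erase y)) x (b x)) := by
    refine sum_congr rfl fun x hx => ?_
    rw [chain_perm D hD (List.perm_append_singleton a (N₁ x)).symm hS (hd x),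
      chain_append_singleton D _ _ (hlen x hx), sum_mul]
    refine sum_congr rfl fun y hy => ?_
    rw [← insert_union, insert_union_erase hy, mul_assoc]
  rw [eq_sub_iff_add_eq', ← sub_eq_zero, e1, e2]
  set f : ι → ι → ℂ := fun x y => chain D S ((R.erase x).erase y) (N₁ x) *
    (br (b x) a * (br D.q (D.lam y) * br D.q (D.lam x) * br (D.lamBar y) (D.lamBar x)) /
      den D (S ∪ (R.erase x).erase y)) with hf
  have e3 : ∀ x ∈ R, ∀ y ∈ R.erase x, chain D S ((R.erase x).erase y) (N₁ x) *
        (attach D (S ∪ (R.erase x).erase y) y (b x) *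
          attach D (insert y (S ∪ (R.erase x).erase y)) x a) -
        chain D S ((R.erase x).erase y) (N₁ x) *
        (attach D (S ∪ (R.erase x).erase y) y a *
          attach D (insert y (S ∪ (R.erase x).erase y)) x (b x)) = f x y := by
    intro x hx y hy
    have hy' : y ∉ S ∪ (R.erase x).erase y := by
      rw [mem_union, not_or]
      exact ⟨fun h => disjoint_left.1 hSR h (mem_of_mem_erase hy), notMem_erase _ _⟩
    rw [← mul_sub, attach_mul_attach_swap D hy' (hD _ (hS.mono subset_union_left))
      (hD _ (insert_nonempty _ _))]
  have e4 : ∑ x ∈ R, ∑ y ∈ R.erase x, f x y =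
      1 / 2 * ∑ x ∈ R, ∑ y ∈ R.erase x, (f x y + f y x) := by
    simp only [sum_add_distrib]
    rw [← sum_sum_erase_comm R f]; ring
  have e5 := sum_congr (rfl : R = R) fun x hx => sum_congr (rfl : R.erase x = R.erase x) (e3 x hx)
  simp only [sum_sub_distrib] at e5
  rw [add_sub_assoc, e5, e4, ← mul_add, ← sum_add_distrib]
  refine mul_eq_zero_of_right _ (sum_eq_zero fun x hx => ?_)
  rw [← sum_add_distrib]
  refine sum_eq_zero fun y hy => ?_
  have hyR := mem_of_mem_erase hy
  have hxy : x ≠ y := fun h => (ne_of_mem_erase hy) h.symm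
  have hdd : Disjoint S ((R.erase x).erase y) := (hd x).mono_right (erase_subset _ _)
  rw [hf]
  beta_reduce
  rw [erase_right_comm (s := R) (a := y)]
  by_cases hb : b x = b y
  · have hp : (N₁ x).Perm (N₁ y) := by
      have := (h₁ x hx).symm.trans (h₁ y hyR)
      rw [hb] at this
      exact this.cons_inv
    rw [hb, br_self, chain_perm D hD hp hS hdd, br_swap (D.lamBar y)]
    ring
  · have hp1 := (h₂ x hx y hyR hxy).resolve_right hb
    have hp2 : (N₁ y).Perm (b x :: N₂ x y) := by
      have h := ((h₁ y hyR).symm.trans (h₁ x hx)).trans (hp1.cons (b x))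
      exact (h.trans (List.Perm.swap _ _ _)).cons_inv
    rw [chain_perm D hD hp1 hS hdd, chain_perm D hD hp2 hS hdd, br_swap (D.lamBar y)]
    have key : br (b x) a * chain D S ((R.erase x).erase y) (b y :: N₂ x y) -
        br (b y) a * chain D S ((R.erase x).erase y) (b x :: N₂ x y) =
        br (b x) (b y) * chain D S ((R.erase x).erase y) (a :: N₂ x y) := by
      simp only [chain, mul_sum, ← sum_sub_distrib]
      refine sum_congr rfl fun z _ => ?_
      have := attach_schouten D S z a (b x) (b y)
      rw [br_swap (b x) a, br_swap (b y) a]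
      linear_combination (-chain D (insert z S) (((R.erase x).erase y).erase z) (N₂ x y)) * this
    linear_combination (-(br D.q (D.lam x) * br D.q (D.lam y) *
      br (D.lamBar x) (D.lamBar y)) / den D (S ∪ (R.erase x).erase y)) * key

end Chain

/-! ### Rooted trees given by a parent function -/

section Rooted

variable {ι : Type*} [DecidableEq ι]

/-- The parent function `p` makes the finite set `K` into a tree with root `r`. The root is its own
parent, and the function `d` decreases from every other vertex to its parent. -/
structure IsRooted (K : Finset ι) (r : ι) (p : ι → ι) (d : ι → ℕ) : Prop where
  root_mem : r ∈ K
  parent_root : p r = r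
  parent_mem : ∀ x ∈ K, p x ∈ K
  depth_lt : ∀ x ∈ K, x ≠ r → d (p x) < d x

/-- `X` is the vertex set of a subtree of `K` that contains the root. -/
structure IsClosedBelow (K : Finset ι) (r : ι) (p : ι → ι) (X : Finset ι) : Prop where
  subset : X ⊆ K
  root_mem : r ∈ X
  parent_mem : ∀ x ∈ X, p x ∈ X

/-- The children of `v` in `X`. -/
def children (r : ι) (p : ι → ι) (X : Finset ι) (v : ι) : Finset ι :=
  X.filter fun x => x ≠ r ∧ p x = v

open Classical in
/-- The vertices of the smallest subtree that contains `R` and the root. -/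
noncomputable def hull (K : Finset ι) (r : ι) (p : ι → ι) (R : Finset ι) : Finset ι :=
  K.filter fun v => v = r ∨ ∃ x ∈ R, ∃ n, p^[n] x = v

open Classical in
/-- The first vertex of `X` on the way from `x` to the root; `x` itself if there is none, which does
not happen for sets `X` that contain the root. -/
noncomputable def gate (p : ι → ι) (X : Finset ι) (x : ι) : ι :=
  if h : ∃ n, p^[n] x ∈ X then p^[Nat.find h] x else x

/-- The multiset of the vertices whose spinors are used when `R` is attached to the root `r`, for a
subtree with vertices `X`: each vertex `v` occurs once less than its number of children, and once
more if it lies in `R`. If `R` is nonempty and `X` is its hull, the subtraction does not truncate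
(`IsRooted.one_le_weight`), and the multiset has one element less than `R`
(`IsRooted.card_labels`). -/
def labels (r : ι) (p : ι → ι) (X R : Finset ι) : Multiset ι :=
  ∑ v ∈ X, Multiset.replicate ((children r p X v).card + (if v ∈ R then 1 else 0) - 1) v

lemma count_sum_replicate (X : Finset ι) (f : ι → ℕ) (v : ι) :
    Multiset.count v (∑ x ∈ X, Multiset.replicate (f x) x) = if v ∈ X then f v else 0 := by
  rw [Multiset.count_sum']
  simp only [Multiset.count_replicate]
  rw [Finset.sum_ite_eq']

lemma count_labels (r : ι) (p : ι → ι) (X R : Finset ι) (v : ι) :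
    Multiset.count v (labels r p X R) =
      if v ∈ X then (children r p X v).card + (if v ∈ R then 1 else 0) - 1 else 0 :=
  count_sum_replicate X _ v

lemma gate_of_mem {p : ι → ι} {X : Finset ι} {x : ι} (hx : x ∈ X) : gate p X x = x := by
  classical
  have h : ∃ n, p^[n] x ∈ X := ⟨0, hx⟩
  have h0 : Nat.find h = 0 := (Nat.find_eq_zero h).2 hx
  rw [gate, dif_pos h, h0, Function.iterate_zero, id]

lemma gate_of_notMem {p : ι → ι} {X : Finset ι} {x : ι} (hx : x ∉ X) (h : ∃ n, p^[n] (p x) ∈ X) :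
    gate p X x = gate p X (p x) := by
  classical
  have h' : ∃ n, p^[n] x ∈ X := by
    obtain ⟨n, hn⟩ := h
    exact ⟨n + 1, by rwa [Function.iterate_succ_apply]⟩
  rw [gate, gate, dif_pos h, dif_pos h']
  have : Nat.find h' = Nat.find h + 1 := Nat.find_comp_succ h' h hx
  rw [this, Function.iterate_succ_apply]

lemma card_children_insert {r : ι} {p : ι → ι} {X : Finset ι} {x : ι} (hx : x ∉ X) (hr : x ≠ r)
    (v : ι) : (children r p (insert x X) v).card =
      (children r p X v).card + if v = p x then 1 else 0 := by
  rw [children, children, filter_insert]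
  by_cases h : p x = v
  · rw [if_pos ⟨hr, h⟩, if_pos h.symm, card_insert_of_notMem (by simp [hx])]
  · rw [if_neg (fun h' => h h'.2), if_neg (Ne.symm h), add_zero]

variable {K : Finset ι} {r : ι} {p : ι → ι} {d : ι → ℕ}

namespace IsRooted

lemma induction (h : IsRooted K r p d) {P : ι → Prop} (h0 : P r)
    (h1 : ∀ x ∈ K, x ≠ r → P (p x) → P x) : ∀ x ∈ K, P x := by
  have : ∀ n, ∀ x ∈ K, d x = n → P x := by
    intro n
    induction n using Nat.strong_induction_on with
    | _ n ih =>
      intro x hx hn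
      by_cases hr : x = r
      · exact hr ▸ h0
      · exact h1 x hx hr (ih _ (hn ▸ h.depth_lt x hx hr) _ (h.parent_mem x hx) rfl)
  exact fun x hx => this _ x hx rfl

omit [DecidableEq ι] in
lemma iterate_mem (h : IsRooted K r p d) {x : ι} (hx : x ∈ K) (n : ℕ) : p^[n] x ∈ K := by
  induction n with
  | zero => exact hx
  | succ n ih => rw [Function.iterate_succ_apply']; exact h.parent_mem _ ih

lemma exists_iterate_eq_root (h : IsRooted K r p d) : ∀ x ∈ K, ∃ n, p^[n] x = r :=
  h.induction ⟨0, rfl⟩ fun _ _ _ ⟨n, hn⟩ => ⟨n + 1, by rwa [Function.iterate_succ_apply]⟩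

lemma depth_parent_le (h : IsRooted K r p d) {x : ι} (hx : x ∈ K) : d (p x) ≤ d x := by
  by_cases hr : x = r
  · rw [hr, h.parent_root]
  · exact (h.depth_lt x hx hr).le

lemma depth_iterate_le (h : IsRooted K r p d) {x : ι} (hx : x ∈ K) (n : ℕ) :
    d (p^[n] x) ≤ d x := by
  induction n with
  | zero => exact le_rfl
  | succ n ih =>
    rw [Function.iterate_succ_apply']
    exact (h.depth_parent_le (h.iterate_mem hx n)).trans ih

omit [DecidableEq ι] in
lemma iterate_root (h : IsRooted K r p d) (n : ℕ) : p^[n] r = r :=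
  Function.iterate_fixed h.parent_root n

/-- A vertex other than the root is not an ancestor of its parent. -/
lemma iterate_parent_ne (h : IsRooted K r p d) {x : ι} (hx : x ∈ K) (hr : x ≠ r) (n : ℕ) :
    p^[n] (p x) ≠ x := by
  intro hn
  have h1 := h.depth_iterate_le (h.parent_mem x hx) n
  rw [hn] at h1
  exact absurd (h.depth_lt x hx hr) (not_lt.2 h1)

lemma exists_iterate_mem (h : IsRooted K r p d) {X : Finset ι} (hX : r ∈ X) {x : ι} (hx : x ∈ K) :
    ∃ n, p^[n] x ∈ X := by
  obtain ⟨n, hn⟩ := h.exists_iterate_eq_root x hx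
  exact ⟨n, hn ▸ hX⟩

lemma gate_mem (_h : IsRooted K r p d) {X : Finset ι} {x : ι} (hx : ∃ n, p^[n] x ∈ X) :
    gate p X x ∈ X := by
  classical
  rw [gate, dif_pos hx]
  exact Nat.find_spec hx

lemma mem_hull (_h : IsRooted K r p d) {R : Finset ι} {v : ι} :
    v ∈ hull K r p R ↔ v ∈ K ∧ (v = r ∨ ∃ x ∈ R, ∃ n, p^[n] x = v) := by
  classical
  rw [hull, mem_filter]

lemma isClosedBelow_hull (h : IsRooted K r p d) (R : Finset ι) :
    IsClosedBelow K r p (hull K r p R) where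
  subset := fun _ hv => (h.mem_hull.1 hv).1
  root_mem := h.mem_hull.2 ⟨h.root_mem, Or.inl rfl⟩
  parent_mem x hx := by
    rw [h.mem_hull] at hx ⊢
    refine ⟨h.parent_mem x hx.1, ?_⟩
    rcases hx.2 with rfl | ⟨y, hy, n, rfl⟩
    · exact Or.inl h.parent_root
    · exact Or.inr ⟨y, hy, n + 1, Function.iterate_succ_apply' _ _ _⟩

lemma subset_hull (h : IsRooted K r p d) {R : Finset ι} (hR : R ⊆ K) : R ⊆ hull K r p R :=
  fun x hx => h.mem_hull.2 ⟨hR hx, Or.inr ⟨x, hx, 0, rfl⟩⟩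

lemma mem_of_children_eq_empty (h : IsRooted K r p d) {R : Finset ι} (hR : R ⊆ K) {v : ι}
    (hv : v ∈ hull K r p R) (hr : v ≠ r) (hc : children r p (hull K r p R) v = ∅) : v ∈ R := by
  obtain ⟨_, hv' | ⟨x, hx, n, hn⟩⟩ := h.mem_hull.1 hv
  · exact absurd hv' hr
  · cases n with
    | zero => exact hn ▸ hx
    | succ n =>
      exfalso
      rw [Function.iterate_succ_apply'] at hn
      have : p^[n] x ∈ children r p (hull K r p R) v := by
        rw [children, mem_filter]
        refine ⟨h.mem_hull.2 ⟨h.iterate_mem (hR hx) n, Or.inr ⟨x, hx, n, rfl⟩⟩, ?_, hn⟩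
        intro h0
        rw [h0, h.parent_root] at hn
        exact hr hn.symm
      rw [hc] at this
      exact notMem_empty _ this

/-- A subtree containing the root is the hull of every set of its vertices that contains all its
leaves. -/
lemma hull_eq (h : IsRooted K r p d) {X R : Finset ι} (hX : IsClosedBelow K r p X) (hR : R ⊆ X)
    (hl : ∀ v ∈ X, v ≠ r → children r p X v = ∅ → v ∈ R) : hull K r p R = X := by
  apply Subset.antisymm
  · intro v hv
    obtain ⟨_, rfl | ⟨x, hx, n, rfl⟩⟩ := h.mem_hull.1 hv
    · exact hX.root_mem
    · clear hv
      induction n with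
      | zero => exact hR hx
      | succ n ih =>
        rw [Function.iterate_succ_apply']
        exact hX.parent_mem _ (ih (h.iterate_mem (hX.subset (hR hx)) n))
  · have hH := h.isClosedBelow_hull R
    -- descend from `v` to a leaf, which lies in `R`
    have key : ∀ n, ∀ v ∈ X, K.sup d - d v = n → v ∈ hull K r p R := by
      intro n
      induction n using Nat.strong_induction_on with
      | _ n ih =>
        intro v hv hn
        by_cases hr : v = r
        · exact hr ▸ hH.root_mem
        · rcases (children r p X v).eq_empty_or_nonempty with hc | ⟨y, hy⟩
          · exact h.subset_hull (hR.trans hX.subset) (hl v hv hr hc)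
          · rw [children, mem_filter] at hy
            have h1 := h.depth_lt y (hX.subset hy.1) hy.2.1
            have h2 : d y ≤ K.sup d := le_sup (f := d) (hX.subset hy.1)
            have h3 := ih (K.sup d - d y) (by rw [hy.2.2] at h1; omega) y hy.1 rfl
            rw [← hy.2.2]
            exact hH.parent_mem y h3
    exact fun v hv => key _ v hv rfl

lemma card_children_root_pos (h : IsRooted K r p d) {X : Finset ι} (hX : IsClosedBelow K r p X)
    {x : ι} (hx : x ∈ X) (hr : x ≠ r) : 0 < (children r p X r).card := by
  have : ∀ x ∈ K, x ∈ X → x ≠ r → (children r p X r).Nonempty := by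
    refine h.induction (fun _ h => absurd rfl h) fun x hxK hr ih hx _ => ?_
    by_cases hp : p x = r
    · exact ⟨x, by rw [children, mem_filter]; exact ⟨hx, hr, hp⟩⟩
    · exact ih (hX.parent_mem x hx) hp
  exact card_pos.2 (this x (hX.subset hx) hx hr)

lemma one_le_weight (h : IsRooted K r p d) {R : Finset ι} (hR : R ⊆ K.erase r) (hne : R.Nonempty)
    {v : ι} (hv : v ∈ hull K r p R) :
    1 ≤ (children r p (hull K r p R) v).card + if v ∈ R then 1 else 0 := by
  have hRK : R ⊆ K := hR.trans (erase_subset _ _)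
  by_cases hr : v = r
  · subst hr
    obtain ⟨x, hx⟩ := hne
    have := h.card_children_root_pos (h.isClosedBelow_hull R) (h.subset_hull hRK hx)
      (ne_of_mem_erase (hR hx))
    omega
  · by_cases hc : children r p (hull K r p R) v = ∅
    · rw [if_pos (h.mem_of_children_eq_empty hRK hv hr hc)]; omega
    · have := card_pos.2 (nonempty_iff_ne_empty.2 hc)
      omega

lemma sum_card_children (_h : IsRooted K r p d) {X : Finset ι} (hX : IsClosedBelow K r p X) :
    ∑ v ∈ X, (children r p X v).card = (X.erase r).card := by
  have : ∀ x ∈ X.erase r, p x ∈ X := fun x hx => hX.parent_mem x (mem_of_mem_erase hx)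
  rw [card_eq_sum_card_fiberwise this]
  refine sum_congr rfl fun v _ => ?_
  congr 1
  ext x
  simp only [children, mem_filter, mem_erase]
  tauto

lemma card_labels (h : IsRooted K r p d) {R : Finset ι} (hR : R ⊆ K.erase r) (hne : R.Nonempty) :
    Multiset.card (labels r p (hull K r p R) R) + 1 = R.card := by
  have hX := h.isClosedBelow_hull R
  have hRX := h.subset_hull (hR.trans (erase_subset _ _))
  rw [labels, Multiset.card_sum]
  simp only [Multiset.card_replicate]
  have h1 : ∑ v ∈ hull K r p R, ((children r p (hull K r p R) v).card +
      (if v ∈ R then 1 else 0) - 1) + ∑ v ∈ hull K r p R, 1 =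
      ∑ v ∈ hull K r p R, ((children r p (hull K r p R) v).card + if v ∈ R then 1 else 0) := by
    rw [← sum_add_distrib]
    exact sum_congr rfl fun v hv => Nat.sub_add_cancel (h.one_le_weight hR hne hv)
  rw [sum_add_distrib, h.sum_card_children hX, card_erase_of_mem hX.root_mem, sum_const,
    smul_eq_mul, mul_one, sum_ite_mem, inter_eq_right.2 hRX, sum_const, smul_eq_mul, mul_one] at h1
  have h2 := card_pos.2 ⟨r, hX.root_mem⟩
  omega

lemma hull_insert_of_mem (h : IsRooted K r p d) {R : Finset ι} (hR : R ⊆ K) {x : ι}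
    (hx : x ∈ hull K r p R) : hull K r p (insert x R) = hull K r p R :=
  h.hull_eq (h.isClosedBelow_hull R) (insert_subset hx (h.subset_hull hR)) fun _ hv hr hc =>
    mem_insert_of_mem (h.mem_of_children_eq_empty hR hv hr hc)

lemma mem_hull_insert (h : IsRooted K r p d) {R : Finset ι} {x v : ι} (hv : v ∈ K) :
    v ∈ hull K r p (insert x R) ↔ v ∈ hull K r p R ∨ ∃ n, p^[n] x = v := by
  rw [h.mem_hull, h.mem_hull, exists_mem_insert]
  simp only [hv, true_and]
  rw [or_assoc, or_comm (b := ∃ n, p^[n] x = v)]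

omit [DecidableEq ι] in
lemma exists_iterate_iff (_h : IsRooted K r p d) {x v : ι} :
    (∃ n, p^[n] x = v) ↔ v = x ∨ ∃ n, p^[n] (p x) = v := by
  constructor
  · rintro ⟨n, rfl⟩
    cases n with
    | zero => exact Or.inl rfl
    | succ n => exact Or.inr ⟨n, (Function.iterate_succ_apply _ _ _).symm⟩
  · rintro (rfl | ⟨n, rfl⟩)
    · exact ⟨0, rfl⟩
    · exact ⟨n + 1, Function.iterate_succ_apply _ _ _⟩

lemma hull_insert_eq_insert (h : IsRooted K r p d) {R : Finset ι} {x : ι} (hxK : x ∈ K) :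
    hull K r p (insert x R) = insert x (hull K r p (insert (p x) R)) := by
  ext v
  rw [mem_insert]
  by_cases hv : v ∈ K
  · rw [h.mem_hull_insert hv, h.mem_hull_insert hv, h.exists_iterate_iff]
    tauto
  · constructor
    · exact fun h' => absurd ((h.isClosedBelow_hull _).subset h') hv
    · rintro (rfl | h')
      · exact absurd hxK hv
      · exact absurd ((h.isClosedBelow_hull _).subset h') hv

/-- Adding a vertex `x` to `R` adds to the labels the vertex at which `x` is attached. -/
lemma labels_insert (h : IsRooted K r p d) {R : Finset ι} (hR : R ⊆ K.erase r) (hne : R.Nonempty) :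
    ∀ x ∈ K, x ≠ r → x ∉ R → labels r p (hull K r p (insert x R)) (insert x R) =
      gate p (hull K r p R) x ::ₘ labels r p (hull K r p R) R := by
  have hRK : R ⊆ K := hR.trans (erase_subset _ _)
  have hX := h.isClosedBelow_hull R
  refine h.induction (fun h => absurd rfl h) fun x hxK hr ih _ hxR => ?_
  ext v
  by_cases hx : x ∈ hull K r p R
  · have h1 := h.one_le_weight hR hne hx
    rw [if_neg hxR] at h1
    rw [h.hull_insert_of_mem hRK hx, gate_of_mem hx, Multiset.count_cons, count_labels,
      count_labels]
    by_cases hv : v = x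
    · subst hv
      simp only [hx, mem_insert_self, hxR, if_true, if_false]
      omega
    · simp only [mem_insert, hv, false_or, if_false, add_zero]
  · have hpK := h.parent_mem x hxK
    have hg := gate_of_notMem hx (h.exists_iterate_mem hX.root_mem hpK)
    have hx' : x ∉ hull K r p (insert (p x) R) := by
      rw [h.mem_hull_insert hxK]
      rintro (h' | ⟨n, hn⟩)
      · exact hx h'
      · exact h.iterate_parent_ne hxK hr n hn
    have hpx : p x ≠ x := h.iterate_parent_ne hxK hr 0
    have hc0 : (children r p (hull K r p (insert (p x) R)) x).card = 0 := by
      rw [card_eq_zero, children, filter_eq_empty_iff]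
      rintro y hy ⟨_, rfl⟩
      exact hx' ((h.isClosedBelow_hull _).parent_mem y hy)
    rw [hg, h.hull_insert_eq_insert hxK]
    by_cases hp : p x ∈ hull K r p R
    · have h1 := h.one_le_weight hR hne hp
      rw [h.hull_insert_of_mem hRK hp] at hx' hc0 ⊢
      rw [gate_of_mem hp, Multiset.count_cons, count_labels, count_labels,
        card_children_insert hx' hr]
      by_cases hv : v = x
      · subst hv
        rw [if_neg hx, if_neg (Ne.symm hpx), if_pos (mem_insert_self _ _),
          if_pos (mem_insert_self _ _), hc0]
      · by_cases hv' : v = p x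
        · subst hv'
          simp only [mem_insert, hpx, false_or, if_true, hp]
          omega
        · simp only [mem_insert, hv, hv', false_or, if_false, add_zero]
    · have hpr : p x ≠ r := fun h' => hp (h' ▸ hX.root_mem)
      have hpR : p x ∉ R := fun h' => hp (h.subset_hull hRK h')
      rw [← ih hpr hpR, count_labels, count_labels, card_children_insert hx' hr]
      by_cases hv : v = x
      · subst hv
        rw [if_neg hx', if_neg (Ne.symm hpx), if_pos (mem_insert_self _ _),
          if_pos (mem_insert_self _ _), hc0]
      · by_cases hv' : v = p x
        · subst hv'
          simp [hpx, hpR]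
        · simp only [mem_insert, hv, hv', false_or, if_false, add_zero]

end IsRooted

end Rooted

/-! ### The sum over the subtrees that contain a given root -/

section RootedSum

variable {ι : Type*} [DecidableEq ι] (D : SpinorData ι)

/-- `chain` with the spinors `q` and those of the vertices in the multiset `A`. -/
noncomputable def chainQ (S R : Finset ι) (A : Multiset ι) : ℂ :=
  chain D S R (D.q :: A.toList.map (nlam D))

/-- `flow` with the spinors `q` and those of the vertices in the multiset `A`. -/
noncomputable def flowQ (S R : Finset ι) (A : Multiset ι) : ℂ :=
  flow D S R (D.q :: A.toList.map (nlam D))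

omit [DecidableEq ι] in
lemma toList_cons_perm (m : ι) (A : Multiset ι) : (m ::ₘ A).toList.Perm (m :: A.toList) := by
  rw [← Multiset.coe_eq_coe, Multiset.coe_toList, ← Multiset.cons_coe, Multiset.coe_toList]

variable {D} (hq : ∀ v, br D.q (D.lam v) ≠ 0) (hD : ∀ S : Finset ι, S.Nonempty → den D S ≠ 0)

include hq hD in
lemma flowQ_insert {S R : Finset ι} {A : Multiset ι} {m : ι} (hS : S.Nonempty)
    (hSR : Disjoint S R) (hm : m ∉ S) (hmR : m ∉ R) (hA : Multiset.card A + 1 = R.card) :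
    flowQ D (insert m S) R A = flowQ D S R A + flowQ D S (insert m R) (m ::ₘ A) := by
  rw [flowQ, flowQ, flowQ, flow_insert D hq hD _ hS hSR hm hmR (by simpa using hA)]
  congr 1
  refine flow_perm D hD ?_ hS (by rw [disjoint_insert_right]; exact ⟨hm, hSR⟩)
  refine (List.Perm.swap _ _ _).trans (List.Perm.cons _ ?_)
  exact (((toList_cons_perm m A).map (nlam D)).trans (by rw [List.map_cons])).symm

include hq hD in
/-- Each element of `B` either stays in the initial set or is attached like the others, with its own
spinor added to the list. -/
lemma flowQ_union {S : Finset ι} (hS : S.Nonempty) (B : Finset ι) : ∀ {R : Finset ι}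
    {A : Multiset ι}, Disjoint S R → Disjoint B S → Disjoint B R →
    Multiset.card A + 1 = R.card →
    flowQ D (S ∪ B) R A = ∑ B' ∈ B.powerset, flowQ D S (R ∪ B') (A + B'.val) := by
  induction B using Finset.induction_on with
  | empty => intro R A _ _ _ _; simp
  | insert m B hm ih =>
    intro R A hSR hBS hBR hA
    rw [disjoint_insert_left] at hBS hBR
    have hmSB : m ∉ S ∪ B := by simp [hm, hBS.1]
    have hSBR : Disjoint (S ∪ B) R := disjoint_union_left.2 ⟨hSR, hBR.2⟩
    rw [union_insert, flowQ_insert hq hD (hS.mono subset_union_left) hSBR hmSB hBR.1 hA,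
      ih hSR hBS.2 hBR.2 hA, ih (R := insert m R) (A := m ::ₘ A)
        (disjoint_insert_right.2 ⟨hBS.1, hSR⟩) hBS.2 (disjoint_insert_right.2 ⟨hm, hBR.2⟩)
        (by rw [Multiset.card_cons, card_insert_of_notMem hBR.1, hA]), sum_powerset_insert hm]
    congr 1
    refine sum_congr rfl fun B' hB' => ?_
    have hmB' : m ∉ B' := fun h => hm (mem_powerset.1 hB' h)
    rw [insert_val_of_notMem hmB', insert_union, union_insert, Multiset.cons_add,
      Multiset.add_cons]

variable {K : Finset ι} {r : ι} {p : ι → ι} {d : ι → ℕ}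

/-- The leaves of `X` other than the root. -/
def leavesBelow (r : ι) (p : ι → ι) (X : Finset ι) : Finset ι :=
  X.filter fun v => v ≠ r ∧ children r p X v = ∅

/-- The vertices of `X` other than the root that are not leaves. -/
def innerBelow (r : ι) (p : ι → ι) (X : Finset ι) : Finset ι :=
  X.filter fun v => v ≠ r ∧ children r p X v ≠ ∅

/-- The multiset in which each vertex of `X` with `c` children occurs `c - 1` times, and the leaves
do not occur. -/
def branching (r : ι) (p : ι → ι) (X : Finset ι) : Multiset ι :=
  ∑ v ∈ X, Multiset.replicate ((children r p X v).card - 1) v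

variable (D) in
/-- The contribution of the root `r` to the weight of the subtree with vertices `X`, up to the
factor `-zed D r`: the leaves are attached to the root and the inner vertices. -/
noncomputable def rootedFlow (r : ι) (p : ι → ι) (X : Finset ι) : ℂ :=
  flowQ D (insert r (innerBelow r p X)) (leavesBelow r p X) (branching r p X)

lemma IsRooted.card_branching (h : IsRooted K r p d) {X : Finset ι} (hX : IsClosedBelow K r p X)
    (h2 : 2 ≤ X.card) : Multiset.card (branching r p X) + 1 = (leavesBelow r p X).card := by
  obtain ⟨y, hy, hyr⟩ : ∃ y ∈ X, y ≠ r := by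
    by_contra! hc
    have : X.card ≤ 1 := card_le_one.2 fun a ha b hb => (hc a ha).trans (hc b hb).symm
    omega
  have hr := h.card_children_root_pos hX hy hyr
  rw [branching, Multiset.card_sum, leavesBelow, card_filter]
  simp only [Multiset.card_replicate]
  have h1 : ∑ v ∈ X, ((children r p X v).card - 1) + ∑ v ∈ X, 1 =
      ∑ v ∈ X, (children r p X v).card +
        ∑ v ∈ X, if v ≠ r ∧ children r p X v = ∅ then 1 else 0 := by
    rw [← sum_add_distrib, ← sum_add_distrib]
    refine sum_congr rfl fun v _ => ?_
    by_cases hc : children r p X v = ∅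
    · have : v ≠ r := by rintro rfl; rw [hc] at hr; simp at hr
      simp [hc, this]
    · have := card_pos.2 (nonempty_iff_ne_empty.2 hc)
      simp only [hc, and_false, if_false]
      omega
  rw [h.sum_card_children hX, card_erase_of_mem hX.root_mem, sum_const, smul_eq_mul, mul_one] at h1
  omega

include hq hD in
/-- The contribution of the root, expanded so that everything is attached to the root alone: a sum
over the sets `R` of vertices that contain the leaves. -/
lemma IsRooted.rootedFlow_eq (h : IsRooted K r p d) {X : Finset ι} (hX : IsClosedBelow K r p X)
    (h2 : 2 ≤ X.card) : rootedFlow D r p X =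
      ∑ R ∈ (X.erase r).powerset with leavesBelow r p X ⊆ R,
        flowQ D {r} R (labels r p X R) := by
  have hd : Disjoint (innerBelow r p X) (leavesBelow r p X) := by
    rw [disjoint_left]
    intro v hv hv'
    rw [innerBelow, mem_filter] at hv
    rw [leavesBelow, mem_filter] at hv'
    exact hv.2.2 hv'.2.2
  have hrl : r ∉ leavesBelow r p X := by simp [leavesBelow]
  have hri : r ∉ innerBelow r p X := by simp [innerBelow]
  have hu : ∀ v ∈ X.erase r, v ∈ innerBelow r p X ∨ v ∈ leavesBelow r p X := by
    intro v hv
    rw [mem_erase] at hv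
    by_cases hc : children r p X v = ∅
    · exact Or.inr (mem_filter.2 ⟨hv.2, hv.1, hc⟩)
    · exact Or.inl (mem_filter.2 ⟨hv.2, hv.1, hc⟩)
  have hlX : leavesBelow r p X ⊆ X.erase r := fun v hv => by
    rw [leavesBelow, mem_filter] at hv; exact mem_erase.2 ⟨hv.2.1, hv.1⟩
  have hiX : innerBelow r p X ⊆ X.erase r := fun v hv => by
    rw [innerBelow, mem_filter] at hv; exact mem_erase.2 ⟨hv.2.1, hv.1⟩
  have e1 : insert r (innerBelow r p X) = {r} ∪ innerBelow r p X := rfl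
  rw [rootedFlow, e1, flowQ_union hq hD (singleton_nonempty r) _ (by simpa using hrl)
    (by simpa using hri) hd (h.card_branching hX h2)]
  refine sum_bij' (fun B _ => leavesBelow r p X ∪ B) (fun R _ => R \ leavesBelow r p X)
    ?_ ?_ ?_ ?_ ?_
  · intro B hB
    rw [mem_powerset] at hB
    rw [mem_filter, mem_powerset]
    exact ⟨union_subset hlX (hB.trans hiX), subset_union_left⟩
  · intro R hR
    rw [mem_filter, mem_powerset] at hR
    rw [mem_powerset]
    intro v hv
    rw [mem_sdiff] at hv
    exact (hu v (hR.1 hv.1)).resolve_right hv.2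
  · intro B hB
    rw [mem_powerset] at hB
    exact union_sdiff_cancel_left (hd.symm.mono_right hB)
  · intro R hR
    rw [mem_filter] at hR
    exact union_sdiff_of_subset hR.2
  · intro B hB
    rw [mem_powerset] at hB
    congr 1
    ext v
    rw [count_labels, Multiset.count_add, branching, count_sum_replicate,
      Multiset.count_eq_of_nodup B.nodup]
    simp only [mem_val, mem_union]
    by_cases hv : v ∈ X
    · rw [if_pos hv, if_pos hv]
      by_cases hr : v = r
      · subst hr
        have : v ∉ B := fun h => hri (hB h)
        simp [this, hrl]
      · rcases hu v (mem_erase.2 ⟨hr, hv⟩) with hi | hl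
        · have hl' : v ∉ leavesBelow r p X := disjoint_left.1 hd hi
          rw [innerBelow, mem_filter] at hi
          have := card_pos.2 (nonempty_iff_ne_empty.2 hi.2.2)
          simp only [hl', false_or]
          split_ifs <;> omega
        · have hB' : v ∉ B := fun h => disjoint_left.1 hd (hB h) hl
          have hl2 := hl
          rw [leavesBelow, mem_filter] at hl
          simp [hl2, hB', hl.2.2]
    · have : v ∉ B := fun h => hv (mem_of_mem_erase (hiX (hB h)))
      rw [if_neg hv, if_neg hv, if_neg this]

open Classical in
/-- The vertex sets of the subtrees of `K` that contain the root. -/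
noncomputable def closedSets (K : Finset ι) (r : ι) (p : ι → ι) : Finset (Finset ι) :=
  K.powerset.filter fun X => IsClosedBelow K r p X

omit [DecidableEq ι] in
lemma mem_closedSets {X : Finset ι} : X ∈ closedSets K r p ↔ IsClosedBelow K r p X := by
  classical
  rw [closedSets, mem_filter, mem_powerset]
  exact ⟨fun h => h.2, fun h => ⟨h.subset, h⟩⟩

include hq hD in
/-- Each set `R` of vertices belongs to exactly one subtree, namely to its hull. -/
lemma IsRooted.sum_rootedFlow (h : IsRooted K r p d) (g : Finset ι → ℂ) :
    ∑ X ∈ closedSets K r p with 2 ≤ X.card, rootedFlow D r p X * g X =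
      ∑ R ∈ (K.erase r).powerset, if R = ∅ then 0 else
        flowQ D {r} R (labels r p (hull K r p R) R) * g (hull K r p R) := by
  have e1 : ∀ X ∈ (closedSets K r p).filter (fun X => 2 ≤ X.card), rootedFlow D r p X * g X =
      ∑ R ∈ (X.erase r).powerset with leavesBelow r p X ⊆ R,
        flowQ D {r} R (labels r p X R) * g X := by
    intro X hX
    rw [mem_filter, mem_closedSets] at hX
    rw [h.rootedFlow_eq hq hD hX.1 hX.2, sum_mul]
  have e2 : ∑ R ∈ (K.erase r).powerset, (if R = ∅ then 0 else
        flowQ D {r} R (labels r p (hull K r p R) R) * g (hull K r p R)) =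
      ∑ R ∈ (K.erase r).powerset with R ≠ ∅,
        flowQ D {r} R (labels r p (hull K r p R) R) * g (hull K r p R) := by
    rw [sum_filter]
    exact sum_congr rfl fun R _ => by by_cases hR : R = ∅ <;> simp [hR]
  rw [sum_congr rfl e1, e2, sum_sigma']
  have hull_of : ∀ X R, IsClosedBelow K r p X → R ⊆ X.erase r → leavesBelow r p X ⊆ R →
      hull K r p R = X := by
    intro X R hX hR hl
    refine h.hull_eq hX (hR.trans (erase_subset _ _)) fun v hv hr hc => hl ?_
    exact mem_filter.2 ⟨hv, hr, hc⟩
  refine sum_bij' (fun a _ => a.2) (fun R _ => ⟨hull K r p R, R⟩) ?_ ?_ ?_ ?_ ?_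
  · rintro ⟨X, R⟩ ha
    simp only [mem_sigma, mem_filter, mem_closedSets, mem_powerset] at ha ⊢
    refine ⟨ha.2.1.trans (erase_subset_erase r ha.1.1.subset), ?_⟩
    have h1 := h.card_branching ha.1.1 ha.1.2
    have h2 := card_le_card ha.2.2
    rw [← nonempty_iff_ne_empty, ← card_pos]
    omega
  · intro R hR
    simp only [mem_sigma, mem_filter, mem_closedSets, mem_powerset] at hR ⊢
    have hRK : R ⊆ K := hR.1.trans (erase_subset _ _)
    obtain ⟨x, hx⟩ := nonempty_iff_ne_empty.2 hR.2
    have hx' := h.subset_hull hRK hx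
    have hxr := ne_of_mem_erase (hR.1 hx)
    refine ⟨⟨h.isClosedBelow_hull R, ?_⟩, ?_, ?_⟩
    · exact one_lt_card.2 ⟨x, hx', r, (h.isClosedBelow_hull R).root_mem, hxr⟩
    · intro y hy
      exact mem_erase.2 ⟨ne_of_mem_erase (hR.1 hy), h.subset_hull hRK hy⟩
    · intro v hv
      rw [leavesBelow, mem_filter] at hv
      exact h.mem_of_children_eq_empty hRK hv.1 hv.2.1 hv.2.2
  · rintro ⟨X, R⟩ ha
    simp only [mem_sigma, mem_filter, mem_closedSets, mem_powerset] at ha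
    simp only [hull_of X R ha.1.1 ha.2.1 ha.2.2]
  · intro R _
    rfl
  · rintro ⟨X, R⟩ ha
    simp only [mem_sigma, mem_filter, mem_closedSets, mem_powerset] at ha
    simp only [hull_of X R ha.1.1 ha.2.1 ha.2.2]

/-! ### The denominators of the trees that are attached to a subtree -/

variable (D) in
/-- The momentum of `x`, with the unprimed spinor turned into the direction of that of `y`. -/
noncomputable def moved (y x : ι) : Momentum :=
  Matrix.vecMulVec (nlam D y) (br D.q (D.lam x) • D.lamBar x)

omit [DecidableEq ι] in
lemma moved_apply (y x : ι) (a b : Fin 2) :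
    moved D y x a b = nlam D y a * (br D.q (D.lam x) * D.lamBar x b) := rfl

omit [DecidableEq ι] in
include hq in
lemma moved_self (x : ι) : moved D x x = D.mom x := by
  ext a b
  rw [moved_apply, mom_apply, nlam, Pi.smul_apply, smul_eq_mul]
  have := hq x
  field_simp

variable (D) in
/-- The momentum `1 + K` in which the spinor of every vertex is turned into that of its gate. -/
noncomputable def projTot (K : Finset ι) (p : ι → ι) (X : Finset ι) : Momentum :=
  D.mom1 + ∑ x ∈ K, moved D (gate p X x) x

variable (D) in
/-- The invariant of two vertices `x`, `y` whose spinors are turned into those of `x'`, `y'`. -/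
noncomputable def pairing (x' y' x y : ι) : ℂ :=
  br (nlam D x') (nlam D y') *
    (br D.q (D.lam x) * br D.q (D.lam y) * br (D.lamBar x) (D.lamBar y))

omit [DecidableEq ι] in
lemma pairing_self (x' x y : ι) : pairing D x' x' x y = 0 := by
  rw [pairing, br_self, zero_mul]

/-- The square is quadratic in the momenta that are added, and these are null. -/
lemma msq_add_sum_moved (P : Momentum) (f : ι → ι) (C : Finset ι) :
    msq (P + ∑ x ∈ C, moved D (f x) x) =
      msq P - ∑ x ∈ C, sand D.q (D.mom x) P (nlam D (f x)) +
        1 / 2 * ∑ x ∈ C, ∑ y ∈ C, pairing D (f x) (f y) x y := by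
  induction C using Finset.induction_on with
  | empty => simp
  | insert z C hz ih =>
    have e1 : msq (P + (moved D (f z) z + ∑ x ∈ C, moved D (f x) x)) =
        msq (P + ∑ x ∈ C, moved D (f x) x) -
          sand D.q (D.mom z) (P + ∑ x ∈ C, moved D (f x) x) (nlam D (f z)) := by
      simp only [msq_eq, sand_eq, Matrix.add_apply, moved_apply, mom_apply, br_eq]
      ring
    have e2 : ∀ y, sand D.q (D.mom z) (moved D (f y) y) (nlam D (f z)) =
        -pairing D (f z) (f y) z y := by
      intro y
      simp only [pairing, sand_eq, moved_apply, mom_apply, br_eq]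
      ring
    have e3 : ∀ y, pairing D (f y) (f z) y z = pairing D (f z) (f y) z y := by
      intro y
      simp only [pairing, br_eq]
      ring
    rw [sum_insert hz, e1, ih, sand_add_right, sand_sum_right, sum_insert hz, sum_insert hz]
    simp only [sum_insert hz, e2, e3, sum_neg_distrib, sum_add_distrib, pairing_self]
    ring

include hq in
lemma IsRooted.projTot_hull (h : IsRooted K r p d) {R : Finset ι} (hR : R ⊆ K.erase r) :
    projTot D K p (hull K r p R) =
      D.tot1 ({r} ∪ R) + ∑ x ∈ K.erase r \ R, moved D (gate p (hull K r p R) x) x := by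
  have hRK : R ⊆ K := hR.trans (erase_subset _ _)
  have hsub : {r} ∪ R ⊆ hull K r p R := union_subset
    (singleton_subset_iff.2 (h.isClosedBelow_hull R).root_mem) (h.subset_hull hRK)
  have hK : K = ({r} ∪ R) ∪ (K.erase r \ R) := by
    rw [union_assoc, union_sdiff_of_subset hR]
    exact (insert_erase h.root_mem).symm
  have hdis : Disjoint ({r} ∪ R) (K.erase r \ R) := by
    rw [disjoint_left]
    intro v hv hv'
    simp only [mem_union, mem_singleton, mem_sdiff, mem_erase] at hv hv'
    tauto
  rw [projTot, SpinorData.tot1, SpinorData.tot, add_assoc]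
  conv_lhs => rw [hK]
  rw [sum_union hdis, ← hK]
  congr 2
  exact sum_congr rfl fun x hx => by rw [gate_of_mem (hsub hx), moved_self hq]

/-! ### The cancellations -/

lemma sum_powerset_sum_sdiff (C : Finset ι) (f : Finset ι → ι → ℂ) :
    ∑ R ∈ C.powerset, ∑ x ∈ C \ R, f R x = ∑ U ∈ C.powerset, ∑ x ∈ U, f (U.erase x) x := by
  rw [sum_sigma', sum_sigma']
  refine sum_bij' (fun a _ => ⟨insert a.2 a.1, a.2⟩) (fun a _ => ⟨a.1.erase a.2, a.2⟩) ?_ ?_ ?_ ?_ ?_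
  · rintro ⟨R, x⟩ ha
    simp only [mem_sigma, mem_powerset, mem_sdiff] at ha ⊢
    exact ⟨insert_subset ha.2.1 ha.1, mem_insert_self _ _⟩
  · rintro ⟨U, x⟩ ha
    simp only [mem_sigma, mem_powerset, mem_sdiff] at ha ⊢
    exact ⟨(erase_subset _ _).trans ha.1, ha.1 ha.2, notMem_erase _ _⟩
  · rintro ⟨R, x⟩ ha
    simp only [mem_sigma, mem_powerset, mem_sdiff] at ha
    simp only [erase_insert ha.2.2]
  · rintro ⟨U, x⟩ ha
    simp only [mem_sigma, mem_powerset] at ha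
    simp only [insert_erase ha.2]
  · rintro ⟨R, x⟩ ha
    simp only [mem_sigma, mem_powerset, mem_sdiff] at ha
    simp only [erase_insert ha.2.2]

lemma sum_powerset_sum_sdiff_erase (C : Finset ι) (f : Finset ι → ι → ι → ℂ) :
    ∑ R ∈ C.powerset, ∑ x ∈ C \ R, ∑ y ∈ (C \ R).erase x, f R x y =
      ∑ U ∈ C.powerset, ∑ x ∈ U, ∑ y ∈ U.erase x, f ((U.erase x).erase y) x y := by
  have e1 : ∀ R x, (C \ R).erase x = C \ insert x R := fun R x => by
    ext y; simp only [mem_erase, mem_sdiff, mem_insert]; tauto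
  simp only [e1]
  rw [sum_powerset_sum_sdiff C fun R x => ∑ y ∈ C \ insert x R, f R x y]
  have e2 : ∀ U ∈ C.powerset, ∑ x ∈ U, ∑ y ∈ C \ insert x (U.erase x), f (U.erase x) x y =
      ∑ y ∈ C \ U, ∑ x ∈ U, f (U.erase x) x y := by
    intro U _
    rw [sum_comm]
    exact sum_congr rfl fun x hx => by rw [insert_erase hx]
  rw [sum_congr rfl e2, sum_powerset_sum_sdiff C fun U y => ∑ x ∈ U, f (U.erase x) x y]
  refine sum_congr rfl fun U _ => ?_
  rw [sum_sum_erase_comm]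
  exact sum_congr rfl fun x _ => sum_congr rfl fun y _ => by
    rw [erase_right_comm (s := U) (a := y)]

include hD in
/-- For each set `U` with at least two elements, the contributions of `U`, of the sets `U ∖ {x}` and
of the sets `U ∖ {x, y}` to `IsRooted.sum_rootedFlow_projTot` cancel. This is the exchange identity,
with the spinor of the gate of `x` for the vertex `x`. -/
lemma IsRooted.chain_cancel (h : IsRooted K r p d) {U : Finset ι} (hU : U ⊆ K.erase r)
    (h2 : 2 ≤ U.card) :
    chainQ D {r} U (labels r p (hull K r p U) U) =
      ∑ x ∈ U, chainQ D {r} (U.erase x) (labels r p (hull K r p (U.erase x)) (U.erase x)) *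
        attach D ({r} ∪ U.erase x) x (nlam D (gate p (hull K r p (U.erase x)) x)) -
      1 / 2 * ∑ x ∈ U, ∑ y ∈ U.erase x, if (U.erase x).erase y = ∅ then 0 else
        chainQ D {r} ((U.erase x).erase y)
          (labels r p (hull K r p ((U.erase x).erase y)) ((U.erase x).erase y)) *
        (pairing D (gate p (hull K r p ((U.erase x).erase y)) x)
          (gate p (hull K r p ((U.erase x).erase y)) y) x y /
            den D ({r} ∪ (U.erase x).erase y)) := by
  have hr : Disjoint {r} U := by
    rw [disjoint_singleton_left]
    exact fun hr => ne_of_mem_erase (hU hr) rfl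
  have hne : U.Nonempty := card_pos.1 (by omega)
  have hKr : ∀ {x}, x ∈ U → x ∈ K ∧ x ≠ r := fun hx =>
    ⟨mem_of_mem_erase (hU hx), ne_of_mem_erase (hU hx)⟩
  have hsub : ∀ x, U.erase x ⊆ K.erase r := fun x => (erase_subset x U).trans hU
  have hne1 : ∀ x ∈ U, (U.erase x).Nonempty := fun x hx => by
    rw [← card_pos, card_erase_of_mem hx]; omega
  have s1 : ∀ x ∈ U, labels r p (hull K r p U) U =
      gate p (hull K r p (U.erase x)) x ::ₘ
        labels r p (hull K r p (U.erase x)) (U.erase x) := by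
    intro x hx
    have := h.labels_insert (hsub x) (hne1 x hx) x (hKr hx).1 (hKr hx).2 (notMem_erase x U)
    rwa [insert_erase hx] at this
  have s2 : ∀ x ∈ U, ∀ y ∈ U.erase x, ((U.erase x).erase y).Nonempty →
      labels r p (hull K r p (U.erase x)) (U.erase x) =
      gate p (hull K r p ((U.erase x).erase y)) y ::ₘ
        labels r p (hull K r p ((U.erase x).erase y)) ((U.erase x).erase y) := by
    intro x _ y hy hn
    have hyU := mem_of_mem_erase hy
    have := h.labels_insert ((erase_subset y _).trans (hsub x)) hn y (hKr hyU).1 (hKr hyU).2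
      (notMem_erase y _)
    rwa [insert_erase hy] at this
  have toPerm : ∀ {A B : Multiset ι} {z : ι}, A = z ::ₘ B →
      (A.toList.map (nlam D)).Perm (nlam D z :: B.toList.map (nlam D)) := by
    intro A B z hA
    rw [hA, ← List.map_cons]
    exact (toList_cons_perm z B).map _
  -- either `x` and `y` are attached independently of each other, or at the same place
  have dich : ∀ x ∈ U, ∀ y ∈ U.erase x, ((U.erase x).erase y).Nonempty →
      (gate p (hull K r p (U.erase y)) y = gate p (hull K r p ((U.erase x).erase y)) y ∧
        gate p (hull K r p (U.erase x)) x = gate p (hull K r p ((U.erase x).erase y)) x) ∨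
      (gate p (hull K r p (U.erase x)) x = gate p (hull K r p (U.erase y)) y ∧
        gate p (hull K r p ((U.erase x).erase y)) x =
          gate p (hull K r p ((U.erase x).erase y)) y) := by
    intro x hx y hy hn
    have hyU := mem_of_mem_erase hy
    have hxy : x ∈ U.erase y := mem_erase.2 ⟨(ne_of_mem_erase hy).symm, hx⟩
    have h1 := s1 x hx
    have h1' := s1 y hyU
    rw [s2 x hx y hy hn] at h1
    have h2' := s2 y hyU x hxy (by rwa [erase_right_comm])
    rw [erase_right_comm (s := U) (a := y)] at h2'
    rw [h2', h1] at h1'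
    have h3 : (gate p (hull K r p (U.erase x)) x ::ₘ
        {gate p (hull K r p ((U.erase x).erase y)) y} : Multiset ι) =
        gate p (hull K r p (U.erase y)) y ::ₘ
          {gate p (hull K r p ((U.erase x).erase y)) x} := by
      rw [← Multiset.singleton_add, ← Multiset.singleton_add] at h1'
      rw [← Multiset.singleton_add, ← Multiset.singleton_add]
      rw [← Multiset.singleton_add, ← add_assoc, ← Multiset.singleton_add, ← add_assoc] at h1'
      exact add_right_cancel h1'
    rcases Multiset.cons_eq_cons.1 h3 with ⟨e1, e2⟩ | ⟨_, cs, e1, e2⟩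
    · exact Or.inr ⟨e1, (Multiset.singleton_inj.1 e2).symm⟩
    · left
      have hcs : cs = 0 := by
        have := congrArg Multiset.card e1
        rw [Multiset.card_singleton, Multiset.card_cons] at this
        exact Multiset.card_eq_zero.1 (by omega)
      subst hcs
      exact ⟨(Multiset.singleton_inj.1 e1).symm, (Multiset.singleton_inj.1 e2).symm⟩
  have triv : ∀ x ∈ U, ∀ y ∈ U.erase x, (U.erase x).erase y = ∅ →
      gate p (hull K r p (U.erase x)) x = gate p (hull K r p (U.erase y)) y := by
    intro x hx y hy hn
    have hyU := mem_of_mem_erase hy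
    have c2 : (U.erase x).card = 1 := by
      rw [← card_erase_add_one hy, hn]; rfl
    have z : ∀ z ∈ U, labels r p (hull K r p (U.erase z)) (U.erase z) = 0 := by
      intro z hz
      have c1 := h.card_labels (hsub z) (hne1 z hz)
      rw [card_erase_of_mem hz, ← card_erase_of_mem hx, c2] at c1
      exact Multiset.card_eq_zero.1 (by omega)
    have e1 := s1 x hx
    have e2 := s1 y hyU
    rw [z x hx] at e1
    rw [z y hyU, e1] at e2
    exact Multiset.singleton_inj.1 e2
  have key := chain_exchange D hD (singleton_nonempty r) hr D.q
    (fun x => nlam D (gate p (hull K r p (U.erase x)) x))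
    ((labels r p (hull K r p U) U).toList.map (nlam D))
    (fun x => (labels r p (hull K r p (U.erase x)) (U.erase x)).toList.map (nlam D))
    (fun x y => (labels r p (hull K r p ((U.erase x).erase y))
      ((U.erase x).erase y)).toList.map (nlam D))
    (by simpa using h.card_labels hU hne) (fun x hx => toPerm (s1 x hx)) ?_
  · rw [chainQ, key]
    refine congrArg₂ (· - ·) rfl ?_
    refine congrArg₂ (· * ·) rfl (sum_congr rfl fun x hx => sum_congr rfl fun y hy => ?_)
    split_ifs with hn
    · rw [triv x hx y hy hn, br_self, zero_mul, zero_div, mul_zero]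
    · rw [pairing]
      rcases dich x hx y hy (nonempty_iff_ne_empty.2 hn) with ⟨e1, e2⟩ | ⟨e1, e2⟩
      · rw [e1, e2]; rfl
      · rw [e1, e2, br_self, br_self]; simp
  · intro x hx y hyU hxy
    have hy : y ∈ U.erase x := mem_erase.2 ⟨hxy.symm, hyU⟩
    by_cases hn : ((U.erase x).erase y).Nonempty
    · rcases dich x hx y hy hn with ⟨e1, _⟩ | ⟨e1, _⟩
      · left
        rw [e1]
        exact toPerm (s2 x hx y hy hn)
      · right
        rw [e1]
    · right
      rw [triv x hx y hy (not_nonempty_iff_eq_empty.1 hn)]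

end RootedSum

section RootedSum

variable {ι : Type*} [DecidableEq ι] {D : SpinorData ι}
variable (hq : ∀ v, br D.q (D.lam v) ≠ 0) (hD : ∀ S : Finset ι, S.Nonempty → den D S ≠ 0)
variable {K : Finset ι} {r : ι} {p : ι → ι} {d : ι → ℕ}

include hq hD in
/-- The projected momentum of the hull of `R`, as a quadratic polynomial in the vertices outside of
`R`. -/
lemma IsRooted.msq_projTot_hull (h : IsRooted K r p d) {R : Finset ι} (hR : R ⊆ K.erase r) :
    msq (projTot D K p (hull K r p R)) / den D ({r} ∪ R) =
      1 - ∑ x ∈ K.erase r \ R, attach D ({r} ∪ R) x (nlam D (gate p (hull K r p R) x)) +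
        1 / 2 * ∑ x ∈ K.erase r \ R, ∑ y ∈ (K.erase r \ R).erase x,
          pairing D (gate p (hull K r p R) x) (gate p (hull K r p R) y) x y /
            den D ({r} ∪ R) := by
  have hd : den D ({r} ∪ R) ≠ 0 := hD _ ((singleton_nonempty r).mono subset_union_left)
  rw [h.projTot_hull hq hR, msq_add_sum_moved, add_div, sub_div, ← den, div_self hd, sum_div,
    mul_div_assoc, sum_div]
  congr 2
  refine sum_congr rfl fun x _ => ?_
  rw [sum_div, sum_erase]
  rw [pairing_self, zero_div]

include hq hD in
/-- Written as a sum over sets `R` of vertices and at most two further vertices `x`, `y`, the sum is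
collected according to `U = R ∪ {x, y}`. Only the sets `U` with one element survive. -/
lemma IsRooted.sum_rootedFlow_projTot (h : IsRooted K r p d) :
    ∑ X ∈ closedSets K r p with 2 ≤ X.card, rootedFlow D r p X * msq (projTot D K p X) =
      ∑ x ∈ K.erase r, attach D {r} x D.q := by
  set H : Finset ι → ℂ := fun R =>
    if R = ∅ then 0 else chainQ D {r} R (labels r p (hull K r p R) R) with hH
  set g : Finset ι → ι → ι := fun R x => gate p (hull K r p R) x with hg
  have e1 : ∀ R ∈ (K.erase r).powerset, (if R = ∅ then 0 else
      flowQ D {r} R (labels r p (hull K r p R) R) * msq (projTot D K p (hull K r p R))) =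
      H R - ∑ x ∈ K.erase r \ R, H R * attach D ({r} ∪ R) x (nlam D (g R x)) +
        1 / 2 * ∑ x ∈ K.erase r \ R, ∑ y ∈ (K.erase r \ R).erase x,
          H R * (pairing D (g R x) (g R y) x y / den D ({r} ∪ R)) := by
    intro R hR
    rw [mem_powerset] at hR
    by_cases hR0 : R = ∅
    · simp [hH, hR0]
    · have hHR : H R = chainQ D {r} R (labels r p (hull K r p R) R) := if_neg hR0
      rw [if_neg hR0, flowQ, flow, ← chainQ, ← hHR, div_mul_eq_mul_div, mul_div_assoc,
        h.msq_projTot_hull hq hD hR]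
      simp only [← mul_sum]
      ring
  rw [h.sum_rootedFlow hq hD, sum_congr rfl e1, sum_add_distrib, sum_sub_distrib, ← mul_sum,
    sum_powerset_sum_sdiff (K.erase r) fun R x => H R * attach D ({r} ∪ R) x (nlam D (g R x)),
    sum_powerset_sum_sdiff_erase (K.erase r) fun R x y =>
      H R * (pairing D (g R x) (g R y) x y / den D ({r} ∪ R)),
    mul_sum, ← sum_sub_distrib, ← sum_add_distrib]
  -- only the one-element sets contribute
  have e2 : ∀ U ∈ (K.erase r).powerset, U ∉ (K.erase r).powersetCard 1 →
      H U - ∑ x ∈ U, H (U.erase x) * attach D ({r} ∪ U.erase x) x (nlam D (g (U.erase x) x)) +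
        1 / 2 * ∑ x ∈ U, ∑ y ∈ U.erase x, H ((U.erase x).erase y) *
          (pairing D (g ((U.erase x).erase y) x) (g ((U.erase x).erase y) y) x y /
            den D ({r} ∪ (U.erase x).erase y)) = 0 := by
    intro U hU hU1
    rw [mem_powerset] at hU
    rw [mem_powersetCard, not_and] at hU1
    have hU1 := hU1 hU
    by_cases hU0 : U = ∅
    · simp [hH, hU0]
    · have hpos := card_pos.2 (nonempty_iff_ne_empty.2 hU0)
      have h2 : 2 ≤ U.card := by omega
      have hHU : H U = chainQ D {r} U (labels r p (hull K r p U) U) := if_neg hU0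
      have hH1 : ∀ x ∈ U, H (U.erase x) *
            attach D ({r} ∪ U.erase x) x (nlam D (g (U.erase x) x)) =
          chainQ D {r} (U.erase x) (labels r p (hull K r p (U.erase x)) (U.erase x)) *
            attach D ({r} ∪ U.erase x) x (nlam D (gate p (hull K r p (U.erase x)) x)) := by
        intro x hx
        refine congrArg₂ (· * ·) (if_neg (nonempty_iff_ne_empty.1 ?_)) rfl
        rw [← card_pos, card_erase_of_mem hx]; omega
      have hH2 : ∀ x ∈ U, ∀ y ∈ U.erase x, H ((U.erase x).erase y) *
          (pairing D (g ((U.erase x).erase y) x) (g ((U.erase x).erase y) y) x y /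
            den D ({r} ∪ (U.erase x).erase y)) = if (U.erase x).erase y = ∅ then 0 else
        chainQ D {r} ((U.erase x).erase y)
          (labels r p (hull K r p ((U.erase x).erase y)) ((U.erase x).erase y)) *
        (pairing D (gate p (hull K r p ((U.erase x).erase y)) x)
          (gate p (hull K r p ((U.erase x).erase y)) y) x y /
            den D ({r} ∪ (U.erase x).erase y)) := by
        intro x _ y _
        rw [hH, ite_mul, zero_mul]
      rw [sum_congr rfl fun x hx => sum_congr rfl (hH2 x hx), hHU, h.chain_cancel hD hU h2,
        sum_congr rfl hH1]
      ring
  rw [← sum_subset (fun U hU => mem_powerset.2 (mem_powersetCard.1 hU).1) e2]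
  have e3 : ∀ U ∈ (K.erase r).powersetCard 1,
      H U - ∑ x ∈ U, H (U.erase x) * attach D ({r} ∪ U.erase x) x (nlam D (g (U.erase x) x)) +
        1 / 2 * ∑ x ∈ U, ∑ y ∈ U.erase x, H ((U.erase x).erase y) *
          (pairing D (g ((U.erase x).erase y) x) (g ((U.erase x).erase y) y) x y /
            den D ({r} ∪ (U.erase x).erase y)) = ∑ x ∈ U, attach D {r} x D.q := by
    intro U hU
    rw [mem_powersetCard] at hU
    obtain ⟨x, rfl⟩ := card_eq_one.1 hU.2
    have c := h.card_labels hU.1 (singleton_nonempty x)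
    rw [card_singleton] at c
    have c0 : labels r p (hull K r p {x}) {x} = 0 := Multiset.card_eq_zero.1 (by omega)
    simp [hH, c0, chainQ, chain]
  rw [sum_congr rfl e3]
  rw [powersetCard_one, sum_map]
  simp

variable (D) in
/-- The contribution of the vertex `r` to the weight of the tree with vertices `X` that is rooted
at `r`. The tree with a single vertex is an exception, as it has no leaves to attach. -/
noncomputable def rootWeight (r : ι) (p : ι → ι) (X : Finset ι) : ℂ :=
  if X.card = 1 then zed D r ^ 2 / den D {r} else -(zed D r * rootedFlow D r p X)

include hq hD in
/-- The recursion, restricted to the contributions of the root `r` to the subtrees. -/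
lemma IsRooted.sum_rootWeight_projTot (h : IsRooted K r p d) (hp : br D.oneBar D.p ≠ 0) :
    ∑ X ∈ closedSets K r p, rootWeight D r p X * msq (projTot D K p X) =
      zed D r * ∑ x ∈ K, zed D x := by
  have hr : ({r} : Finset ι) ∈ closedSets K r p := mem_closedSets.2
    ⟨singleton_subset_iff.2 h.root_mem, mem_singleton_self r, fun x hx => by
      rw [mem_singleton] at hx ⊢; rw [hx, h.parent_root]⟩
  have hfil : (closedSets K r p).filter (fun X => ¬ 2 ≤ X.card) = {{r}} := by
    ext X
    rw [mem_filter, mem_singleton]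
    constructor
    · rintro ⟨hX, h2⟩
      rw [mem_closedSets] at hX
      have := card_pos.2 ⟨r, hX.root_mem⟩
      obtain ⟨y, rfl⟩ := card_eq_one.1 (by omega : X.card = 1)
      rw [mem_singleton.1 hX.root_mem]
    · rintro rfl
      exact ⟨hr, by simp⟩
  have e1 : ∑ X ∈ closedSets K r p with 2 ≤ X.card,
      rootWeight D r p X * msq (projTot D K p X) =
      -(zed D r * ∑ x ∈ K.erase r, attach D {r} x D.q) := by
    rw [← h.sum_rootedFlow_projTot hq hD, mul_sum, ← sum_neg_distrib]
    refine sum_congr rfl fun X hX => ?_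
    rw [rootWeight, if_neg (by have := (mem_filter.1 hX).2; omega)]
    ring
  have hdr := hD {r} (singleton_nonempty r)
  have e2 : msq (projTot D K p {r}) =
      -∑ x ∈ K, sand D.q (D.mom x) D.mom1 (nlam D r) := by
    have hg : ∀ x ∈ K, gate p {r} x = r := fun x hx =>
      mem_singleton.1 (h.gate_mem (h.exists_iterate_mem (mem_singleton_self r) hx))
    rw [projTot, sum_congr rfl fun x hx => by rw [hg x hx],
      msq_add_sum_moved (D := D) D.mom1 (fun _ => r) K]
    have : msq D.mom1 = 0 := by simp only [msq_eq, mom1_apply]; ring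
    simp only [pairing_self, this]
    simp
  have e3 : ∀ x, attach D {r} x (nlam D r) =
      sand D.q (D.mom x) D.mom1 (nlam D r) / den D {r} := by
    intro x
    have : sand D.q (D.mom x) (D.tot1 {r}) (nlam D r) =
        sand D.q (D.mom x) D.mom1 (nlam D r) := by
      rw [SpinorData.tot1, SpinorData.tot, sum_singleton, sand_add_right, add_eq_left]
      simp only [sand_eq, mom_apply, nlam, Pi.smul_apply, smul_eq_mul]
      ring
    rw [attach, this]
  have e4 : sand D.q (D.mom r) D.mom1 (nlam D r) = -den D {r} := by
    rw [den, SpinorData.tot1, SpinorData.tot, sum_singleton]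
    have := hq r
    have : sand D.q (D.mom r) D.mom1 (nlam D r) =
        (br D.q (D.lam r))⁻¹ * sand D.q (D.mom r) D.mom1 (D.lam r) := by
      simp only [sand_eq, nlam, Pi.smul_apply, smul_eq_mul]; ring
    rw [this, inv_mul_eq_iff_eq_mul₀ (hq r)]
    simp only [sand_eq, msq_eq, Matrix.add_apply, mom_apply, mom1_apply, br_eq]
    ring
  rw [← sum_filter_add_sum_filter_not _ (fun X => 2 ≤ X.card), e1, hfil, sum_singleton, rootWeight,
    if_pos (card_singleton r), e2, ← add_sum_erase K (zed D) h.root_mem,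
    ← add_sum_erase K (fun x => sand D.q (D.mom x) D.mom1 (nlam D r)) h.root_mem, e4]
  have e5 : ∀ x, attach D {r} x D.q =
      -zed D x - zed D r * (sand D.q (D.mom x) D.mom1 (nlam D r) / den D {r}) := by
    intro x
    rw [attach_q D {r} x hp hq hdr, sum_singleton, e3]
  simp only [e5, sum_sub_distrib, sum_neg_distrib, ← mul_sum, ← sum_div]
  field_simp
  ring

end RootedSum

/-! ### Subtrees as rooted trees -/

section Graphs

variable {ι : Type*} [Fintype ι] [DecidableEq ι]

/-- The graph `Γ` is the rooted tree with root `r` and parent function `p`: its edges join the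
vertices other than the root to their parents. -/
structure GraphRooted (Γ : Graph ι) (r : ι) (p : ι → ι) (d : ι → ℕ) : Prop where
  isRooted : IsRooted (verts Γ) r p d
  adj_iff : ∀ x y, Γ.Adj x y ↔ (x ∈ verts Γ ∧ x ≠ r ∧ y = p x) ∨ (y ∈ verts Γ ∧ y ≠ r ∧ x = p y)

omit [DecidableEq ι] in
lemma mem_verts {Γ : Graph ι} {x : ι} : x ∈ verts Γ ↔ x ∈ Γ.verts := by
  classical
  rw [verts, Set.mem_toFinset]

omit [DecidableEq ι] in
lemma coe_verts (Γ : Graph ι) : (verts Γ : Set ι) = Γ.verts := by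
  ext x
  rw [mem_coe, mem_verts]

/-- Every tree can be rooted at any of its vertices, with the distance to the root as the depth. -/
lemma IsSubtree.exists_graphRooted {Γ : Graph ι} (h : IsSubtree Γ) {r : ι} (hr : r ∈ verts Γ) :
    ∃ p d, GraphRooted Γ r p d := by
  classical
  rw [mem_verts] at hr
  set G := Γ.coe with hG
  set r' : Γ.verts := ⟨r, hr⟩ with hr'
  have hconn : G.Connected := h.1
  have hpar : ∀ v : Γ.verts, v ≠ r' → ∃ w, G.Adj v w ∧ G.dist w r' < G.dist v r' := by
    intro v hv
    obtain ⟨w, hw⟩ := (hconn.preconnected v r').exists_walk_length_eq_dist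
    cases w with
    | nil => exact absurd rfl hv
    | cons hadj w =>
      refine ⟨_, hadj, ?_⟩
      have := SimpleGraph.dist_le w
      rw [← hw, SimpleGraph.Walk.length_cons]
      omega
  choose! P hP1 hP2 using hpar
  have hinj : ∀ v w : {v : Γ.verts // v ≠ r'}, s(v.1, P v.1) = s(w.1, P w.1) → v = w := by
    intro v w hvw
    rw [Sym2.eq_iff] at hvw
    rcases hvw with ⟨h1, _⟩ | ⟨h1, h2⟩
    · exact Subtype.ext h1
    · have a1 := hP2 v.1 v.2
      have a2 := hP2 w.1 w.2
      rw [h2, h1] at a1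
      exact absurd a1 (not_lt.2 a2.le)
  -- there are as many edges as vertices other than the root
  have hsurj : Function.Surjective (fun v : {v : Γ.verts // v ≠ r'} =>
      (⟨s(v.1, P v.1), hP1 v.1 v.2⟩ : G.edgeSet)) := by
    refine (Function.Injective.bijective_of_nat_card_le
      (fun v w hvw => hinj v w (congrArg Subtype.val hvw)) ?_).2
    have h1 := (SimpleGraph.isTree_iff_connected_and_card.1 h).2
    rw [Nat.card_eq_fintype_card (α := {v : Γ.verts // v ≠ r'}), Fintype.card_subtype_compl,
      Fintype.card_subtype_eq, ← Nat.card_eq_fintype_card]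
    exact (Nat.eq_sub_of_add_eq h1).le
  have hadj : ∀ v w : Γ.verts, G.Adj v w → (v ≠ r' ∧ w = P v) ∨ (w ≠ r' ∧ v = P w) := by
    intro v w hvw
    obtain ⟨⟨x, hx⟩, hxe⟩ := hsurj ⟨s(v, w), hvw⟩
    have := congrArg Subtype.val hxe
    simp only [Sym2.eq_iff] at this
    rcases this with ⟨rfl, rfl⟩ | ⟨rfl, rfl⟩
    · exact Or.inl ⟨hx, rfl⟩
    · exact Or.inr ⟨hx, rfl⟩
  set p : ι → ι := fun x => if hx : x ∈ Γ.verts ∧ x ≠ r then P ⟨x, hx.1⟩ else r with hp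
  set d : ι → ℕ := fun x => if hx : x ∈ Γ.verts then G.dist ⟨x, hx⟩ r' else 0 with hd
  have hpx : ∀ x (hx : x ∈ Γ.verts), x ≠ r → p x = P ⟨x, hx⟩ := fun x hx hxr => by
    rw [hp]; exact dif_pos ⟨hx, hxr⟩
  have hdx : ∀ v : Γ.verts, d v = G.dist v r' := fun v => by
    rw [hd]; exact dif_pos v.2
  have hne : ∀ x (hx : x ∈ Γ.verts), x ≠ r ↔ (⟨x, hx⟩ : Γ.verts) ≠ r' := fun x hx => by
    rw [Ne, Ne, Subtype.ext_iff]
  refine ⟨p, d, ⟨mem_verts.2 hr, ?_, ?_, ?_⟩, ?_⟩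
  · rw [hp]; simp
  · intro x hx
    rw [mem_verts] at hx ⊢
    by_cases hxr : x = r
    · rw [hp]; simp [hxr, hr]
    · rw [hpx x hx hxr]; exact (P ⟨x, hx⟩).2
  · intro x hx hxr
    rw [mem_verts] at hx
    rw [hpx x hx hxr, hdx, hdx ⟨x, hx⟩]
    exact hP2 _ ((hne x hx).1 hxr)
  · intro x y
    constructor
    · intro hxy
      have hx := hxy.fst_mem
      have hy := hxy.snd_mem
      have hxy' : G.Adj ⟨x, hx⟩ ⟨y, hy⟩ := hxy
      rcases hadj _ _ hxy' with ⟨h1, h2⟩ | ⟨h1, h2⟩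
      · refine Or.inl ⟨mem_verts.2 hx, (hne x hx).2 h1, ?_⟩
        rw [hpx x hx ((hne x hx).2 h1), ← h2]
      · refine Or.inr ⟨mem_verts.2 hy, (hne y hy).2 h1, ?_⟩
        rw [hpx y hy ((hne y hy).2 h1), ← h2]
    · have key : ∀ x, x ∈ verts Γ → x ≠ r → Γ.Adj x (p x) := by
        intro x hx hxr
        rw [mem_verts] at hx
        rw [hpx x hx hxr]
        exact hP1 _ ((hne x hx).1 hxr)
      rintro (⟨hx, hxr, rfl⟩ | ⟨hy, hyr, rfl⟩)
      · exact key x hx hxr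
      · exact (key y hy hyr).symm

namespace GraphRooted

variable {Γ : Graph ι} {r : ι} {p : ι → ι} {d : ι → ℕ}

omit [DecidableEq ι] in
lemma adj_parent (h : GraphRooted Γ r p d) {x : ι} (hx : x ∈ verts Γ) (hr : x ≠ r) :
    Γ.Adj x (p x) := (h.adj_iff x (p x)).2 (Or.inl ⟨hx, hr, rfl⟩)

lemma isSubtree (h : GraphRooted Γ r p d) : IsSubtree Γ := by
  classical
  have hr := mem_verts.1 h.isRooted.root_mem
  have hreach : ∀ x, ∀ hx : x ∈ Γ.verts, Γ.coe.Reachable ⟨x, hx⟩ ⟨r, hr⟩ := by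
    have : ∀ x ∈ verts Γ, ∀ hx : x ∈ Γ.verts, Γ.coe.Reachable ⟨x, hx⟩ ⟨r, hr⟩ := by
      refine h.isRooted.induction (fun _ => SimpleGraph.Reachable.refl _) fun x hx hxr ih hx' => ?_
      have hadj := h.adj_parent hx hxr
      have : Γ.coe.Adj ⟨x, hx'⟩ ⟨p x, hadj.snd_mem⟩ := hadj
      exact this.reachable.trans (ih _)
    exact fun x hx => this x (mem_verts.2 hx) hx
  have hconn : Γ.coe.Connected :=
    { preconnected := fun v w => (hreach v.1 v.2).trans (hreach w.1 w.2).symm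
      nonempty := ⟨⟨r, hr⟩⟩ }
  refine SimpleGraph.isTree_iff_connected_and_card.2 ⟨hconn, le_antisymm ?_ ?_⟩
  · have hs : Function.Surjective (fun v : {v : Γ.verts // v ≠ ⟨r, hr⟩} =>
        (⟨s(v.1, ⟨p v.1, (h.adj_parent (mem_verts.2 v.1.2)
          (fun h' => v.2 (Subtype.ext h'))).snd_mem⟩), h.adj_parent (mem_verts.2 v.1.2)
          (fun h' => v.2 (Subtype.ext h'))⟩ : Γ.coe.edgeSet)) := by
      rintro ⟨e, he⟩
      induction e using Sym2.ind with
      | _ v w =>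
        have he' : Γ.Adj v w := he
        rcases (h.adj_iff _ _).1 he' with ⟨_, h1, h2⟩ | ⟨_, h1, h2⟩
        · refine ⟨⟨v, fun h' => h1 (congrArg Subtype.val h')⟩, Subtype.ext ?_⟩
          simp only [Sym2.eq_iff]
          exact Or.inl ⟨trivial, Subtype.ext h2.symm⟩
        · refine ⟨⟨w, fun h' => h1 (congrArg Subtype.val h')⟩, Subtype.ext ?_⟩
          simp only [Sym2.eq_iff]
          exact Or.inr ⟨trivial, Subtype.ext h2.symm⟩
    have h1 : Nat.card Γ.coe.edgeSet ≤ _ := Nat.card_le_card_of_surjective _ hs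
    have h2 : Nat.card {v : Γ.verts // v ≠ ⟨r, hr⟩} + 1 = Nat.card Γ.verts := by
      rw [Nat.card_eq_fintype_card, Nat.card_eq_fintype_card, Fintype.card_subtype_compl,
        Fintype.card_subtype_eq]
      exact Nat.sub_add_cancel (Fintype.card_pos_iff.2 ⟨⟨r, hr⟩⟩)
    omega
  · exact hconn.card_vert_le_card_edgeSet_add_one

lemma valency_eq (h : GraphRooted Γ r p d) {v : ι} (hv : v ∈ verts Γ) :
    valency Γ v = (children r p (verts Γ) v).card + if v = r then 0 else 1 := by
  classical
  have hset : Γ.neighborSet v =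
      ((children r p (verts Γ) v ∪ if v = r then ∅ else {p v} : Finset ι) : Set ι) := by
    ext y
    rw [SimpleGraph.Subgraph.mem_neighborSet, h.adj_iff, mem_coe, mem_union, children, mem_filter]
    by_cases hr : v = r
    · simp only [hr, if_true, notMem_empty, or_false]
      constructor
      · rintro (⟨_, h1, _⟩ | ⟨h1, h2, h3⟩)
        · exact absurd rfl h1
        · exact ⟨h1, h2, h3.symm⟩
      · rintro ⟨h1, h2, h3⟩
        exact Or.inr ⟨h1, h2, h3.symm⟩
    · simp only [hr, if_false, mem_singleton]
      constructor
      · rintro (⟨_, _, h3⟩ | ⟨h1, h2, h3⟩)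
        · exact Or.inr h3
        · exact Or.inl ⟨h1, h2, h3.symm⟩
      · rintro (⟨h1, h2, h3⟩ | h3)
        · exact Or.inr ⟨h1, h2, h3.symm⟩
        · exact Or.inl ⟨hv, hr, h3⟩
  have hcard : valency Γ v =
      (children r p (verts Γ) v ∪ if v = r then ∅ else {p v} : Finset ι).card := by
    rw [valency, SimpleGraph.Subgraph.degree, ← Set.toFinset_card]
    congr 1
    ext y
    rw [Set.mem_toFinset, hset, mem_coe]
  rw [hcard]
  by_cases hr : v = r
  · simp [hr]
  · rw [if_neg hr, if_neg hr, card_union_of_disjoint, card_singleton]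
    rw [disjoint_singleton_right, children, mem_filter]
    rintro ⟨_, h1, h2⟩
    exact h.isRooted.iterate_parent_ne hv hr 1 h2

omit [DecidableEq ι] in
/-- The subgraph on a set of vertices that contains the root and the parents of its elements. -/
lemma induce (h : GraphRooted Γ r p d) {X : Finset ι} (hX : IsClosedBelow (verts Γ) r p X) :
    verts (Γ.induce (X : Set ι)) = X ∧ GraphRooted (Γ.induce (X : Set ι)) r p d := by
  have hv : verts (Γ.induce (X : Set ι)) = X := by
    ext x
    rw [mem_verts, SimpleGraph.Subgraph.induce_verts, mem_coe]
  refine ⟨hv, ⟨?_, ?_⟩⟩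
  · rw [hv]
    exact ⟨hX.root_mem, h.isRooted.parent_root, hX.parent_mem,
      fun x hx => h.isRooted.depth_lt x (hX.subset hx)⟩
  · intro x y
    rw [hv, SimpleGraph.Subgraph.induce_adj, h.adj_iff, mem_coe, mem_coe]
    constructor
    · rintro ⟨hx, hy, ⟨_, h2⟩ | ⟨_, h2⟩⟩
      · exact Or.inl ⟨hx, h2⟩
      · exact Or.inr ⟨hy, h2⟩
    · rintro (⟨hx, hr, rfl⟩ | ⟨hy, hr, rfl⟩)
      · exact ⟨hx, hX.parent_mem x hx, Or.inl ⟨hX.subset hx, hr, rfl⟩⟩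
      · exact ⟨hX.parent_mem y hy, hy, Or.inr ⟨hX.subset hy, hr, rfl⟩⟩

omit [DecidableEq ι] in
lemma _root_.GravityBG.mem_subtrees {Γ Γ' : Graph ι} :
    Γ' ∈ subtrees Γ ↔ IsSubtree Γ' ∧ Γ' ≤ Γ := by
  classical
  rw [subtrees, mem_filter]
  simp

/-- Every subtree that contains the root is the subgraph on such a set of vertices. -/
lemma of_le (h : GraphRooted Γ r p d) {Γ' : Graph ι} (h' : IsSubtree Γ') (hle : Γ' ≤ Γ)
    (hr : r ∈ verts Γ') :
    IsClosedBelow (verts Γ) r p (verts Γ') ∧ Γ.induce (verts Γ' : Set ι) = Γ' := by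
  obtain ⟨p', d', hp⟩ := h'.exists_graphRooted hr
  have hsub : verts Γ' ⊆ verts Γ := fun x hx => mem_verts.2 (hle.1 (mem_verts.1 hx))
  have hpp : ∀ x ∈ verts Γ', x ≠ r → p' x = p x := by
    refine hp.isRooted.induction (fun h0 => absurd rfl h0) fun x hx hxr ih _ => ?_
    rcases (h.adj_iff _ _).1 (hle.2 (hp.adj_parent hx hxr)) with ⟨_, _, h1⟩ | ⟨_, h2, h3⟩
    · exact h1
    · exact absurd ((ih h2).trans h3.symm) (hp.isRooted.iterate_parent_ne hx hxr 1)
  have hX : IsClosedBelow (verts Γ) r p (verts Γ') := by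
    refine ⟨hsub, hr, fun x hx => ?_⟩
    by_cases hxr : x = r
    · rw [hxr, h.isRooted.parent_root]; exact hr
    · rw [← hpp x hx hxr]; exact hp.isRooted.parent_mem x hx
  refine ⟨hX, ?_⟩
  obtain ⟨hv, hi⟩ := h.induce hX
  ext x y
  · rw [← mem_verts, hv, mem_verts]
  · rw [hi.adj_iff, hp.adj_iff, hv]
    constructor
    · rintro (⟨h1, h2, h3⟩ | ⟨h1, h2, h3⟩)
      · exact Or.inl ⟨h1, h2, h3.trans (hpp x h1 h2).symm⟩
      · exact Or.inr ⟨h1, h2, h3.trans (hpp y h1 h2).symm⟩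
    · rintro (⟨h1, h2, h3⟩ | ⟨h1, h2, h3⟩)
      · exact Or.inl ⟨h1, h2, h3.trans (hpp x h1 h2)⟩
      · exact Or.inr ⟨h1, h2, h3.trans (hpp y h1 h2)⟩

lemma sum_subtrees (h : GraphRooted Γ r p d) (f : Graph ι → ℂ) :
    ∑ Γ' ∈ subtrees Γ with r ∈ verts Γ', f Γ' =
      ∑ X ∈ closedSets (verts Γ) r p, f (Γ.induce (X : Set ι)) := by
  refine sum_bij' (fun Γ' _ => verts Γ') (fun X _ => Γ.induce (X : Set ι)) ?_ ?_ ?_ ?_ ?_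
  · intro Γ' hΓ'
    rw [mem_filter, mem_subtrees] at hΓ'
    exact mem_closedSets.2 (h.of_le hΓ'.1.1 hΓ'.1.2 hΓ'.2).1
  · intro X hX
    rw [mem_closedSets] at hX
    obtain ⟨hv, hi⟩ := h.induce hX
    rw [mem_filter, mem_subtrees, hv]
    refine ⟨⟨hi.isSubtree, ?_⟩, hX.root_mem⟩
    refine ⟨?_, fun x y hxy => hxy.2.2⟩
    rw [SimpleGraph.Subgraph.induce_verts, ← coe_verts]
    exact coe_subset.2 hX.subset
  · intro Γ' hΓ'
    rw [mem_filter, mem_subtrees] at hΓ'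
    exact (h.of_le hΓ'.1.1 hΓ'.1.2 hΓ'.2).2
  · intro X hX
    exact (h.induce (mem_closedSets.1 hX)).1
  · intro Γ' hΓ'
    rw [mem_filter, mem_subtrees] at hΓ'
    rw [(h.of_le hΓ'.1.1 hΓ'.1.2 hΓ'.2).2]

end GraphRooted

end Graphs

/-! ### The weights of the trees as sums over orders of attachment -/

section Weights

variable {ι : Type*} [Fintype ι] [DecidableEq ι] (D : SpinorData ι)

/-- The iterated sum over orders, written as a sum over injective functions. -/
lemma chain_ofFn : ∀ (n : ℕ) (a : Fin n → Spinor) (S R : Finset ι),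
    chain D S R (List.ofFn a) =
      ∑ f : Fin n → ι with Function.Injective f ∧ ∀ k, f k ∈ R,
        ∏ j : Fin n, attach D (S ∪ (univ.filter fun k : Fin n => (k : ℕ) < (j : ℕ)).image f)
          (f j) (a j) := by
  intro n
  induction n with
  | zero => intro a S R; simp [chain, Function.injective_of_subsingleton]
  | succ n ih =>
    intro a S R
    rw [List.ofFn_succ, chain]
    simp only [ih]
    rw [sum_filter, ← (Fin.consEquiv fun _ : Fin (n + 1) => ι).sum_comp, Fintype.sum_prod_type,
      ← sum_subset (subset_univ R)]
    · refine sum_congr rfl fun x hx => ?_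
      rw [sum_filter, mul_sum]
      refine sum_congr rfl fun g _ => ?_
      have hiff : (Function.Injective (Fin.cons x g : Fin (n + 1) → ι) ∧
          ∀ k, (Fin.cons x g : Fin (n + 1) → ι) k ∈ R) ↔
          Function.Injective g ∧ ∀ k, g k ∈ R.erase x := by
        rw [Fin.cons_injective_iff, Fin.forall_fin_succ]
        simp only [Fin.cons_zero, Fin.cons_succ, mem_erase, Set.mem_range, not_exists]
        constructor
        · rintro ⟨⟨h1, h2⟩, _, h3⟩
          exact ⟨h2, fun k => ⟨h1 k, h3 k⟩⟩
        · rintro ⟨h1, h2⟩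
          exact ⟨⟨fun k => (h2 k).1, h1⟩, hx, fun k => (h2 k).2⟩
      simp only [Fin.consEquiv, Equiv.coe_fn_mk]
      rw [mul_ite, mul_zero]
      refine ite_congr (propext hiff).symm (fun _ => ?_) (fun _ => rfl)
      rw [Fin.prod_univ_succ]
      have hS0 : S ∪ (univ.filter fun k : Fin (n + 1) => (k : ℕ) < ((0 : Fin (n + 1)) : ℕ)).image
          (Fin.cons x g : Fin (n + 1) → ι) = S := by simp
      rw [hS0, Fin.cons_zero]
      refine congrArg₂ (· * ·) rfl (prod_congr rfl fun j _ => ?_)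
      rw [Fin.cons_succ]
      refine congrArg (fun T => attach D T (g j) (a j.succ)) ?_
      ext y
      simp only [mem_union, mem_insert, mem_image, mem_filter, mem_univ, true_and,
        Fin.exists_fin_succ, Fin.cons_zero, Fin.cons_succ, Fin.val_zero, Fin.val_succ]
      simp only [add_lt_add_iff_right, Nat.zero_lt_succ, true_and]
      rw [eq_comm (a := x)]
      tauto
    · intro x _ hx
      refine sum_eq_zero fun g _ => ?_
      rw [if_neg]
      rintro ⟨_, h⟩
      exact hx (by simpa [Fin.consEquiv] using h 0)

/-- The sum over all orders, written as a sum over the enumerations of `R`. -/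
lemma chain_ofFn_equiv {n : ℕ} (a : Fin n → Spinor) (S R : Finset ι) (hn : n = R.card) :
    chain D S R (List.ofFn a) = ∑ η : Fin n ≃ R,
      ∏ j : Fin n, attach D
        (S ∪ (univ.filter fun k : Fin n => (k : ℕ) < (j : ℕ)).image fun k => (η k : ι)) (η j) (a j) := by
  rw [chain_ofFn]
  symm
  refine sum_bij (fun η _ k => (η k : ι)) ?_ ?_ ?_ ?_
  · intro η _
    rw [mem_filter]
    exact ⟨mem_univ _, fun x y hxy => η.injective (Subtype.ext hxy), fun k => (η k).2⟩
  · intro η _ η' _ h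
    exact Equiv.ext fun k => Subtype.ext (congrFun h k)
  · intro f hf
    rw [mem_filter] at hf
    refine ⟨Equiv.ofBijective (fun k => (⟨f k, hf.2.2 k⟩ : R)) ?_, mem_univ _, rfl⟩
    rw [Fintype.bijective_iff_injective_and_card]
    exact ⟨fun x y hxy => hf.2.1 (congrArg Subtype.val hxy), by simp [hn]⟩
  · intro η _
    rfl

omit [Fintype ι] [DecidableEq ι] in
lemma prod_ends {n : ℕ} (h : 2 ≤ n) (g : Fin n → ℂ) :
    ∏ j, g j = g ⟨0, by omega⟩ * (∏ j : Fin (n - 2), g ⟨j + 1, by omega⟩) *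
      g ⟨n - 1, by omega⟩ := by
  obtain ⟨m, rfl⟩ : ∃ m, n = m + 2 := ⟨n - 2, by omega⟩
  rw [Fin.prod_univ_succ, Fin.prod_univ_castSucc, ← mul_assoc]
  rfl

omit [Fintype ι] [DecidableEq ι] in
lemma ofFn_ends {α : Type*} {n : ℕ} (h : 2 ≤ n) (c : α) (b : Fin (n - 2) → α) :
    List.ofFn (fun j : Fin n => if hj : 1 ≤ (j : ℕ) ∧ (j : ℕ) < n - 1 then
      b ⟨j - 1, by omega⟩ else c) = c :: (List.ofFn b ++ [c]) := by
  obtain ⟨m, rfl⟩ : ∃ m, n = m + 2 := ⟨n - 2, by omega⟩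
  rw [List.ofFn_succ, List.ofFn_succ']
  simp only [Fin.val_zero, Fin.val_succ, List.concat_eq_append]
  refine congrArg₂ _ (by simp) (congrArg₂ _ ?_ (by simp))
  congr 1
  funext j
  have hj := j.2
  rw [dif_pos (by simp)]
  rfl

lemma stem_union_leaves (Γ : Graph ι) : stem Γ ∪ leaves Γ = verts Γ := by
  rw [stem, leaves, union_comm]
  exact filter_union_filter_not_eq _ _

omit [DecidableEq ι] in
lemma disjoint_stem_leaves (Γ : Graph ι) : Disjoint (stem Γ) (leaves Γ) :=
  (disjoint_filter_filter_not _ _ _).symm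

/-- The weight of a tree is a sum over the orders in which its leaves are attached to its stem. The
spinors are `q` for the first and the last leaf and those of the enumeration of `Δ` between. -/
lemma phiBig_eq (Γ : Graph ι) (δ : Fin (numEnds Γ - 2) → ι) (h : 2 ≤ numEnds Γ) :
    phiBig D Γ δ = flow D (stem Γ) (leaves Γ)
      (D.q :: (List.ofFn (fun j => nlam D (δ j)) ++ [D.q])) := by
  have hgrown : ∀ (η : Fin (numEnds Γ) ≃ leaves Γ) (j : ℕ), grown Γ η j =
      stem Γ ∪ (univ.filter fun k : Fin (numEnds Γ) => (k : ℕ) < (j : ℕ)).image fun k => (η k : ι) := by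
    intro η j
    ext x
    simp [grown]
  rw [phiBig, dif_pos h, flow, stem_union_leaves, ← ofFn_ends h,
    chain_ofFn_equiv (n := numEnds Γ) D _ _ (leaves Γ) rfl, sum_div]
  -- the two sides carry different decidability instances
  refine sum_congr (Finset.ext fun η => by simp only [mem_univ]) fun η _ => ?_
  rw [prod_ends h, ← one_div_mul_eq_div (den D (verts Γ)), ← mul_assoc, ← mul_assoc]
  refine congrArg₂ (· * ·) (congrArg₂ (· * ·) (congrArg₂ (· * ·) rfl ?_) ?_) ?_
  · rw [dif_neg (by simp)]
    simp only [Nat.not_lt_zero, filter_false, image_empty, union_empty, attach]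
    rw [sand_tot1_q]
    rfl
  · refine prod_congr rfl fun j _ => ?_
    have hj := j.2
    rw [dif_pos ⟨by simp, by simp; omega⟩, hgrown]
    simp only [Nat.add_sub_cancel, Fin.eta]
    rw [nlam, attach_smul, attach, den]
    rw [div_eq_mul_inv, div_eq_mul_inv, mul_inv]
    ring
  · rw [dif_neg (by simp), hgrown, attach, sand_tot1_q]
    rfl

end Weights

/-! ### The weights of the trees as sums over their roots -/

section Weights

variable {ι : Type*} [Fintype ι] [DecidableEq ι]

section Counting

variable {Γ : Graph ι} {r : ι} {p : ι → ι} {d : ι → ℕ}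

omit [DecidableEq ι] in
lemma GraphRooted.isClosedBelow_verts (h : GraphRooted Γ r p d) :
    IsClosedBelow (verts Γ) r p (verts Γ) :=
  ⟨Subset.rfl, h.isRooted.root_mem, h.isRooted.parent_mem⟩

lemma GraphRooted.one_le_children_root (h : GraphRooted Γ r p d) (h2 : 2 ≤ (verts Γ).card) :
    1 ≤ (children r p (verts Γ) r).card := by
  obtain ⟨y, hy, hyr⟩ := exists_mem_ne (by omega : 1 < (verts Γ).card) r
  exact h.isRooted.card_children_root_pos h.isClosedBelow_verts hy hyr

lemma GraphRooted.one_le_valency (h : GraphRooted Γ r p d) (h2 : 2 ≤ (verts Γ).card) {v : ι}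
    (hv : v ∈ verts Γ) : 1 ≤ valency Γ v := by
  rw [h.valency_eq hv]
  by_cases hr : v = r
  · rw [hr]
    have := h.one_le_children_root h2
    omega
  · rw [if_neg hr]; omega

lemma GraphRooted.sum_valency (h : GraphRooted Γ r p d) :
    ∑ v ∈ verts Γ, valency Γ v + 2 = 2 * (verts Γ).card := by
  have hr := h.isRooted.root_mem
  rw [sum_congr rfl fun v hv => h.valency_eq hv, sum_add_distrib,
    h.isRooted.sum_card_children h.isClosedBelow_verts, ← add_sum_erase _ _ hr, if_pos rfl, zero_add,
    sum_congr rfl fun v hv => if_neg (ne_of_mem_erase hv), sum_const, smul_eq_mul, mul_one,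
    card_erase_of_mem hr]
  have := card_pos.2 ⟨r, hr⟩
  omega

/-- The sum of `α - 2` over all the vertices is `-2`, and each leaf contributes `-1`. -/
lemma GraphRooted.card_delta (h : GraphRooted Γ r p d) (h2 : 2 ≤ (verts Γ).card) :
    Multiset.card (delta Γ) + 2 = numEnds Γ := by
  rw [delta, Multiset.card_sum, numEnds, leaves, card_filter]
  simp only [Multiset.card_replicate]
  have h1 : ∑ v ∈ verts Γ, (valency Γ v - 2) + ∑ v ∈ verts Γ, 2 =
      ∑ v ∈ verts Γ, valency Γ v + ∑ v ∈ verts Γ, if valency Γ v = 1 then 1 else 0 := by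
    rw [← sum_add_distrib, ← sum_add_distrib]
    refine sum_congr rfl fun v hv => ?_
    have := h.one_le_valency h2 hv
    split_ifs <;> omega
  rw [sum_const, smul_eq_mul] at h1
  have := h.sum_valency
  omega

lemma GraphRooted.stem_nonempty (h : GraphRooted Γ r p d) (h3 : 3 ≤ (verts Γ).card) :
    (stem Γ).Nonempty := by
  by_contra hs
  rw [not_nonempty_iff_eq_empty, stem, filter_eq_empty_iff] at hs
  have h1 : ∑ v ∈ verts Γ, valency Γ v = (verts Γ).card := by
    rw [sum_congr rfl fun v hv => not_not.1 (hs hv), sum_const, smul_eq_mul, mul_one]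
  have := h.sum_valency
  omega

end Counting

variable (D : SpinorData ι)

omit [DecidableEq ι] in
lemma ofFn_perm_delta {Γ : Graph ι} {δ : Fin (numEnds Γ - 2) → ι} (hδ : IsDeltaEnumeration Γ δ) :
    (List.ofFn fun j => nlam D (δ j)).Perm ((delta Γ).toList.map (nlam D)) := by
  have : (List.ofFn fun j => nlam D (δ j)) = (List.ofFn δ).map (nlam D) := by
    rw [List.map_ofFn]; rfl
  rw [this]
  refine List.Perm.map _ ?_
  rw [← Multiset.coe_eq_coe, Multiset.coe_toList, ← hδ, Fin.univ_val_map]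

variable {D} (hq : ∀ v, br D.q (D.lam v) ≠ 0) (hD : ∀ S : Finset ι, S.Nonempty → den D S ≠ 0)

include hD in
/-- In this form the weight depends on the enumeration only through the multiset `Δ`. -/
lemma phi_eq_flow {Γ : Graph ι} (h : IsSubtree Γ) (h3 : 3 ≤ (verts Γ).card)
    {δ : Fin (numEnds Γ - 2) → ι} (hδ : IsDeltaEnumeration Γ δ) :
    phi D Γ δ =
      flow D (stem Γ) (leaves Γ) (D.q :: D.q :: (delta Γ).toList.map (nlam D)) := by
  obtain ⟨r, hr⟩ := card_pos.1 (by omega : 0 < (verts Γ).card)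
  obtain ⟨p, d, hp⟩ := h.exists_graphRooted hr
  have h2 : 2 ≤ numEnds Γ := by
    have := hp.card_delta (by omega)
    omega
  rw [phi, if_neg (by omega), if_neg (by omega), phiBig_eq D Γ δ h2]
  refine flow_perm D hD ((List.perm_append_singleton _ _).trans ?_ |>.cons _)
    (hp.stem_nonempty h3) (disjoint_stem_leaves Γ)
  exact (ofFn_perm_delta D hδ).cons _

omit [Fintype ι] in
include hq hD in
/-- The first of the two spinors `q` is traded for a sum over all the vertices. -/
lemma flow_q_cons {S R : Finset ι} (hS : S.Nonempty) (hSR : Disjoint S R)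
    (hp : br D.oneBar D.p ≠ 0) (A : Multiset ι) :
    flow D S R (D.q :: D.q :: A.toList.map (nlam D)) =
      ∑ x ∈ R, -(zed D x * flowQ D (insert x S) (R.erase x) A) +
        ∑ v ∈ S, -(zed D v * flowQ D S R (v ::ₘ A)) := by
  have e1 : ∀ v, flowQ D S R (v ::ₘ A) =
      ∑ x ∈ R, attach D S x (nlam D v) * flowQ D (insert x S) (R.erase x) A := by
    intro v
    have : (D.q :: (v ::ₘ A).toList.map (nlam D)).Perm
        (nlam D v :: D.q :: A.toList.map (nlam D)) :=
      (((toList_cons_perm v A).map (nlam D)).cons D.q).trans (List.Perm.swap _ _ _)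
    rw [flowQ, flow_perm D hD this hS hSR, flow_cons]
    rfl
  simp only [e1, mul_sum, ← sum_neg_distrib]
  rw [sum_comm, flow_cons, ← sum_add_distrib]
  refine sum_congr rfl fun x _ => ?_
  rw [attach_q D S x hp hq (hD S hS), ← flowQ, sub_mul, sum_mul]
  simp only [sum_neg_distrib, mul_assoc]
  ring

omit [Fintype ι] [DecidableEq ι] in
lemma den_singleton (i : ι) : den D {i} = br D.q (D.lam i) * br D.oneBar (D.lamBar i) := by
  rw [den, SpinorData.tot1, SpinorData.tot, sum_singleton]
  simp only [msq_eq, Matrix.add_apply, mom_apply, mom1_apply, br_eq]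
  ring

omit [Fintype ι] [DecidableEq ι] in
include hq hD in
lemma phi1_eq (hp : br D.oneBar D.p ≠ 0) (i : ι) : phi1 D i = zed D i ^ 2 / den D {i} := by
  have h1 := hD {i} (singleton_nonempty i)
  rw [den_singleton] at h1 ⊢
  have h2 := hq i
  have h3 := right_ne_zero_of_mul h1
  rw [phi1, zed]
  field_simp

omit [Fintype ι] in
include hD in
/-- The weight of an edge, as the sum of the contributions of its two vertices. -/
lemma phi2_eq (hp : br D.oneBar D.p ≠ 0) {i j : ι} (hij : i ≠ j) :
    phi2 D s(i, j) = -(zed D i * (attach D {i} j D.q / den D {i, j})) -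
      zed D j * (attach D {j} i D.q / den D {i, j}) := by
  have h1 := hD {i} (singleton_nonempty i)
  have h2 := hD {j} (singleton_nonempty j)
  have h3 := hD {i, j} (insert_nonempty _ _)
  have e3 : den D {i, j} = msq (D.mom1 + (D.mom i + D.mom j)) := by
    rw [den, SpinorData.tot1, SpinorData.tot, sum_pair hij]
  have e1 : ∀ i, den D {i} = msq (D.mom1 + D.mom i) := fun i => by
    rw [den, SpinorData.tot1, SpinorData.tot, sum_singleton]
  have e4 : phi2 D s(i, j) = sand D.q (D.mom i) (D.mom j) D.q * sand D.q (D.mom j) (D.mom i) D.q /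
      (den D {i} * den D {j} * den D {i, j}) := by
    rw [e1, e1, e3]; rfl
  rw [e4, attach, attach, sand_tot1_q, sand_tot1_q, SpinorData.tot, SpinorData.tot, sum_singleton,
    sum_singleton, zed, zed]
  field_simp
  rw [den_singleton, den_singleton]
  simp only [sand_mom_mom, br_eq]
  ring

include hq hD in
/-- The weight of a tree is a sum over its vertices, each of them taken as the root in turn. -/
theorem phi_eq_sum_rootWeight (hp : br D.oneBar D.p ≠ 0) {Γ : Graph ι} (h : IsSubtree Γ)
    {p : ι → ι → ι} {d : ι → ι → ℕ} (hr : ∀ r ∈ verts Γ, GraphRooted Γ r (p r) (d r))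
    {δ : Fin (numEnds Γ - 2) → ι} (hδ : 3 ≤ (verts Γ).card → IsDeltaEnumeration Γ δ) :
    phi D Γ δ = ∑ r ∈ verts Γ, rootWeight D r (p r) (verts Γ) := by
  classical
  by_cases h1 : (verts Γ).card = 1
  · rw [phi, if_pos h1]
    refine sum_congr rfl fun i hi => ?_
    rw [phi1_eq hq hD hp, rootWeight, if_pos h1]
  by_cases h2 : (verts Γ).card = 2
  · rw [phi, if_neg h1, if_pos h2]
    obtain ⟨i, j, hij, hK⟩ := card_eq_two.1 h2
    have hi : i ∈ verts Γ := by rw [hK]; simp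
    have hj : j ∈ verts Γ := by rw [hK]; simp
    have root : ∀ a b, a ≠ b → verts Γ = {a, b} → GraphRooted Γ a (p a) (d a) →
        p a b = a ∧ rootWeight D a (p a) (verts Γ) =
          -(zed D a * (attach D {a} b D.q / den D {a, b})) := by
      intro a b hab hV ha
      have hb : b ∈ verts Γ := by rw [hV]; simp
      have hpb : p a b = a := by
        have h0 := ha.isRooted.iterate_parent_ne hb hab.symm 0
        have h0' := ha.isRooted.parent_mem b hb
        rw [hV, mem_insert, mem_singleton] at h0'
        exact h0'.resolve_right h0
      refine ⟨hpb, ?_⟩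
      have hca : children a (p a) {a, b} a = {b} := by
        ext x
        simp only [children, mem_filter, mem_insert, mem_singleton]
        constructor
        · rintro ⟨h1, h2, _⟩
          exact h1.resolve_left h2
        · rintro rfl
          exact ⟨Or.inr rfl, hab.symm, hpb⟩
      have hcb : children a (p a) {a, b} b = ∅ := by
        ext x
        simp only [children, mem_filter, mem_insert, mem_singleton, notMem_empty, iff_false]
        rintro ⟨h1, h2, h3⟩
        rw [h1.resolve_left h2, hpb] at h3
        exact hab h3
      have hl : leavesBelow a (p a) {a, b} = {b} := by
        ext x
        simp only [leavesBelow, mem_filter, mem_insert, mem_singleton]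
        constructor
        · rintro ⟨h1, h2, _⟩
          exact h1.resolve_left h2
        · rintro rfl
          exact ⟨Or.inr rfl, hab.symm, hcb⟩
      have hi : innerBelow a (p a) {a, b} = ∅ := by
        ext x
        simp only [innerBelow, mem_filter, mem_insert, mem_singleton, notMem_empty, iff_false]
        rintro ⟨h1, h2, h3⟩
        rw [h1.resolve_left h2] at h3
        exact h3 hcb
      have hb : branching a (p a) {a, b} = 0 := by
        rw [branching, sum_pair hab, hca, hcb]
        simp
      rw [rootWeight, if_neg h1, hV, rootedFlow, hl, hi, hb, flowQ, flow]
      simp [chain]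
    have hE : Γ.edgeSet.toFinset = {s(i, j)} := by
      have hpi := (root j i hij.symm (by rw [hK, pair_comm]) (hr j hj)).1
      have hadj := (hr j hj).adj_parent hi hij
      rw [hpi] at hadj
      ext e
      rw [Set.mem_toFinset, mem_singleton]
      constructor
      · induction e using Sym2.ind with
        | _ a b =>
          intro hab
          rw [SimpleGraph.Subgraph.mem_edgeSet] at hab
          have ha := mem_verts.2 hab.fst_mem
          have hb := mem_verts.2 hab.snd_mem
          have hne := hab.ne
          rw [hK, mem_insert, mem_singleton] at ha hb
          rcases ha with rfl | rfl <;> rcases hb with rfl | rfl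
          · exact absurd rfl hne
          · rfl
          · exact Sym2.eq_swap
          · exact absurd rfl hne
      · rintro rfl
        exact hadj
    have hsum := sum_pair (f := fun r => rootWeight D r (p r) (verts Γ)) hij
    rw [← hK] at hsum
    rw [hE, sum_singleton, phi2_eq hD hp hij, hsum, (root i j hij hK (hr i hi)).2,
      (root j i hij.symm (by rw [hK, pair_comm]) (hr j hj)).2, pair_comm j i]
    ring
  have h3 : 3 ≤ (verts Γ).card := by
    have : (verts Γ).card ≠ 0 := by
      intro h0
      obtain ⟨v⟩ := h.1.nonempty
      rw [card_eq_zero] at h0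
      have := mem_verts.2 v.2
      rw [h0] at this
      exact notMem_empty _ this
    omega
  obtain ⟨r0, hr0⟩ := card_pos.1 (by omega : 0 < (verts Γ).card)
  rw [phi_eq_flow hD h h3 (hδ h3),
    flow_q_cons hq hD ((hr r0 hr0).stem_nonempty h3) (disjoint_stem_leaves Γ) hp,
    ← stem_union_leaves Γ, sum_union (disjoint_stem_leaves Γ), add_comm, stem_union_leaves]
  have hinner : ∀ r ∈ verts Γ, insert r (innerBelow r (p r) (verts Γ)) = insert r (stem Γ) ∧
      leavesBelow r (p r) (verts Γ) = (leaves Γ).erase r := by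
    intro r hrV
    have hR := hr r hrV
    have hval : ∀ v ∈ verts Γ, v ≠ r → (children r (p r) (verts Γ) v = ∅ ↔ valency Γ v = 1) := by
      intro v hv hvr
      rw [hR.valency_eq hv, if_neg hvr, ← card_eq_zero]
      omega
    constructor
    · ext v
      simp only [mem_insert, innerBelow, stem, mem_filter]
      by_cases hvr : v = r
      · simp [hvr]
      · simp only [hvr, false_or]
        constructor
        · rintro ⟨h1, h2, h3⟩
          exact ⟨h1, fun h => h3 ((hval v h1 h2).2 h)⟩
        · rintro ⟨h1, h3⟩
          exact ⟨h1, hvr, fun h => h3 ((hval v h1 hvr).1 h)⟩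
    · ext v
      simp only [mem_erase, leavesBelow, leaves, mem_filter]
      constructor
      · rintro ⟨h1, h2, h3⟩
        exact ⟨h2, h1, (hval v h1 h2).1 h3⟩
      · rintro ⟨h2, h1, h3⟩
        exact ⟨h1, h2, (hval v h1 h2).2 h3⟩
  have hbranch : ∀ r ∈ verts Γ, ∀ v, Multiset.count v (branching r (p r) (verts Γ)) =
      if v ∈ verts Γ then (valency Γ v - if v = r then 1 else 2) else 0 := by
    intro r hrV v
    rw [branching, count_sum_replicate]
    split_ifs with hv hvr
    · rw [(hr r hrV).valency_eq hv, if_pos hvr]; rfl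
    · rw [(hr r hrV).valency_eq hv, if_neg hvr]; rfl
    · rfl
  have hdelta : ∀ v, Multiset.count v (delta Γ) =
      if v ∈ verts Γ then valency Γ v - 2 else 0 := fun v => by
    rw [delta, count_sum_replicate]
  congr 1
  · refine sum_congr rfl fun r hrs => ?_
    have hrs' := hrs
    rw [stem, mem_filter] at hrs
    have hl : r ∉ leaves Γ := disjoint_left.1 (disjoint_stem_leaves Γ) hrs'
    rw [rootWeight, if_neg h1, rootedFlow, (hinner r hrs.1).1, (hinner r hrs.1).2,
      erase_eq_of_notMem hl, insert_eq_of_mem hrs']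
    have : branching r (p r) (verts Γ) = r ::ₘ delta Γ := by
      ext v
      rw [hbranch r hrs.1, Multiset.count_cons, hdelta]
      by_cases hvr : v = r
      · subst hvr
        have := (hr v hrs.1).one_le_valency (by omega) hrs.1
        rw [if_pos hrs.1, if_pos hrs.1, if_pos rfl, if_pos rfl]
        omega
      · simp [hvr]
    rw [this]
  · refine sum_congr rfl fun r hrl => ?_
    have hrl' := hrl
    rw [leaves, mem_filter] at hrl
    rw [rootWeight, if_neg h1, rootedFlow, (hinner r hrl.1).1, (hinner r hrl.1).2]
    have : branching r (p r) (verts Γ) = delta Γ := by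
      ext v
      rw [hbranch r hrl.1, hdelta]
      by_cases hvr : v = r
      · subst hvr
        rw [if_pos hrl.1, if_pos hrl.1, if_pos rfl, hrl.2]
      · simp [hvr]
    rw [this]

end Weights

/-! ### Removing an edge -/

section Branches

variable {ι : Type*} [Fintype ι] [DecidableEq ι]

open Classical in
/-- The descendants of `j` in `K`, including `j`. -/
noncomputable def desc (K : Finset ι) (p : ι → ι) (j : ι) : Finset ι :=
  K.filter fun x => ∃ n, p^[n] x = j

omit [Fintype ι] [DecidableEq ι] in
lemma mem_desc {K : Finset ι} {p : ι → ι} {j x : ι} :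
    x ∈ desc K p j ↔ x ∈ K ∧ ∃ n, p^[n] x = j := by
  classical
  rw [desc, mem_filter]

namespace GraphRooted

variable {Γ : Graph ι} {r : ι} {p : ι → ι} {d : ι → ℕ}

omit [Fintype ι] [DecidableEq ι] in
lemma self_mem_desc {K : Finset ι} {j : ι} (hj : j ∈ K) : j ∈ desc K p j :=
  mem_desc.2 ⟨hj, 0, rfl⟩

omit [DecidableEq ι] in
lemma parent_mem_desc_iff (h : GraphRooted Γ r p d) {j x : ι} (hx : x ∈ verts Γ) (hxj : x ≠ j) :
    p x ∈ desc (verts Γ) p j ↔ x ∈ desc (verts Γ) p j := by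
  rw [mem_desc, mem_desc]
  constructor
  · rintro ⟨_, n, hn⟩
    exact ⟨hx, n + 1, by rwa [Function.iterate_succ_apply]⟩
  · rintro ⟨_, n, hn⟩
    refine ⟨h.isRooted.parent_mem x hx, ?_⟩
    cases n with
    | zero => exact absurd hn hxj
    | succ n => exact ⟨n, by rwa [Function.iterate_succ_apply] at hn⟩

omit [DecidableEq ι] in
lemma root_notMem_desc (h : GraphRooted Γ r p d) {j : ι} (hj : j ≠ r) :
    r ∉ desc (verts Γ) p j := by
  rw [mem_desc]
  rintro ⟨_, n, hn⟩
  rw [h.isRooted.iterate_root] at hn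
  exact hj hn.symm

lemma parent_notMem_desc (h : GraphRooted Γ r p d) {j : ι} (hj : j ∈ verts Γ) (hjr : j ≠ r) :
    p j ∉ desc (verts Γ) p j := by
  rw [mem_desc]
  rintro ⟨_, n, hn⟩
  exact h.isRooted.iterate_parent_ne hj hjr n hn

/-- The graph from which the edge between `j` and its parent has been removed. -/
abbrev cutGraph (Γ : Graph ι) (p : ι → ι) (j : ι) : SimpleGraph ι :=
  (Γ.deleteEdges {s(j, p j)}).spanningCoe

lemma cutGraph_adj_parent (h : GraphRooted Γ r p d) {j x : ι} (hj : j ∈ verts Γ) (hjr : j ≠ r)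
    (hx : x ∈ verts Γ) (hxr : x ≠ r) (hxj : x ≠ j) : (cutGraph Γ p j).Adj x (p x) := by
  rw [SimpleGraph.Subgraph.spanningCoe_adj, SimpleGraph.Subgraph.deleteEdges_adj]
  refine ⟨h.adj_parent hx hxr, ?_⟩
  rw [Set.mem_singleton_iff, Sym2.eq_iff]
  rintro (⟨h1, _⟩ | ⟨h1, h2⟩)
  · exact hxj h1
  · subst h1
    exact h.isRooted.iterate_parent_ne hj hjr 1 h2

omit [DecidableEq ι] in
lemma cutGraph_reachable_iff (h : GraphRooted Γ r p d) {j : ι} {x y : ι}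
    (hxy : (cutGraph Γ p j).Reachable x y) (hx : x ∈ verts Γ) :
    y ∈ verts Γ ∧ (x ∈ desc (verts Γ) p j ↔ y ∈ desc (verts Γ) p j) := by
  obtain ⟨w⟩ := hxy
  induction w with
  | nil => exact ⟨hx, Iff.rfl⟩
  | @cons a b c hab w ih =>
    rw [SimpleGraph.Subgraph.spanningCoe_adj, SimpleGraph.Subgraph.deleteEdges_adj] at hab
    obtain ⟨hadj, hne⟩ := hab
    have hb : b ∈ verts Γ := mem_verts.2 hadj.snd_mem
    obtain ⟨h1, h2⟩ := ih hb
    refine ⟨h1, Iff.trans ?_ h2⟩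
    rw [Set.mem_singleton_iff] at hne
    rcases (h.adj_iff a b).1 hadj with ⟨_, _, rfl⟩ | ⟨_, _, rfl⟩
    · exact (h.parent_mem_desc_iff hx (fun h' => hne (by rw [h']))).symm
    · exact h.parent_mem_desc_iff hb (fun h' => hne (by rw [h', Sym2.eq_swap]))

lemma cutGraph_reachable_desc (h : GraphRooted Γ r p d) {j : ι} (hj : j ∈ verts Γ) (hjr : j ≠ r) :
    ∀ x ∈ verts Γ, x ∈ desc (verts Γ) p j → (cutGraph Γ p j).Reachable x j := by
  refine h.isRooted.induction (fun h' => absurd h' (h.root_notMem_desc hjr))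
    fun x hx hxr ih hxd => ?_
  by_cases hxj : x = j
  · rw [hxj]
  · exact (h.cutGraph_adj_parent hj hjr hx hxr hxj).reachable.trans
      (ih ((h.parent_mem_desc_iff hx hxj).2 hxd))

lemma cutGraph_reachable_root (h : GraphRooted Γ r p d) {j : ι} (hj : j ∈ verts Γ) (hjr : j ≠ r) :
    ∀ x ∈ verts Γ, x ∉ desc (verts Γ) p j → (cutGraph Γ p j).Reachable x r := by
  refine h.isRooted.induction (fun _ => SimpleGraph.Reachable.refl _) fun x hx hxr ih hxd => ?_
  have hxj : x ≠ j := by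
    rintro rfl
    exact hxd (self_mem_desc hx)
  exact (h.cutGraph_adj_parent hj hjr hx hxr hxj).reachable.trans
    (ih (fun h' => hxd ((h.parent_mem_desc_iff hx hxj).1 h')))

omit [DecidableEq ι] in
lemma _root_.GravityBG.mem_verts_branch {Γ : Graph ι} {v w x : ι} : x ∈ verts (branch Γ v w) ↔
    (Γ.deleteEdges {s(v, w)}).spanningCoe.Reachable v x := by
  rw [mem_verts, branch, SimpleGraph.Subgraph.induce_verts, Set.mem_ofPred_eq]

lemma verts_branch_child (h : GraphRooted Γ r p d) {j : ι} (hj : j ∈ verts Γ) (hjr : j ≠ r) :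
    verts (branch Γ j (p j)) = desc (verts Γ) p j := by
  ext x
  rw [mem_verts_branch]
  constructor
  · intro hx
    exact (h.cutGraph_reachable_iff hx hj).2.1 (self_mem_desc hj)
  · intro hx
    exact (h.cutGraph_reachable_desc hj hjr x (mem_desc.1 hx).1 hx).symm

lemma verts_branch_parent (h : GraphRooted Γ r p d) {j : ι} (hj : j ∈ verts Γ) (hjr : j ≠ r) :
    verts (branch Γ (p j) j) = verts Γ \ desc (verts Γ) p j := by
  have hpj := h.isRooted.parent_mem j hj
  have hpd := h.parent_notMem_desc hj hjr
  ext x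
  rw [mem_verts_branch, Sym2.eq_swap, mem_sdiff]
  constructor
  · intro hx
    have := h.cutGraph_reachable_iff hx hpj
    exact ⟨this.1, fun h' => hpd (this.2.2 h')⟩
  · rintro ⟨hx, hxd⟩
    exact (h.cutGraph_reachable_root hj hjr _ hpj hpd).trans
      (h.cutGraph_reachable_root hj hjr x hx hxd).symm

omit [DecidableEq ι] in
lemma _root_.GravityBG.branch_eq_induce (Γ : Graph ι) (v w : ι) :
    branch Γ v w = Γ.induce (verts (branch Γ v w) : Set ι) := by
  conv_lhs => rw [branch]
  congr 1
  ext x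
  rw [mem_coe, mem_verts_branch, Set.mem_ofPred_eq]

omit [Fintype ι] [DecidableEq ι] in
lemma _root_.GravityBG.subset_iff_induce_le {Γ : Graph ι} {X Y : Finset ι} :
    Γ.induce (X : Set ι) ≤ Γ.induce (Y : Set ι) ↔ X ⊆ Y := by
  constructor
  · intro h x hx
    have := h.1 (show x ∈ (Γ.induce (X : Set ι)).verts from mem_coe.2 hx)
    exact mem_coe.1 this
  · intro h
    exact SimpleGraph.Subgraph.induce_mono_right (coe_subset.2 h)

end GraphRooted

end Branches

/-! ### The coefficients of the edges -/

section EdgeSum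

variable {ι : Type*} [Fintype ι] [DecidableEq ι] (D : SpinorData ι)

/-- The coefficient `(q|I|J|q)(ij) / ((qi)(jq))` of the oriented edge `i j` in the recursion. It is
symmetric in `i` and `j`, see `cutTerm_swap`. -/
noncomputable def cutTerm (Γ : Graph ι) (i j : ι) : ℂ :=
  sand D.q (D.tot (verts (branch Γ i j))) (D.tot (verts (branch Γ j i))) D.q *
    (br (D.lam i) (D.lam j) / (br D.q (D.lam i) * br (D.lam j) D.q))

variable {D} (hq : ∀ v, br D.q (D.lam v) ≠ 0)
variable {Γ : Graph ι} {r : ι} {p : ι → ι} {d : ι → ℕ}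

omit [Fintype ι] [DecidableEq ι] in
include hq in
lemma br_div_br (i j : ι) : br (D.lam i) (D.lam j) / (br D.q (D.lam i) * br (D.lam j) D.q) =
    -br (nlam D i) (nlam D j) := by
  have h1 := hq i
  have h2 := hq j
  have : br (nlam D i) (nlam D j) =
      (br D.q (D.lam i))⁻¹ * (br D.q (D.lam j))⁻¹ * br (D.lam i) (D.lam j) := by
    simp only [nlam, br_eq, Pi.smul_apply, smul_eq_mul]; ring
  rw [this, br_swap (D.lam j) D.q]
  field_simp

omit [Fintype ι] [DecidableEq ι] in
include hq in
/-- The contractions of the normalised spinors are differences of a function of the vertices. -/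
lemma br_nlam_add (i j k : ι) :
    br (nlam D i) (nlam D j) + br (nlam D j) (nlam D k) = br (nlam D i) (nlam D k) := by
  have h := schouten (nlam D j) (nlam D i) (nlam D k)
  have hi := br_q_nlam D (hq i)
  have hj := br_q_nlam D (hq j)
  have hk := br_q_nlam D (hq k)
  rw [br_eq] at hi hj hk
  have h0 := congrFun h 0
  have h1 := congrFun h 1
  simp only [Pi.sub_apply, Pi.smul_apply, Pi.neg_apply, smul_eq_mul] at h0 h1
  rw [br_swap (nlam D i) (nlam D j)]
  linear_combination (-D.q 0) * h1 + D.q 1 * h0 + br (nlam D j) (nlam D i) * hk -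
    br (nlam D j) (nlam D k) * hi + br (nlam D i) (nlam D k) * hj

include hq in
lemma GraphRooted.cutTerm_parent (h : GraphRooted Γ r p d) {j : ι} (hj : j ∈ verts Γ)
    (hjr : j ≠ r) : cutTerm D Γ (p j) j = -∑ x ∈ desc (verts Γ) p j,
      sand D.q (D.tot (verts Γ)) (D.mom x) D.q * br (nlam D (p j)) (nlam D j) := by
  have hsub : desc (verts Γ) p j ⊆ verts Γ := fun x hx => (mem_desc.1 hx).1
  have e : D.tot (verts Γ) = D.tot (verts Γ \ desc (verts Γ) p j) + D.tot (desc (verts Γ) p j) := by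
    rw [SpinorData.tot, SpinorData.tot, SpinorData.tot, sum_sdiff hsub]
  have e2 : sand D.q (D.tot (verts Γ \ desc (verts Γ) p j)) (D.tot (desc (verts Γ) p j)) D.q =
      ∑ x ∈ desc (verts Γ) p j, sand D.q (D.tot (verts Γ)) (D.mom x) D.q := by
    rw [← sand_sum_right, ← SpinorData.tot, e, sand_add_left, sand_self, add_zero]
  rw [cutTerm, h.verts_branch_parent hj hjr, h.verts_branch_child hj hjr, br_div_br hq, e2,
    ← sum_mul, mul_neg]

include hq in
/-- The sum over the edges outside of `X` that separate `x` from the root telescopes along the way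
from `x` to its gate. -/
lemma GraphRooted.sum_br_nlam (h : GraphRooted Γ r p d) {X : Finset ι}
    (hX : IsClosedBelow (verts Γ) r p X) : ∀ x ∈ verts Γ,
    ∑ j ∈ verts Γ \ X with x ∈ desc (verts Γ) p j, br (nlam D (p j)) (nlam D j) =
      br (nlam D (gate p X x)) (nlam D x) := by
  have hin : ∀ x ∈ X, ∑ j ∈ verts Γ \ X with x ∈ desc (verts Γ) p j,
      br (nlam D (p j)) (nlam D j) = br (nlam D (gate p X x)) (nlam D x) := by
    intro x hx
    rw [gate_of_mem hx, br_self, filter_false_of_mem, sum_empty]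
    intro j hj hxj
    rw [mem_sdiff] at hj
    obtain ⟨n, rfl⟩ := (mem_desc.1 hxj).2
    refine hj.2 ?_
    clear hj hxj
    induction n with
    | zero => exact hx
    | succ n ih => rw [Function.iterate_succ_apply']; exact hX.parent_mem _ ih
  refine h.isRooted.induction (hin r hX.root_mem) fun x hxK hxr ih => ?_
  by_cases hx : x ∈ X
  · exact hin x hx
  have hpK := h.isRooted.parent_mem x hxK
  have hset : (verts Γ \ X).filter (fun j => x ∈ desc (verts Γ) p j) =
      insert x ((verts Γ \ X).filter fun j => p x ∈ desc (verts Γ) p j) := by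
    ext j
    simp only [mem_filter, mem_insert, mem_sdiff]
    by_cases hj : j = x
    · subst hj
      simp [hxK, hx, GraphRooted.self_mem_desc]
    · rw [h.parent_mem_desc_iff hxK (Ne.symm hj)]
      simp [hj]
  rw [hset, sum_insert, ih, gate_of_notMem hx (h.isRooted.exists_iterate_mem hX.root_mem hpK),
    add_comm, br_nlam_add hq]
  rw [mem_filter, not_and]
  exact fun _ => h.parent_notMem_desc hxK hxr

omit [Fintype ι] [DecidableEq ι] in
include hq in
lemma moved_eq (g x : ι) : moved D g x =
    D.mom x + (br (nlam D g) (nlam D x) * br D.q (D.lam x)) • Matrix.vecMulVec D.q (D.lamBar x) := by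
  have h := schouten D.q (nlam D g) (nlam D x)
  rw [br_q_nlam D (hq g), br_q_nlam D (hq x), one_smul, one_smul] at h
  rw [← moved_self hq x]
  ext a b
  have ha := congrFun h a
  simp only [Pi.sub_apply, Pi.smul_apply, Pi.neg_apply, smul_eq_mul] at ha
  rw [Matrix.add_apply, Matrix.smul_apply, moved_apply, moved_apply, Matrix.vecMulVec_apply,
    smul_eq_mul]
  linear_combination (-(br D.q (D.lam x) * D.lamBar x b)) * ha

omit [Fintype ι] [DecidableEq ι] in
lemma msq_add_sum_smul (P : Momentum) (s : ι → ℂ) (C : Finset ι) :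
    msq (P + ∑ x ∈ C, (s x * br D.q (D.lam x)) • Matrix.vecMulVec D.q (D.lamBar x)) =
      msq P + ∑ x ∈ C, sand D.q P (D.mom x) D.q * s x := by
  classical
  induction C using Finset.induction_on generalizing P with
  | empty => simp
  | insert z C hz ih =>
    have e1 : msq (P + (s z * br D.q (D.lam z)) • Matrix.vecMulVec D.q (D.lamBar z)) =
        msq P + sand D.q P (D.mom z) D.q * s z := by
      simp only [msq_eq, sand_eq, Matrix.add_apply, Matrix.smul_apply, Matrix.vecMulVec_apply,
        smul_eq_mul, mom_apply, br_eq]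
      ring
    have e2 : ∀ x, sand D.q (P + (s z * br D.q (D.lam z)) • Matrix.vecMulVec D.q (D.lamBar z))
        (D.mom x) D.q = sand D.q P (D.mom x) D.q := by
      intro x
      simp only [sand_eq, Matrix.add_apply, Matrix.smul_apply, Matrix.vecMulVec_apply,
        smul_eq_mul]
      ring
    rw [sum_insert hz, sum_insert hz, ← add_assoc, ih, e1]
    simp only [e2]
    ring

open Classical in
/-- An edge with `X` on the side of `e.1` leads away from the root to a vertex outside of `X`. -/
lemma GraphRooted.sum_cutTerm (h : GraphRooted Γ r p d) {X : Finset ι}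
    (hX : IsClosedBelow (verts Γ) r p X) :
    ∑ e : ι × ι with Γ.Adj e.1 e.2 ∧ Γ.induce (X : Set ι) ≤ branch Γ e.1 e.2,
      cutTerm D Γ e.1 e.2 = ∑ j ∈ verts Γ \ X, cutTerm D Γ (p j) j := by
  symm
  refine sum_bij (fun j _ => (p j, j)) ?_ ?_ ?_ ?_
  · intro j hj
    rw [mem_sdiff] at hj
    have hjr : j ≠ r := fun h' => hj.2 (h' ▸ hX.root_mem)
    rw [mem_filter]
    refine ⟨mem_univ _, (h.adj_parent hj.1 hjr).symm, ?_⟩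
    rw [branch_eq_induce, subset_iff_induce_le, h.verts_branch_parent hj.1 hjr]
    intro x hx
    rw [mem_sdiff]
    refine ⟨hX.subset hx, fun hxd => hj.2 ?_⟩
    obtain ⟨n, rfl⟩ := (mem_desc.1 hxd).2
    clear hj hjr hxd
    induction n with
    | zero => exact hx
    | succ n ih => rw [Function.iterate_succ_apply']; exact hX.parent_mem _ ih
  · intro j _ j' _ hjj
    exact (Prod.ext_iff.1 hjj).2
  · rintro ⟨i, j⟩ he
    rw [mem_filter] at he
    obtain ⟨_, hadj, hle⟩ := he
    simp only at hadj hle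
    rw [branch_eq_induce, subset_iff_induce_le] at hle
    rcases (h.adj_iff i j).1 hadj with ⟨hi, hir, rfl⟩ | ⟨hj, hjr, rfl⟩
    · rw [h.verts_branch_child hi hir] at hle
      exact absurd (hle hX.root_mem) (h.root_notMem_desc hir)
    · rw [h.verts_branch_parent hj hjr] at hle
      exact ⟨j, mem_sdiff.2 ⟨hj, fun hjX =>
        (mem_sdiff.1 (hle hjX)).2 (GraphRooted.self_mem_desc hj)⟩, rfl⟩
  · intro j _
    rfl

include hq in
lemma GraphRooted.sum_cutTerm_parent (h : GraphRooted Γ r p d) {X : Finset ι}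
    (hX : IsClosedBelow (verts Γ) r p X) : ∑ j ∈ verts Γ \ X, cutTerm D Γ (p j) j =
      -∑ x ∈ verts Γ, sand D.q (D.tot (verts Γ)) (D.mom x) D.q *
        br (nlam D (gate p X x)) (nlam D x) := by
  have e1 : ∀ j ∈ verts Γ \ X, cutTerm D Γ (p j) j = -∑ x ∈ verts Γ,
      if x ∈ desc (verts Γ) p j then
        sand D.q (D.tot (verts Γ)) (D.mom x) D.q * br (nlam D (p j)) (nlam D j) else 0 := by
    intro j hj
    rw [mem_sdiff] at hj
    have hjr : j ≠ r := fun h' => hj.2 (h' ▸ hX.root_mem)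
    rw [h.cutTerm_parent hq hj.1 hjr, ← sum_filter, filter_mem_eq_inter,
      inter_eq_right.2 fun x hx => (mem_desc.1 hx).1]
  rw [sum_congr rfl e1, sum_neg_distrib, sum_comm]
  refine congrArg _ (sum_congr rfl fun x hx => ?_)
  rw [← sum_filter, ← mul_sum, h.sum_br_nlam hq hX x hx]

open Classical in
include hq in
/-- Subtracting from `(1 + K)²` the terms of the edges outside of a subtree turns the spinor of each
vertex into that of its gate. -/
lemma GraphRooted.den_sub_sum_cutTerm (h : GraphRooted Γ r p d) {X : Finset ι}
    (hX : IsClosedBelow (verts Γ) r p X) :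
    den D (verts Γ) - ∑ e : ι × ι with Γ.Adj e.1 e.2 ∧ Γ.induce (X : Set ι) ≤ branch Γ e.1 e.2,
      cutTerm D Γ e.1 e.2 = msq (projTot D (verts Γ) p X) := by
  have e1 : ∀ x ∈ verts Γ, sand D.q (D.tot (verts Γ)) (D.mom x) D.q *
        br (nlam D (gate p X x)) (nlam D x) =
      sand D.q (D.tot1 (verts Γ)) (D.mom x) D.q * br (nlam D (gate p X x)) (nlam D x) := by
    intro x _
    rw [sand_swap D.q (D.tot1 _), sand_tot1_q, ← sand_swap]
  rw [h.sum_cutTerm hX, h.sum_cutTerm_parent hq hX, sum_congr rfl e1, sub_neg_eq_add, den,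
    ← msq_add_sum_smul, projTot]
  congr 1
  rw [SpinorData.tot1, add_assoc, SpinorData.tot, ← sum_add_distrib]
  exact congrArg _ (sum_congr rfl fun x _ => (moved_eq hq _ x).symm)

/-! ### The recursion for a single tree -/

lemma branch_le (hΓ : IsSubtree Γ) {i j : ι} (hij : Γ.Adj i j) : branch Γ i j ≤ Γ := by
  obtain ⟨p, d, h⟩ := hΓ.exists_graphRooted (mem_verts.2 hij.fst_mem)
  have hv : verts (branch Γ i j) ⊆ verts Γ := by
    rcases (h.adj_iff i j).1 hij with ⟨hi, hir, rfl⟩ | ⟨hj, hjr, hp⟩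
    · exact absurd rfl hir
    · have := h.verts_branch_parent hj hjr
      rw [← hp] at this
      rw [this]
      exact sdiff_subset
  rw [branch_eq_induce]
  refine ⟨?_, fun x y hxy => hxy.2.2⟩
  rw [SimpleGraph.Subgraph.induce_verts, ← coe_verts Γ]
  exact coe_subset.2 hv

open Classical in
include hq in
/-- The recursion for `Φ`. An oriented edge contributes to the coefficient of each subtree on the
side of its first vertex. -/
theorem bigPhi_recursion (hD : ∀ S : Finset ι, S.Nonempty → den D S ≠ 0)
    (hp : br D.oneBar D.p ≠ 0) {δ : (Γ : Graph ι) → Fin (numEnds Γ - 2) → ι}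
    (hδ : ∀ Γ : Graph ι, IsSubtree Γ → 3 ≤ (verts Γ).card → IsDeltaEnumeration Γ (δ Γ))
    (hΓ : IsSubtree Γ) :
    den D (verts Γ) * bigPhi D δ Γ =
      (sand1 D.q (D.tot (verts Γ)) D.p) ^ 2 / (br D.oneBar D.p) ^ 2 +
        ∑ e : ι × ι with Γ.Adj e.1 e.2, cutTerm D Γ e.1 e.2 * bigPhi D δ (branch Γ e.1 e.2) := by
  have hroot : ∀ r, ∃ (p : ι → ι) (d : ι → ℕ), r ∈ verts Γ → GraphRooted Γ r p d := by
    intro r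
    by_cases hr : r ∈ verts Γ
    · obtain ⟨p, d, h⟩ := hΓ.exists_graphRooted hr
      exact ⟨p, d, fun _ => h⟩
    · exact ⟨id, fun _ => 0, fun h => absurd h hr⟩
  choose p d hpd using hroot
  have hbr : ∀ e ∈ (univ : Finset (ι × ι)).filter (fun e => Γ.Adj e.1 e.2),
      cutTerm D Γ e.1 e.2 * bigPhi D δ (branch Γ e.1 e.2) = ∑ Γ' ∈ subtrees Γ,
        if Γ' ≤ branch Γ e.1 e.2 then phi D Γ' (δ Γ') * cutTerm D Γ e.1 e.2 else 0 := by
    intro e he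
    rw [bigPhi, ← sum_filter, mul_sum]
    refine sum_congr ?_ fun _ _ => mul_comm _ _
    ext Γ'
    rw [mem_filter, mem_subtrees, mem_subtrees]
    have hle := branch_le hΓ (mem_filter.1 he).2
    exact ⟨fun h => ⟨⟨h.1, h.2.trans hle⟩, h.2⟩, fun h => ⟨h.1.1, h.2⟩⟩
  -- the coefficient of `φ(Γ')` when all the terms with `Φ` are on the left-hand side
  set g : Graph ι → ℂ := fun Γ' => den D (verts Γ) -
    ∑ e : ι × ι with Γ.Adj e.1 e.2 ∧ Γ' ≤ branch Γ e.1 e.2, cutTerm D Γ e.1 e.2 with hg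
  have hphi : ∀ Γ' ∈ subtrees Γ, phi D Γ' (δ Γ') =
      ∑ r ∈ verts Γ', rootWeight D r (p r) (verts Γ') := by
    intro Γ' hΓ'
    obtain ⟨hs, hle⟩ := mem_subtrees.1 hΓ'
    refine phi_eq_sum_rootWeight hq hD hp hs (d := d) (fun r hr => ?_) (hδ Γ' hs)
    have h := hpd r (mem_verts.2 (hle.1 (mem_verts.1 hr)))
    obtain ⟨hX, he⟩ := h.of_le hs hle hr
    have := (h.induce hX).2
    rwa [he] at this
  have key : ∑ Γ' ∈ subtrees Γ, phi D Γ' (δ Γ') * g Γ' = (∑ x ∈ verts Γ, zed D x) ^ 2 := by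
    calc ∑ Γ' ∈ subtrees Γ, phi D Γ' (δ Γ') * g Γ'
        = ∑ Γ' ∈ subtrees Γ, ∑ r ∈ verts Γ', rootWeight D r (p r) (verts Γ') * g Γ' :=
          sum_congr rfl fun Γ' hΓ' => by rw [hphi Γ' hΓ', sum_mul]
      _ = ∑ r ∈ verts Γ, ∑ Γ' ∈ subtrees Γ with r ∈ verts Γ',
            rootWeight D r (p r) (verts Γ') * g Γ' := by
          refine sum_comm' fun Γ' r => ?_
          rw [mem_filter]
          constructor
          · rintro ⟨h1, h2⟩
            exact ⟨⟨h1, h2⟩, mem_verts.2 ((mem_subtrees.1 h1).2.1 (mem_verts.1 h2))⟩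
          · rintro ⟨h1, _⟩
            exact h1
      _ = ∑ r ∈ verts Γ, zed D r * ∑ x ∈ verts Γ, zed D x := by
          refine sum_congr rfl fun r hr => ?_
          have h := hpd r hr
          rw [h.sum_subtrees, ← h.isRooted.sum_rootWeight_projTot hq hD hp]
          refine sum_congr rfl fun X hX => ?_
          rw [mem_closedSets] at hX
          rw [(h.induce hX).1, hg, ← h.den_sub_sum_cutTerm hq hX]
      _ = _ := by rw [← sum_mul, sq]
  have hz : ∑ x ∈ verts Γ, zed D x = sand1 D.q (D.tot (verts Γ)) D.p / br D.oneBar D.p := by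
    rw [SpinorData.tot, sand1_sum, sum_div]
    exact sum_congr rfl fun x _ => by rw [zed, sand1_mom]
  rw [sum_congr rfl hbr, sum_comm, ← div_pow, ← hz, ← key, ← sum_add_distrib, bigPhi, mul_sum]
  refine sum_congr rfl fun Γ' _ => ?_
  rw [hg, ← sum_filter, filter_filter, ← mul_sum]
  ring

end EdgeSum

/-! ### Joining two trees by an edge -/

section Join

variable {ι : Type*} [Fintype ι] [DecidableEq ι]

/-- The union of `Γ₁` and `Γ₂` and an edge between `i` and `j`. -/
def join (Γ₁ Γ₂ : Graph ι) {i j : ι} (hij : i ≠ j) : Graph ι :=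
  Γ₁ ⊔ Γ₂ ⊔ SimpleGraph.subgraphOfAdj ⊤ (show (⊤ : SimpleGraph ι).Adj i j from hij)

variable {Γ Γ₁ Γ₂ : Graph ι} {i j : ι}

omit [Fintype ι] [DecidableEq ι] in
lemma join_adj (hij : i ≠ j) (x y : ι) : (join Γ₁ Γ₂ hij).Adj x y ↔
    Γ₁.Adj x y ∨ Γ₂.Adj x y ∨ (x = i ∧ y = j) ∨ (x = j ∧ y = i) := by
  rw [join, SimpleGraph.Subgraph.sup_adj, SimpleGraph.Subgraph.sup_adj,
    SimpleGraph.subgraphOfAdj_adj, Sym2.eq_iff, or_assoc]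
  tauto

lemma verts_join (hij : i ≠ j) (hi : i ∈ verts Γ₁) (hj : j ∈ verts Γ₂) :
    verts (join Γ₁ Γ₂ hij) = verts Γ₁ ∪ verts Γ₂ := by
  ext x
  rw [mem_union, mem_verts, mem_verts, mem_verts, join, SimpleGraph.Subgraph.verts_sup,
    SimpleGraph.Subgraph.verts_sup, SimpleGraph.subgraphOfAdj_verts]
  rw [mem_verts] at hi hj
  constructor
  · rintro (h | h | h)
    · exact h
    · rw [h]; exact Or.inl hi
    · rw [Set.mem_singleton_iff] at h; rw [h]; exact Or.inr hj
  · exact fun h => Or.inl h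

omit [Fintype ι] [DecidableEq ι] in
lemma join_swap (hij : i ≠ j) : join Γ₁ Γ₂ hij = join Γ₂ Γ₁ hij.symm := by
  rw [join, join, sup_comm Γ₁]
  congr 1
  ext x y
  · simp [or_comm]
  · simp [Sym2.eq_swap]

namespace GraphRooted

variable {p₁ p₂ : ι → ι} {d₁ d₂ : ι → ℕ}

lemma join (h₁ : GraphRooted Γ₁ i p₁ d₁) (h₂ : GraphRooted Γ₂ j p₂ d₂)
    (hd : Disjoint (verts Γ₁) (verts Γ₂)) (hij : i ≠ j) :
    GraphRooted (join Γ₁ Γ₂ hij) i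
      (fun x => if x ∈ verts Γ₁ then p₁ x else if x = j then i else p₂ x)
      (fun x => if x ∈ verts Γ₁ then d₁ x else d₂ x + d₁ i + 1) := by
  have hi := h₁.isRooted.root_mem
  have hj := h₂.isRooted.root_mem
  have hv := verts_join hij hi hj
  have hn : ∀ {x}, x ∈ verts Γ₂ → x ∉ verts Γ₁ := fun h2 h1 => disjoint_left.1 hd h1 h2
  refine ⟨⟨?_, ?_, ?_, ?_⟩, ?_⟩
  · rw [hv]; exact mem_union_left _ hi
  · simp only [if_pos hi, h₁.isRooted.parent_root]
  · intro x hx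
    rw [hv, mem_union] at hx ⊢
    by_cases h1 : x ∈ verts Γ₁
    · rw [if_pos h1]
      exact Or.inl (h₁.isRooted.parent_mem x h1)
    · rw [if_neg h1]
      split_ifs
      · exact Or.inl hi
      · exact Or.inr (h₂.isRooted.parent_mem x (hx.resolve_left h1))
  · intro x hx hxi
    rw [hv, mem_union] at hx
    by_cases h1 : x ∈ verts Γ₁
    · simp only [if_pos h1, if_pos (h₁.isRooted.parent_mem x h1)]
      exact h₁.isRooted.depth_lt x h1 hxi
    · have h2 := hx.resolve_left h1
      simp only [if_neg h1]
      by_cases hxj : x = j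
      · simp only [if_pos hxj, if_pos hi]
        omega
      · simp only [if_neg hxj, if_neg (hn (h₂.isRooted.parent_mem x h2))]
        have := h₂.isRooted.depth_lt x h2 hxj
        omega
  · intro x y
    have key : ∀ x y : ι, (x ∈ verts (GravityBG.join Γ₁ Γ₂ hij) ∧ x ≠ i ∧
        y = if x ∈ verts Γ₁ then p₁ x else if x = j then i else p₂ x) ↔
        (x ∈ verts Γ₁ ∧ x ≠ i ∧ y = p₁ x) ∨ (x ∈ verts Γ₂ ∧ x ≠ j ∧ y = p₂ x) ∨
          (x = j ∧ y = i) := by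
      intro x y
      rw [hv, mem_union]
      by_cases h1 : x ∈ verts Γ₁
      · have h2 : x ∉ verts Γ₂ := fun h => hn h h1
        have h3 : x ≠ j := fun h => h2 (h ▸ hj)
        simp [h1, h2, h3]
      · have h3 : x ≠ i := fun h => h1 (h ▸ hi)
        by_cases hxj : x = j
        · subst hxj
          simp [h1, hj, hij.symm]
        · simp [h1, h3, hxj]
    rw [join_adj, h₁.adj_iff, h₂.adj_iff, key, key, and_comm (a := x = i)]
    have aux : ∀ a a' b b' c c' : Prop,
        (a ∨ a') ∨ (b ∨ b') ∨ c ∨ c' ↔ (a ∨ b ∨ c') ∨ a' ∨ b' ∨ c := by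
      intro a a' b b' c c'
      tauto
    exact aux ..

end GraphRooted

lemma IsSubtree.join (h₁ : IsSubtree Γ₁) (h₂ : IsSubtree Γ₂) (hd : Disjoint (verts Γ₁) (verts Γ₂))
    (hi : i ∈ verts Γ₁) (hj : j ∈ verts Γ₂) (hij : i ≠ j) : IsSubtree (join Γ₁ Γ₂ hij) := by
  obtain ⟨p₁, d₁, h₁⟩ := h₁.exists_graphRooted hi
  obtain ⟨p₂, d₂, h₂⟩ := h₂.exists_graphRooted hj
  exact (h₁.join h₂ hd hij).isSubtree

omit [DecidableEq ι] in
lemma induce_verts_join (hd : Disjoint (verts Γ₁) (verts Γ₂)) (hi : i ∈ verts Γ₁)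
    (hj : j ∈ verts Γ₂) (hij : i ≠ j) :
    (join Γ₁ Γ₂ hij).induce (verts Γ₁ : Set ι) = Γ₁ := by
  have hn : ∀ {x}, x ∈ verts Γ₁ → x ∉ verts Γ₂ := fun h1 h2 => disjoint_left.1 hd h1 h2
  ext x y
  · rw [SimpleGraph.Subgraph.induce_verts, coe_verts]
  · rw [SimpleGraph.Subgraph.induce_adj, join_adj, mem_coe, mem_coe]
    constructor
    · rintro ⟨hx, hy, h | h | ⟨rfl, rfl⟩ | ⟨rfl, rfl⟩⟩
      · exact h
      · exact absurd (mem_verts.2 h.fst_mem) (hn hx)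
      · exact absurd hj (hn hy)
      · exact absurd hj (hn hx)
    · exact fun h => ⟨mem_verts.2 h.fst_mem, mem_verts.2 h.snd_mem, Or.inl h⟩

/-- Removing the new edge of `join` gives back the two trees. -/
lemma branch_join (h₁ : IsSubtree Γ₁) (h₂ : IsSubtree Γ₂) (hd : Disjoint (verts Γ₁) (verts Γ₂))
    (hi : i ∈ verts Γ₁) (hj : j ∈ verts Γ₂) (hij : i ≠ j) :
    branch (join Γ₁ Γ₂ hij) i j = Γ₁ ∧ branch (join Γ₁ Γ₂ hij) j i = Γ₂ := by
  obtain ⟨p₁, d₁, h₁⟩ := h₁.exists_graphRooted hi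
  obtain ⟨p₂, d₂, h₂⟩ := h₂.exists_graphRooted hj
  have h := h₁.join h₂ hd hij
  have hj1 : j ∉ verts Γ₁ := fun h1 => disjoint_left.1 hd h1 hj
  have hv := verts_join hij hi hj
  have hjv : j ∈ verts (join Γ₁ Γ₂ hij) := by rw [hv]; exact mem_union_right _ hj
  have hb1 := h.verts_branch_parent hjv hij.symm
  have hb2 := h.verts_branch_child hjv hij.symm
  have m1 : ∀ x ∈ verts Γ₁, x ∉ desc (verts (join Γ₁ Γ₂ hij))
      (fun x => if x ∈ verts Γ₁ then p₁ x else if x = j then i else p₂ x) j := by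
    refine h₁.isRooted.induction (h.root_notMem_desc hij.symm) fun x hx hxr ih hxd => ih ?_
    have := (h.parent_mem_desc_iff (by rw [hv]; exact mem_union_left _ hx)
      (fun h' : x = j => hj1 (h' ▸ hx))).2 hxd
    rwa [if_pos hx] at this
  have m2 : ∀ x ∈ verts Γ₂, x ∈ desc (verts (join Γ₁ Γ₂ hij))
      (fun x => if x ∈ verts Γ₁ then p₁ x else if x = j then i else p₂ x) j := by
    refine h₂.isRooted.induction (GraphRooted.self_mem_desc hjv) fun x hx hxr ih => ?_
    refine (h.parent_mem_desc_iff (by rw [hv]; exact mem_union_right _ hx) hxr).1 ?_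
    rwa [if_neg (fun h1 => disjoint_left.1 hd h1 hx), if_neg hxr]
  have e2 : desc (verts (join Γ₁ Γ₂ hij))
      (fun x => if x ∈ verts Γ₁ then p₁ x else if x = j then i else p₂ x) j = verts Γ₂ := by
    ext x
    refine ⟨fun hx => ?_, m2 x⟩
    have := (mem_desc.1 hx).1
    rw [hv, mem_union] at this
    exact this.resolve_left fun h1 => m1 x h1 hx
  rw [e2, hv, union_sdiff_cancel_right hd] at hb1
  rw [e2] at hb2
  simp only [if_neg hj1, if_true] at hb1 hb2
  constructor
  · rw [branch_eq_induce, hb1, induce_verts_join hd hi hj]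
  · rw [branch_eq_induce, hb2, join_swap, induce_verts_join hd.symm hj hi]

/-- The tree without the edge `i j` consists of two trees, and the edge joins them. -/
lemma IsSubtree.branch (h : IsSubtree Γ) (hij : Γ.Adj i j) :
    IsSubtree (branch Γ i j) ∧ IsSubtree (branch Γ j i) ∧ i ∈ verts (branch Γ i j) ∧
      j ∈ verts (GravityBG.branch Γ j i) ∧
      verts (GravityBG.branch Γ j i) = verts Γ \ verts (GravityBG.branch Γ i j) ∧
      verts (GravityBG.branch Γ i j) ⊆ verts Γ ∧
      GravityBG.join (GravityBG.branch Γ i j) (GravityBG.branch Γ j i) hij.ne = Γ := by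
  obtain ⟨p, d, h⟩ := h.exists_graphRooted (mem_verts.2 hij.fst_mem)
  obtain ⟨hj, hji, hp⟩ : j ∈ verts Γ ∧ j ≠ i ∧ i = p j := by
    rcases (h.adj_iff i j).1 hij with ⟨_, hii, _⟩ | h'
    · exact absurd rfl hii
    · exact h'
  have hv1 := h.verts_branch_parent hj hji
  have hv2 := h.verts_branch_child hj hji
  rw [← hp] at hv1 hv2
  have hsub : desc (verts Γ) p j ⊆ verts Γ := fun x hx => (mem_desc.1 hx).1
  have hjd : j ∈ desc (verts Γ) p j := GraphRooted.self_mem_desc hj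
  have hid : i ∉ desc (verts Γ) p j := h.root_notMem_desc hji
  have hX : IsClosedBelow (verts Γ) i p (verts Γ \ desc (verts Γ) p j) := by
    refine ⟨sdiff_subset, mem_sdiff.2 ⟨h.isRooted.root_mem, hid⟩, fun x hx => ?_⟩
    rw [mem_sdiff] at hx ⊢
    exact ⟨h.isRooted.parent_mem x hx.1, fun hpx => hx.2
      ((h.parent_mem_desc_iff hx.1 (fun h' => hx.2 (h' ▸ hjd))).1 hpx)⟩
  have hr2 : GraphRooted (Γ.induce (desc (verts Γ) p j : Set ι)) j (Function.update p j j) d := by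
    have hv : verts (Γ.induce (desc (verts Γ) p j : Set ι)) = desc (verts Γ) p j := by
      ext x
      rw [mem_verts, SimpleGraph.Subgraph.induce_verts, mem_coe]
    refine ⟨⟨?_, Function.update_self .., ?_, ?_⟩, ?_⟩
    · rwa [hv]
    · intro x hx
      rw [hv] at hx ⊢
      by_cases hxj : x = j
      · rwa [hxj, Function.update_self]
      · rw [Function.update_of_ne hxj]
        exact (h.parent_mem_desc_iff (hsub hx) hxj).2 hx
    · intro x hx hxj
      rw [hv] at hx
      rw [Function.update_of_ne hxj]
      exact h.isRooted.depth_lt x (hsub hx) fun h' => hid (h' ▸ hx)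
    · have key : ∀ x y : ι, (x ∈ desc (verts Γ) p j ∧ x ≠ j ∧ y = Function.update p j j x) ↔
          (x ∈ desc (verts Γ) p j ∧ y ∈ desc (verts Γ) p j ∧
            (x ∈ verts Γ ∧ x ≠ i ∧ y = p x)) := by
        intro x y
        constructor
        · rintro ⟨hx, hxj, rfl⟩
          rw [Function.update_of_ne hxj]
          exact ⟨hx, (h.parent_mem_desc_iff (hsub hx) hxj).2 hx, hsub hx,
            fun h' => hid (h' ▸ hx), rfl⟩
        · rintro ⟨hx, hy, _, _, rfl⟩
          have hxj : x ≠ j := by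
            rintro rfl
            exact h.parent_notMem_desc hj hji hy
          exact ⟨hx, hxj, (Function.update_of_ne hxj ..).symm⟩
      intro x y
      rw [hv, SimpleGraph.Subgraph.induce_adj, h.adj_iff, mem_coe, mem_coe, key, key]
      tauto
  have hi1 : i ∈ verts (GravityBG.branch Γ i j) := by rw [hv1]; exact hX.root_mem
  have hj2 : j ∈ verts (GravityBG.branch Γ j i) := by rw [hv2]; exact hjd
  have hs1 : IsSubtree (GravityBG.branch Γ i j) := by
    rw [branch_eq_induce, hv1]
    exact (h.induce hX).2.isSubtree
  have hs2 : IsSubtree (GravityBG.branch Γ j i) := by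
    rw [branch_eq_induce, hv2]
    exact hr2.isSubtree
  have hv21 : verts (GravityBG.branch Γ j i) = verts Γ \ verts (GravityBG.branch Γ i j) := by
    rw [hv1, hv2, Finset.sdiff_sdiff_eq_self hsub]
  have hsub1 : verts (GravityBG.branch Γ i j) ⊆ verts Γ := by rw [hv1]; exact sdiff_subset
  refine ⟨hs1, hs2, hi1, hj2, hv21, hsub1, ?_⟩
  ext x y
  · rw [← mem_verts, verts_join hij.ne hi1 hj2, hv21, union_sdiff_of_subset hsub1, mem_verts]
  · have hside : ∀ x ∈ verts Γ, x ≠ j → (p x ∈ desc (verts Γ) p j ↔ x ∈ desc (verts Γ) p j) :=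
      fun x hx hxj => h.parent_mem_desc_iff hx hxj
    have hforw : ∀ x, x ∈ verts Γ → x ≠ i →
        (GravityBG.join (GravityBG.branch Γ i j) (GravityBG.branch Γ j i) hij.ne).Adj x (p x) := by
      intro x hx hxi
      rw [join_adj, branch_eq_induce Γ i j, branch_eq_induce Γ j i, hv1, hv2,
        SimpleGraph.Subgraph.induce_adj, SimpleGraph.Subgraph.induce_adj, mem_coe, mem_coe,
        mem_coe, mem_coe, mem_sdiff, mem_sdiff]
      have hadj := h.adj_parent hx hxi
      have hpx := h.isRooted.parent_mem x hx
      by_cases hxj : x = j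
      · subst hxj
        exact Or.inr (Or.inr (Or.inr ⟨rfl, hp.symm⟩))
      · have := hside x hx hxj
        by_cases hxd : x ∈ desc (verts Γ) p j
        · exact Or.inr (Or.inl ⟨hxd, this.2 hxd, hadj⟩)
        · exact Or.inl ⟨⟨hx, hxd⟩, ⟨hpx, fun h' => hxd (this.1 h')⟩, hadj⟩
    constructor
    · rw [join_adj, branch_eq_induce Γ i j, branch_eq_induce Γ j i,
        SimpleGraph.Subgraph.induce_adj, SimpleGraph.Subgraph.induce_adj]
      rintro (⟨_, _, h'⟩ | ⟨_, _, h'⟩ | ⟨rfl, rfl⟩ | ⟨rfl, rfl⟩)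
      · exact h'
      · exact h'
      · exact hij
      · exact hij.symm
    · intro hxy
      rcases (h.adj_iff x y).1 hxy with ⟨hx, hxi, rfl⟩ | ⟨hy, hyi, rfl⟩
      · exact hforw x hx hxi
      · exact (hforw y hy hyi).symm

omit [DecidableEq ι] in
lemma mem_spanningTrees {K : Finset ι} : Γ ∈ spanningTrees K ↔ IsSubtree Γ ∧ verts Γ = K := by
  classical
  simp [spanningTrees]

open Classical in
/-- A spanning tree with an oriented edge is the same as a pair of trees on complementary sets of
vertices with a vertex of each. -/
lemma sum_spanningTrees_branch (K : Finset ι) (f : Graph ι → Graph ι → ι → ι → ℂ) :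
    ∑ Γ ∈ spanningTrees K, ∑ e : ι × ι with Γ.Adj e.1 e.2,
      f (branch Γ e.1 e.2) (branch Γ e.2 e.1) e.1 e.2 =
    ∑ I ∈ K.ssubsets.erase ∅, ∑ t ∈ spanningTrees I ×ˢ spanningTrees (K \ I),
      ∑ e ∈ I ×ˢ (K \ I), f t.1 t.2 e.1 e.2 := by
  have hne : ∀ {I : Finset ι} {e : ι × ι}, e ∈ I ×ˢ (K \ I) → e.1 ≠ e.2 := by
    intro I e he h'
    rw [mem_product, mem_sdiff] at he
    exact he.2.2 (h' ▸ he.1)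
  rw [sum_sigma', sum_sigma', sum_sigma']
  refine sum_bij' (fun a _ => ⟨⟨verts (branch a.1 a.2.1 a.2.2),
      (branch a.1 a.2.1 a.2.2, branch a.1 a.2.2 a.2.1)⟩, a.2⟩)
    (fun b hb => ⟨join b.1.2.1 b.1.2.2 (hne (mem_sigma.1 hb).2), b.2⟩) ?_ ?_ ?_ ?_ ?_
  · rintro ⟨Γ, i, j⟩ ha
    simp only [mem_sigma, mem_filter, mem_spanningTrees, mem_univ, true_and] at ha
    obtain ⟨⟨hΓ, rfl⟩, hij⟩ := ha
    obtain ⟨h1, h2, h3, h4, h5, h6, h7⟩ := hΓ.branch hij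
    simp only [mem_sigma, mem_product, mem_erase, mem_ssubsets, mem_spanningTrees]
    refine ⟨⟨⟨Nonempty.ne_empty ⟨i, h3⟩, ?_⟩, ⟨h1, trivial⟩, h2, h5⟩, h3, h5 ▸ h4⟩
    rw [h5] at h4
    exact Finset.ssubset_iff_subset_ne.2
      ⟨h6, fun h' => (mem_sdiff.1 h4).2 (h' ▸ (mem_sdiff.1 h4).1)⟩
  · rintro ⟨⟨I, Γ₁, Γ₂⟩, i, j⟩ hb
    have hij := hne (mem_sigma.1 hb).2
    simp only [mem_sigma, mem_product, mem_erase, mem_ssubsets, mem_spanningTrees] at hb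
    obtain ⟨⟨⟨hI, hIK⟩, ⟨h1, rfl⟩, h2, hv⟩, hi, hj⟩ := hb
    rw [← hv] at hj
    have hd : Disjoint (verts Γ₁) (verts Γ₂) := by rw [hv]; exact disjoint_sdiff
    simp only [mem_sigma, mem_filter, mem_spanningTrees, mem_univ, true_and]
    refine ⟨⟨h1.join h2 hd hi hj hij, ?_⟩, ?_⟩
    · rw [verts_join hij hi hj, hv, union_sdiff_of_subset hIK.subset]
    · rw [join_adj]
      exact Or.inr (Or.inr (Or.inl ⟨rfl, rfl⟩))
  · rintro ⟨Γ, i, j⟩ ha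
    simp only [mem_sigma, mem_filter, mem_spanningTrees, mem_univ, true_and] at ha
    obtain ⟨⟨hΓ, rfl⟩, hij⟩ := ha
    obtain ⟨h1, h2, h3, h4, h5, h6, h7⟩ := hΓ.branch hij
    simp only [h7]
  · rintro ⟨⟨I, Γ₁, Γ₂⟩, i, j⟩ hb
    have hij := hne (mem_sigma.1 hb).2
    simp only [mem_sigma, mem_product, mem_erase, mem_ssubsets, mem_spanningTrees] at hb
    obtain ⟨⟨⟨hI, hIK⟩, ⟨h1, rfl⟩, h2, hv⟩, hi, hj⟩ := hb
    rw [← hv] at hj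
    have hd : Disjoint (verts Γ₁) (verts Γ₂) := by rw [hv]; exact disjoint_sdiff
    obtain ⟨e1, e2⟩ := branch_join h1 h2 hd hi hj hij
    simp only [e1, e2]
  · intro a _
    rfl

end Join

/-! ### The weight of a tree -/

section TreeWeight

variable {ι : Type*} [Fintype ι] [DecidableEq ι] {D : SpinorData ι}
variable {Γ Γ₁ Γ₂ : Graph ι} {i j : ι}

open Classical in
omit [DecidableEq ι] in
lemma valency_eq_card (Γ : Graph ι) (v : ι) : valency Γ v = (univ.filter (Γ.Adj v)).card := by
  rw [valency, SimpleGraph.Subgraph.degree, ← Set.toFinset_card]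
  congr 1
  ext y
  simp

lemma valency_join (hd : Disjoint (verts Γ₁) (verts Γ₂)) (hj : j ∈ verts Γ₂) (hij : i ≠ j)
    {x : ι} (hx : x ∈ verts Γ₁) :
    valency (join Γ₁ Γ₂ hij) x = valency Γ₁ x + if x = i then 1 else 0 := by
  classical
  have hx2 : x ∉ verts Γ₂ := disjoint_left.1 hd hx
  have hxj : x ≠ j := fun h => hx2 (h ▸ hj)
  have hn : ∀ y, ¬ Γ₂.Adj x y := fun y h => hx2 (mem_verts.2 h.fst_mem)
  rw [valency_eq_card, valency_eq_card]
  split_ifs with hxi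
  · rw [← card_insert_of_notMem (a := j) (s := univ.filter (Γ₁.Adj x))]
    · congr 1
      ext y
      have hn' : ¬ Γ₂.Adj i y := hxi ▸ hn y
      simp only [mem_filter, mem_univ, true_and, mem_insert, join_adj, hn', hxi, hij, false_or,
        false_and, or_false]
      exact or_comm
    · rw [mem_filter]
      exact fun h => disjoint_left.1 hd (mem_verts.2 h.2.snd_mem) hj
  · rw [add_zero]
    congr 1
    ext y
    simp only [mem_filter, mem_univ, true_and, join_adj, hn, hxi, hxj, false_and, or_false]

omit [Fintype ι] [DecidableEq ι] in
lemma edgeWeight_mk (D : SpinorData ι) (i j : ι) : edgeWeight D s(i, j) =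
    br (D.lamBar i) (D.lamBar j) / br (D.lam i) (D.lam j) := rfl

lemma prod_verts_join (hq : ∀ v, br D.q (D.lam v) ≠ 0) (hd : Disjoint (verts Γ₁) (verts Γ₂))
    (hi : i ∈ verts Γ₁) (hj : j ∈ verts Γ₂) (hij : i ≠ j) :
    ∏ x ∈ verts Γ₁, br D.q (D.lam x) ^ (2 * (valency (join Γ₁ Γ₂ hij) x : ℤ) - 4) =
      (∏ x ∈ verts Γ₁, br D.q (D.lam x) ^ (2 * (valency Γ₁ x : ℤ) - 4)) *
        br D.q (D.lam i) ^ 2 := by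
  have e : ∀ x ∈ verts Γ₁, br D.q (D.lam x) ^ (2 * (valency (join Γ₁ Γ₂ hij) x : ℤ) - 4) =
      br D.q (D.lam x) ^ (2 * (valency Γ₁ x : ℤ) - 4) *
        if x = i then br D.q (D.lam x) ^ 2 else 1 := by
    intro x hx
    rw [valency_join hd hj hij hx]
    split_ifs with hxi
    · have : (2 * ((valency Γ₁ x + 1 : ℕ) : ℤ) - 4) = (2 * (valency Γ₁ x : ℤ) - 4) + (2 : ℕ) := by
        push_cast; ring
      rw [this, zpow_add₀ (hq x), zpow_natCast]
    · rw [add_zero, mul_one]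
  rw [prod_congr rfl e, prod_mul_distrib, prod_ite_eq' (verts Γ₁) i, if_pos hi]

/-- The new edge raises the valencies of `i` and of `j` by one. -/
lemma treeWeight_join (hq : ∀ v, br D.q (D.lam v) ≠ 0) (hd : Disjoint (verts Γ₁) (verts Γ₂))
    (hi : i ∈ verts Γ₁) (hj : j ∈ verts Γ₂) (hij : i ≠ j) :
    treeWeight D (join Γ₁ Γ₂ hij) = treeWeight D Γ₁ * treeWeight D Γ₂ *
      (br D.q (D.lam i) ^ 2 * br D.q (D.lam j) ^ 2 *
        (br (D.lamBar i) (D.lamBar j) / br (D.lam i) (D.lam j))) := by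
  classical
  have hE : (join Γ₁ Γ₂ hij).edgeSet.toFinset =
      insert s(i, j) (Γ₁.edgeSet.toFinset ∪ Γ₂.edgeSet.toFinset) := by
    ext e
    induction e using Sym2.ind with
    | _ x y =>
      simp only [Set.mem_toFinset, SimpleGraph.Subgraph.mem_edgeSet, mem_insert, mem_union,
        join_adj, Sym2.eq_iff]
      tauto
  have hdE : Disjoint Γ₁.edgeSet.toFinset Γ₂.edgeSet.toFinset := by
    rw [disjoint_left]
    intro e
    induction e using Sym2.ind with
    | _ x y =>
      simp only [Set.mem_toFinset, SimpleGraph.Subgraph.mem_edgeSet]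
      exact fun h1 h2 => disjoint_left.1 hd (mem_verts.2 h1.fst_mem) (mem_verts.2 h2.fst_mem)
  have hnE : s(i, j) ∉ Γ₁.edgeSet.toFinset ∪ Γ₂.edgeSet.toFinset := by
    simp only [mem_union, Set.mem_toFinset, SimpleGraph.Subgraph.mem_edgeSet]
    rintro (h | h)
    · exact disjoint_left.1 hd (mem_verts.2 h.snd_mem) hj
    · exact disjoint_left.1 hd hi (mem_verts.2 h.fst_mem)
  have h1 := prod_verts_join hq hd hi hj hij
  have h2 := prod_verts_join hq hd.symm hj hi hij.symm
  rw [← join_swap hij] at h2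
  rw [treeWeight, treeWeight, treeWeight, verts_join hij hi hj, prod_union hd, h1, h2, hE,
    prod_insert hnE, prod_union hdE, edgeWeight_mk]
  ring

open Classical in
/-- The edge terms of all the trees on `K` build up the vertex of the Berends–Giele recursion: for
fixed branches, with vertices `I` and `J`, the sum over the edges between them of the edge weights,
each with its factor from the recursion, is a second factor `(q|I|J|q)`. -/
lemma sum_cutTerm_mul_treeWeight (hq : ∀ v, br D.q (D.lam v) ≠ 0)
    (hlam : ∀ i j, i ≠ j → br (D.lam i) (D.lam j) ≠ 0) (K : Finset ι) (F : Graph ι → ℂ) :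
    ∑ Γ ∈ spanningTrees K, (∑ e : ι × ι with Γ.Adj e.1 e.2,
        cutTerm D Γ e.1 e.2 * F (branch Γ e.1 e.2)) * treeWeight D Γ =
      ∑ I ∈ K.ssubsets.erase ∅, sand D.q (D.tot I) (D.tot (K \ I)) D.q ^ 2 *
        (∑ Γ ∈ spanningTrees I, F Γ * treeWeight D Γ) *
          ∑ Γ ∈ spanningTrees (K \ I), treeWeight D Γ := by
  set f : Graph ι → Graph ι → ι → ι → ℂ := fun Γ₁ Γ₂ i j =>
    sand D.q (D.tot (verts Γ₁)) (D.tot (verts Γ₂)) D.q * F Γ₁ * treeWeight D Γ₁ *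
      treeWeight D Γ₂ * sand D.q (D.mom i) (D.mom j) D.q with hf
  have e1 : ∀ Γ ∈ spanningTrees K, (∑ e : ι × ι with Γ.Adj e.1 e.2,
      cutTerm D Γ e.1 e.2 * F (branch Γ e.1 e.2)) * treeWeight D Γ =
      ∑ e : ι × ι with Γ.Adj e.1 e.2, f (branch Γ e.1 e.2) (branch Γ e.2 e.1) e.1 e.2 := by
    intro Γ hΓ
    rw [sum_mul]
    refine sum_congr rfl ?_
    rintro ⟨i, j⟩ he
    obtain ⟨hΓ, -⟩ := mem_spanningTrees.1 hΓ
    have hij : Γ.Adj i j := (mem_filter.1 he).2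
    obtain ⟨h1, h2, h3, h4, h5, h6, h7⟩ := hΓ.branch hij
    have hd : Disjoint (verts (branch Γ i j)) (verts (branch Γ j i)) := by
      rw [h5]; exact disjoint_sdiff
    have hw := treeWeight_join hq hd h3 h4 hij.ne
    rw [h7] at hw
    have hi := hq i
    have hj := hq j
    have hl := hlam i j hij.ne
    rw [hw, cutTerm, hf]
    simp only [sand_mom_mom, br_swap (D.lam j) D.q]
    field_simp
  rw [sum_congr rfl e1, sum_spanningTrees_branch]
  refine sum_congr rfl fun I _ => ?_
  have e2 : ∀ t ∈ spanningTrees I ×ˢ spanningTrees (K \ I),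
      ∑ e ∈ I ×ˢ (K \ I), f t.1 t.2 e.1 e.2 =
      sand D.q (D.tot I) (D.tot (K \ I)) D.q ^ 2 *
        (F t.1 * treeWeight D t.1 * treeWeight D t.2) := by
    rintro ⟨Γ₁, Γ₂⟩ ht
    rw [mem_product, mem_spanningTrees, mem_spanningTrees] at ht
    obtain ⟨⟨_, h1⟩, _, h2⟩ := ht
    simp only at h1 h2
    rw [hf]
    simp only [h1, h2]
    rw [← mul_sum, sum_product]
    have : ∑ x ∈ I, ∑ y ∈ K \ I, sand D.q (D.mom x) (D.mom y) D.q =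
        sand D.q (D.tot I) (D.tot (K \ I)) D.q := by
      rw [SpinorData.tot, sand_sum_left]
      refine sum_congr rfl fun x _ => ?_
      rw [SpinorData.tot, sand_sum_right]
    rw [this]
    ring
  rw [sum_congr rfl e2, ← mul_sum, sum_product, mul_assoc, sum_mul_sum]

end TreeWeight

/-! ### The currents as sums over trees -/

section Currents

variable {ι : Type*} [Fintype ι] [DecidableEq ι] {D : SpinorData ι} {Γ : Graph ι}

open Classical in
lemma GraphRooted.sum_adj {r : ι} {p : ι → ι} {d : ι → ℕ} (h : GraphRooted Γ r p d)
    (f : ι → ι → ℂ) : ∑ e : ι × ι with Γ.Adj e.1 e.2, f e.1 e.2 =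
      ∑ j ∈ (verts Γ).erase r, (f (p j) j + f j (p j)) := by
  have hset : (univ.filter fun e : ι × ι => Γ.Adj e.1 e.2) =
      ((verts Γ).erase r).image (fun j => (p j, j)) ∪
        ((verts Γ).erase r).image (fun j => (j, p j)) := by
    ext ⟨i, j⟩
    simp only [mem_filter, mem_univ, true_and, mem_union, mem_image, mem_erase, Prod.mk.injEq,
      h.adj_iff]
    constructor
    · rintro (⟨h1, h2, h3⟩ | ⟨h1, h2, h3⟩)
      · exact Or.inr ⟨i, ⟨h2, h1⟩, rfl, h3.symm⟩
      · exact Or.inl ⟨j, ⟨h2, h1⟩, h3.symm, rfl⟩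
    · rintro (⟨x, ⟨h1, h2⟩, rfl, rfl⟩ | ⟨x, ⟨h1, h2⟩, rfl, rfl⟩)
      · exact Or.inr ⟨h2, h1, rfl⟩
      · exact Or.inl ⟨h2, h1, rfl⟩
  rw [hset, sum_union, sum_image, sum_image, sum_add_distrib]
  · exact fun x _ y _ hxy => (Prod.ext_iff.1 hxy).1
  · exact fun x _ y _ hxy => (Prod.ext_iff.1 hxy).2
  · rw [disjoint_left]
    rintro ⟨i, j⟩ h1 h2
    simp only [mem_image, mem_erase, Prod.mk.injEq] at h1 h2
    obtain ⟨x, ⟨hxr, hx⟩, rfl, rfl⟩ := h1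
    obtain ⟨y, _, hy, hyp⟩ := h2
    rw [hy] at hyp
    exact h.isRooted.iterate_parent_ne hx hxr 1 hyp

omit [DecidableEq ι] in
lemma cutTerm_swap (D : SpinorData ι) (Γ : Graph ι) (i j : ι) :
    cutTerm D Γ i j = cutTerm D Γ j i := by
  rw [cutTerm, cutTerm, sand_swap, br_swap (D.lam i) (D.lam j), br_swap D.q (D.lam i),
    br_swap (D.lam j) D.q]
  ring

open Classical in
/-- Every tree on `K` decomposes `K²` into terms of its edges. -/
lemma msq_tot_eq_sum_cutTerm (hq : ∀ v, br D.q (D.lam v) ≠ 0) (hΓ : IsSubtree Γ)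
    (hne : (verts Γ).Nonempty) :
    msq (D.tot (verts Γ)) = 1 / 2 * ∑ e : ι × ι with Γ.Adj e.1 e.2, cutTerm D Γ e.1 e.2 := by
  obtain ⟨r, hr⟩ := hne
  obtain ⟨p, d, h⟩ := hΓ.exists_graphRooted hr
  have hX : IsClosedBelow (verts Γ) r p {r} :=
    ⟨singleton_subset_iff.2 hr, mem_singleton_self r, fun x hx => by
      rw [mem_singleton] at hx ⊢; rw [hx, h.isRooted.parent_root]⟩
  have hg : ∀ x ∈ verts Γ, gate p {r} x = r := fun x hx => mem_singleton.1
    (h.isRooted.gate_mem (h.isRooted.exists_iterate_mem (mem_singleton_self r) hx))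
  have h1 : ∑ j ∈ verts Γ \ {r}, cutTerm D Γ (p j) j =
      -∑ x ∈ verts Γ, sand D.q (D.tot (verts Γ)) (D.mom x) D.q * br (nlam D r) (nlam D x) := by
    rw [h.sum_cutTerm_parent hq hX]
    exact congrArg _ (sum_congr rfl fun x hx => by rw [hg x hx])
  have h2 := msq_add_sum_smul (D := D) (D.tot (verts Γ)) (fun x => br (nlam D r) (nlam D x))
    (verts Γ)
  -- all spinors are turned into that of the root, so the total momentum becomes null
  have h3 : msq (D.tot (verts Γ) + ∑ x ∈ verts Γ, (br (nlam D r) (nlam D x) * br D.q (D.lam x)) •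
      Matrix.vecMulVec D.q (D.lamBar x)) = 0 := by
    rw [SpinorData.tot, ← sum_add_distrib,
      sum_congr rfl fun x _ => (moved_eq hq r x).symm, msq_eq]
    simp only [Matrix.sum_apply, moved_apply, ← mul_sum]
    ring
  have h4 : ∀ j ∈ (verts Γ).erase r, cutTerm D Γ (p j) j + cutTerm D Γ j (p j) =
      2 * cutTerm D Γ (p j) j := fun j _ => by rw [cutTerm_swap D Γ j]; ring
  rw [h.sum_adj, sum_congr rfl h4, ← mul_sum, ← sdiff_singleton_eq_erase]
  linear_combination h3 - h2 - h1

lemma spanningTrees_singleton (i : ι) :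
    spanningTrees ({i} : Finset ι) = {SimpleGraph.singletonSubgraph ⊤ i} := by
  ext Γ
  rw [mem_spanningTrees, mem_singleton]
  constructor
  · rintro ⟨_, hv⟩
    have hv' : ∀ x, x ∈ Γ.verts ↔ x = i := fun x => by rw [← mem_verts, hv, mem_singleton]
    ext x y
    · rw [hv', SimpleGraph.singletonSubgraph_verts, Set.mem_singleton_iff]
    · rw [SimpleGraph.singletonSubgraph_adj]
      refine ⟨fun hxy => hxy.ne ?_, fun h => absurd h (by simp)⟩
      rw [(hv' x).1 hxy.fst_mem, (hv' y).1 hxy.snd_mem]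
  · rintro rfl
    have hv : verts (SimpleGraph.singletonSubgraph (⊤ : SimpleGraph ι) i) = {i} := by
      ext x
      rw [mem_verts, SimpleGraph.singletonSubgraph_verts, Set.mem_singleton_iff, mem_singleton]
    have h : GraphRooted (SimpleGraph.singletonSubgraph (⊤ : SimpleGraph ι) i) i (fun _ => i)
        (fun _ => 0) := by
      refine ⟨⟨?_, rfl, ?_, ?_⟩, ?_⟩
      · simp [hv]
      · simp [hv]
      · intro x hx hxi
        rw [hv, mem_singleton] at hx
        exact absurd hx hxi
      · intro x y
        rw [hv, mem_singleton, mem_singleton]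
        simp
        tauto
    exact ⟨h.isSubtree, hv⟩

omit [DecidableEq ι] in
lemma treeWeight_singleton (i : ι) : treeWeight D (SimpleGraph.singletonSubgraph ⊤ i) =
    1 / br D.q (D.lam i) ^ 4 := by
  classical
  have hv : verts (SimpleGraph.singletonSubgraph (⊤ : SimpleGraph ι) i) = {i} := by
    ext x
    rw [mem_verts, SimpleGraph.singletonSubgraph_verts, Set.mem_singleton_iff, mem_singleton]
  have hval : valency (SimpleGraph.singletonSubgraph (⊤ : SimpleGraph ι) i) i = 0 := by
    rw [valency_eq_card, card_eq_zero, filter_eq_empty_iff]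
    simp
  have hE : (SimpleGraph.singletonSubgraph (⊤ : SimpleGraph ι) i).edgeSet.toFinset = ∅ := by
    simp
  rw [treeWeight, hv, prod_singleton, hval, hE, prod_empty, mul_one, one_div]
  have : (2 * ((0 : ℕ) : ℤ) - 4) = -((4 : ℕ) : ℤ) := by norm_num
  rw [this, zpow_neg, zpow_natCast]

/-- The all-plus current is the sum over the spanning trees. -/
theorem allPlus_eq_sum_treeWeight (hq : ∀ v, br D.q (D.lam v) ≠ 0)
    (hlam : ∀ i j, i ≠ j → br (D.lam i) (D.lam j) ≠ 0)
    (hplus : ∀ S : Finset ι, 2 ≤ S.card → msq (D.tot S) ≠ 0) (K : Finset ι) (hK : K.Nonempty) :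
    allPlus D K = ∑ Γ ∈ spanningTrees K, treeWeight D Γ := by
  classical
  induction K using Finset.strongInduction with
  | H K ih =>
  rw [allPlus]
  split_ifs with h1
  · obtain ⟨i, rfl⟩ := card_eq_one.1 h1
    rw [prod_singleton, spanningTrees_singleton, sum_singleton, treeWeight_singleton]
  have h2 : 2 ≤ K.card := by
    have := hK.card_pos
    omega
  have hm := hplus K h2
  rw [sum_attach (K.ssubsets.erase ∅) (fun I =>
    (sand D.q (D.tot I) (D.tot (K \ I)) D.q) ^ 2 * allPlus D I * allPlus D (K \ I))]
  have e1 : ∀ I ∈ K.ssubsets.erase ∅,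
      (sand D.q (D.tot I) (D.tot (K \ I)) D.q) ^ 2 * allPlus D I * allPlus D (K \ I) =
      sand D.q (D.tot I) (D.tot (K \ I)) D.q ^ 2 *
        (∑ Γ ∈ spanningTrees I, 1 * treeWeight D Γ) *
          ∑ Γ ∈ spanningTrees (K \ I), treeWeight D Γ := by
    intro I hI
    rw [mem_erase, mem_ssubsets] at hI
    simp only [one_mul]
    rw [ih I hI.2 (nonempty_iff_ne_empty.2 hI.1),
      ih (K \ I) (sdiff_ssubset hI.2.subset (nonempty_iff_ne_empty.2 hI.1))
        (sdiff_nonempty.2 hI.2.not_subset)]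
  rw [sum_congr rfl e1, ← sum_cutTerm_mul_treeWeight hq hlam K (fun _ => 1),
    one_div, inv_mul_eq_iff_eq_mul₀ hm, mul_sum, mul_sum]
  refine sum_congr rfl fun Γ hΓ => ?_
  obtain ⟨hs, hv⟩ := mem_spanningTrees.1 hΓ
  rw [← hv, msq_tot_eq_sum_cutTerm hq hs (by rwa [hv])]
  simp only [mul_one, mul_assoc]

/-- Summing the recursion for `Φ` over all the trees on `K`, with the weights `J(Γ)`, gives the
Berends–Giele recursion. -/
theorem allButOnePlus_eq_sum_bigPhi (hq : ∀ v, br D.q (D.lam v) ≠ 0)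
    (hlam : ∀ i j, i ≠ j → br (D.lam i) (D.lam j) ≠ 0)
    (hplus : ∀ S : Finset ι, 2 ≤ S.card → msq (D.tot S) ≠ 0)
    (hD : ∀ S : Finset ι, S.Nonempty → den D S ≠ 0)
    (hp : br D.oneBar D.p ≠ 0) {δ : (Γ : Graph ι) → Fin (numEnds Γ - 2) → ι}
    (hδ : ∀ Γ : Graph ι, IsSubtree Γ → 3 ≤ (verts Γ).card → IsDeltaEnumeration Γ (δ Γ))
    (K : Finset ι) (hK : K.Nonempty) :
    allButOnePlus D K = ∑ Γ ∈ spanningTrees K, bigPhi D δ Γ * treeWeight D Γ := by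
  classical
  induction K using Finset.strongInduction with
  | H K ih =>
  rw [allButOnePlus]
  have hm : msq (D.tot1 K) ≠ 0 := hD K hK
  rw [sum_attach (K.ssubsets.erase ∅) (fun I =>
    (sand D.q (D.tot I) (D.tot (K \ I)) D.q) ^ 2 * allButOnePlus D I * allPlus D (K \ I))]
  have e1 : ∀ I ∈ K.ssubsets.erase ∅,
      (sand D.q (D.tot I) (D.tot (K \ I)) D.q) ^ 2 * allButOnePlus D I * allPlus D (K \ I) =
      sand D.q (D.tot I) (D.tot (K \ I)) D.q ^ 2 *
        (∑ Γ ∈ spanningTrees I, bigPhi D δ Γ * treeWeight D Γ) *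
          ∑ Γ ∈ spanningTrees (K \ I), treeWeight D Γ := by
    intro I hI
    rw [mem_erase, mem_ssubsets] at hI
    rw [ih I hI.2 (nonempty_iff_ne_empty.2 hI.1), allPlus_eq_sum_treeWeight hq hlam hplus (K \ I)
      (sdiff_nonempty.2 hI.2.not_subset)]
  rw [sum_congr rfl e1, ← sum_cutTerm_mul_treeWeight hq hlam K (bigPhi D δ),
    allPlus_eq_sum_treeWeight hq hlam hplus K hK, one_div, inv_mul_eq_iff_eq_mul₀ hm, mul_sum,
    mul_sum, ← sum_add_distrib]
  refine sum_congr rfl fun Γ hΓ => ?_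
  obtain ⟨hs, hv⟩ := mem_spanningTrees.1 hΓ
  have := bigPhi_recursion hq hD hp hδ hs
  rw [den, hv] at this
  rw [← mul_assoc, this, add_mul]

end Currents

end GravityBG

open GravityBG in
open Classical in
theorem mainTheorem1 {ι : Type*} [Fintype ι] [DecidableEq ι] (D : SpinorData ι)
    (hp : br D.oneBar D.p ≠ 0)
    (hplus : ∀ S : Finset ι, 2 ≤ S.card → msq (D.tot S) ≠ 0)
    (hminus : ∀ S : Finset ι, S.Nonempty → msq (D.tot1 S) ≠ 0) :
    -- `Δ` has `E - 2` elements
    (∀ Γ : Graph ι, IsSubtree Γ → 3 ≤ (verts Γ).card →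
      Multiset.card (delta Γ) + 2 = numEnds Γ) ∧
    -- `φ(Γ)` does not depend on the order in which the elements of `Δ` are taken
    (∀ Γ : Graph ι, IsSubtree Γ → 3 ≤ (verts Γ).card →
      ∀ δ δ' : Fin (numEnds Γ - 2) → ι, IsDeltaEnumeration Γ δ → IsDeltaEnumeration Γ δ' →
        phi D Γ δ = phi D Γ δ') ∧
    ∀ δ : (Γ : Graph ι) → Fin (numEnds Γ - 2) → ι,
      (∀ Γ : Graph ι, IsSubtree Γ → 3 ≤ (verts Γ).card → IsDeltaEnumeration Γ (δ Γ)) →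
      -- `Φ` satisfies the recursion tree by tree; each edge `ij` occurs as `(i, j)` and `(j, i)`
      (∀ Γ : Graph ι, IsSubtree Γ →
        bigPhi D δ Γ = 1 / msq (D.tot1 (verts Γ)) *
          ((sand1 D.q (D.tot (verts Γ)) D.p) ^ 2 / (br D.oneBar D.p) ^ 2 +
            ∑ e : ι × ι with Γ.Adj e.1 e.2,
              sand D.q (D.tot (verts (branch Γ e.1 e.2))) (D.tot (verts (branch Γ e.2 e.1))) D.q *
                (br (D.lam e.1) (D.lam e.2) /
                  (br D.q (D.lam e.1) * br (D.lam e.2) D.q)) *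
                bigPhi D δ (branch Γ e.1 e.2))) ∧
      -- the all-but-one-plus current is the sum over spanning trees
      (∀ K : Finset ι, K.Nonempty →
        allButOnePlus D K = ∑ Γ ∈ spanningTrees K, bigPhi D δ Γ * treeWeight D Γ) := by
  have hD : ∀ S : Finset ι, S.Nonempty → den D S ≠ 0 := hminus
  -- `(1 + v)²` is the product of `(q v)` and `[1 v]`
  have hq : ∀ v, br D.q (D.lam v) ≠ 0 := by
    intro v hv
    refine hD {v} (singleton_nonempty v) ?_
    rw [den_singleton, hv, zero_mul]
  have hlam : ∀ i j, i ≠ j → br (D.lam i) (D.lam j) ≠ 0 := by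
    intro i j hij h
    refine hplus {i, j} (by rw [card_pair hij]) ?_
    have : msq (D.tot {i, j}) = br (D.lam i) (D.lam j) * br (D.lamBar i) (D.lamBar j) := by
      rw [SpinorData.tot, sum_pair hij]
      simp only [msq_eq, Matrix.add_apply, mom_apply, br_eq]
      ring
    rw [this, h, zero_mul]
  refine ⟨fun Γ hΓ h3 => ?_, fun Γ hΓ h3 δ δ' hδ hδ' => ?_, fun δ hδ =>
    ⟨fun Γ hΓ => ?_, fun K hK => ?_⟩⟩
  · obtain ⟨r, hr⟩ := card_pos.1 (by omega : 0 < (verts Γ).card)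
    obtain ⟨p, d, h⟩ := hΓ.exists_graphRooted hr
    exact h.card_delta (by omega)
  · rw [phi_eq_flow hD hΓ h3 hδ, phi_eq_flow hD hΓ h3 hδ']
  · have hne : (verts Γ).Nonempty := by
      obtain ⟨v⟩ := hΓ.1.nonempty
      exact ⟨v, mem_verts.2 v.2⟩
    have h := bigPhi_recursion hq hD hp hδ hΓ
    rw [one_div, eq_inv_mul_iff_mul_eq₀ (hminus _ hne)]
    exact h
  · exact allButOnePlus_eq_sum_bigPhi hq hlam hplus hD hp hδ K hK
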